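/- An (unweighted) election system ${\cal E}$ maps each pair $(C,V)$, where $C$ is a finite candidate set and $V$ a finite collection of votes (each consisting of a voter name and a total order over $C$), to a possibly empty winner set $W_{\cal E}(C,V)\subseteq C$. Candidate and voter names are binary strings. If the votes carry binary nonnegative integer weights, $W_{\cal E}(C,V)$ is the winner set of the election in which each vote of weight $w$ is replaced by $w$ unweighted copies of it. The unweighted (respectively, weighted) winner problem of ${\cal E}$ is the set of all triples $(C,V,c)$ such that $c\in C$ and $c\in W_{\cal E}(C,V)$, for unweighted (respectively, weighted) $V$. An online bribery setting is a tuple $(C,(V_{<u},u,V_{>u}),\sigma,d,k)$: a candidate set $C$; the list $V_{<u}$ of the voters who voted before $u$, in voting order, each with the ballot cast and a bit saying whether it was bribed; the current voter $u$ with the vote $u$ casts unless bribed; the list $V_{>u}$ of the voters still to come, in voting order; the briber's total order $\sigma$ over $C$; a distinguished candidate $d\in C$; and a nonnegative integer $k$. In priced (respectively, weighted) problems every voter also comes with a price (respectively, a weight), a nonnegative integer in binary; in unpriced problems each bribe costs $1$, and in unweighted problems there are no weights. The voters $u$ and those of $V_{>u}$ vote one after another. When a voter's vote is revealed, the briber,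 knowing only what has been revealed so far, either leaves the vote as it is or bribes the voter, replacing the vote by any total order over $C$; the total cost of all bribes, including those recorded in $V_{<u}$, must never exceed $k$. A setting is a yes-instance if the briber has a legal choice for $u$ such that, for each vote that the next voter may be revealed to have, the briber has a legal choice, and so on through the last voter, such that the final collection $U'$ of cast votes satisfies the briber's goal. In the constructive problems the goal is $W_{\cal E}(C,U')\cap\{c\mid c\ge_\sigma d\}\ne\emptyset$; in the destructive problems it is $W_{\cal E}(C,U')\cap\{c\mid d\ge_\sigma c\}=\emptyset$. **Theorem 1.** 1. For each election system ${\cal E}$ whose unweighted winner problem is in $\mathrm{P}$ (or even in $\mathrm{PSPACE}$), each of the four unweighted online bribery problems of ${\cal E}$ (unpriced or priced, constructive or destructive) is in $\mathrm{PSPACE}$. 2. For each election system ${\cal E}$ whose weighted winner problem is in $\mathrm{P}$ (or even in $\mathrm{PSPACE}$), each of the four weighted online bribery problems of ${\cal E}$ (unpriced or priced, constructive or destructive) is in $\mathrm{PSPACE}$. -/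

import Mathlib

namespace OnlineBribery

open Computability Turing

/-! ## The complexity classes, for the multi-stack Turing machines `Turing.FinTM2` -/

section Classes

open Classical in
/-- The class `P`: the languages whose characteristic function is computed by a deterministic
Turing machine in polynomial time. -/
def PTIME {Γ : Type} : Set (Language Γ) :=
  {L | Nonempty (TM2ComputableInPolyTime (α := List Γ) (β := Bool) id encodeBool
    fun s => decide (s ∈ L))}

open Classical in
/-- A deterministic Turing machine that halts on every input `s` with the answer to `s ∈ L` as its
output and that, in every configuration it passes through on the way, has on each of its finitely
many stacks (the input stack included) at most polynomially many symbols. -/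
structure DecidesInPolySpace {Γ : Type} (L : Language Γ) extends TM2ComputableAux Γ Bool where
  /-- the polynomial space bound -/
  space : Polynomial ℕ
  outputsFun : ∀ s : List Γ, TM2Outputs tm (s.map inputAlphabet.invFun)
    (some ((encodeBool (decide (s ∈ L))).map outputAlphabet.invFun))
  space_le : ∀ (s : List Γ) (c : tm.Cfg),
    StateTransition.Reaches tm.step (initList tm (s.map inputAlphabet.invFun)) c →
      ∀ k : tm.K, (TM2.Cfg.stk c k).length ≤ space.eval s.length

/-- The class `PSPACE`: the languages decided by a deterministic Turing machine in polynomial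
space. -/
def PSPACE {Γ : Type} : Set (Language Γ) :=
  {L | Nonempty (DecidesInPolySpace L)}

end Classes

/-! ## Elections -/

/-- Names of candidates and of voters are binary strings. -/
abbrev Name : Type := List Bool

/-- A total order over the candidate set `C`, given as the list of all candidates from the most
preferred to the least preferred one. -/
abbrev Ranking (C : Finset Name) : Type := {l : List Name // l.Nodup ∧ l.toFinset = C}

/-- `σ.WeaklyPrefers a b` says that `a ≥ b` in the order `σ`. -/
def Ranking.WeaklyPrefers {C : Finset Name} (σ : Ranking C) (a b : Name) : Prop :=
  σ.1.idxOf a ≤ σ.1.idxOf b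

/-- An (unweighted) vote: a voter name and a preference order. -/
abbrev Vote (C : Finset Name) : Type := Name × Ranking C

/-- An election system maps a candidate set and a collection of votes to a set of winners, which
may be empty. It may depend on the names, and need not be neutral or anonymous. -/
structure ElectionSystem where
  winners : (C : Finset Name) → Multiset (Vote C) → Finset Name
  winners_subset : ∀ (C : Finset Name) (V : Multiset (Vote C)), winners C V ⊆ C

/-! ## Encodings

Bit strings are closed by a comma, numbers are written in binary, lists are put in brackets, and
tuples are concatenated. -/

def encName (x : Name) : List Γ' := x.map Γ'.bit ++ [Γ'.comma]

def encNat (n : ℕ) : List Γ' := encName (encodeNat n)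

def encList {α : Type} (e : α → List Γ') (l : List α) : List Γ' :=
  Γ'.bra :: l.flatMap e ++ [Γ'.ket]

/-- A number attached to a voter (a price or a weight): the type of the data that the input holds
for it, the number that they stand for, and their encoding. -/
structure Attribute where
  Data : Type
  val : Data → ℕ
  enc : Data → List Γ'

/-- The attribute is part of the input: a nonnegative integer in binary. -/
def Attribute.given : Attribute := ⟨ℕ, id, encNat⟩

/-- The attribute is absent from the input and is `1` for every voter: each bribe counts one in the
unpriced setting, and each vote counts once in the unweighted setting. -/
def Attribute.absent : Attribute := ⟨Unit, fun _ => 1, fun _ => []⟩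

/-- A vote that carries a weight: voter name, weight, preference order. -/
abbrev WVote (w : Attribute) (C : Finset Name) : Type := Name × w.Data × Ranking C

/-- Each vote of weight `n` is replaced by `n` copies of it. -/
def expand {w : Attribute} {C : Finset Name} (V : List (WVote w C)) : Multiset (Vote C) :=
  (V.flatMap fun v => List.replicate (w.val v.2.1) (v.1, v.2.2) : List (Vote C))

/-- The winner problem (weighted for `Attribute.given`, unweighted for `Attribute.absent`): the
encodings of the triples `(C, V, c)` such that `c ∈ C` is a winner of the election `(C, V)`. The
set `C` is encoded through any list `L` of its members without repetitions. -/
def winnerProblem (E : ElectionSystem) (w : Attribute) : Language Γ' :=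
  {s | ∃ (C : Finset Name) (L : List Name) (V : List (WVote w C)) (c : Name),
    L.Nodup ∧ L.toFinset = C ∧ c ∈ C ∧ c ∈ E.winners C (expand V) ∧
    s = encList encName L ++
      encList (fun v => encName v.1 ++ w.enc v.2.1 ++ encList encName v.2.2.1) V ++
      encName c}

/-! ## Online bribery settings -/

/-- A voter, with price (if priced) and weight (if weighted). -/
structure Voter (p w : Attribute) where
  name : Name
  price : p.Data
  weight : w.Data

/-- A voter together with the vote that he or she casts. -/
def Voter.cast {p w : Attribute} {C : Finset Name} (v : Voter p w) (τ : Ranking C) : WVote w C :=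
  (v.name, v.weight, τ)

/-- A voter who has already voted: the voter, the ballot cast, and whether it was bribed. -/
structure PastVoter (p w : Attribute) (C : Finset Name) extends Voter p w where
  ballot : Ranking C
  bribed : Bool

/-- An online bribery setting `(C, (V_{<u}, u, V_{>u}), σ, d, k)`. -/
structure OBS (p w : Attribute) where
  /-- the candidates -/
  C : Finset Name
  /-- the voters before `u`, in voting order -/
  past : List (PastVoter p w C)
  /-- the current voter `u` -/
  current : Voter p w
  /-- the vote that `u` casts unless bribed -/
  ballot : Ranking C
  /-- the voters after `u`, in voting order -/
  future : List (Voter p w)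
  /-- the preference order of the briber -/
  σ : Ranking C
  /-- the distinguished candidate -/
  d : Name
  d_mem : d ∈ C
  /-- the bribe limit or budget -/
  k : ℕ

def encVoter {p w : Attribute} (v : Voter p w) : List Γ' :=
  encName v.name ++ p.enc v.price ++ w.enc v.weight

def encPastVoter {p w : Attribute} {C : Finset Name} (v : PastVoter p w C) : List Γ' :=
  encVoter v.toVoter ++ encList encName v.ballot.1 ++ [Γ'.bit v.bribed]

/-- The encoding of a setting, with its candidate set listed as `L`. -/
def OBS.enc {p w : Attribute} (I : OBS p w) (L : List Name) : List Γ' :=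
  encList encName L ++ encList encPastVoter I.past ++
    (encVoter I.current ++ encList encName I.ballot.1) ++ encList encVoter I.future ++
    encList encName I.σ.1 ++ encName I.d ++ encNat I.k

/-! ## The decision process -/

section Decisions

variable {p w : Attribute} {C : Finset Name}

/-- The voter `v` is about to cast `τ`, after the bribes so far have cost `spent` and the votes `U`
have been cast. The briber has a legal choice (to let `v` vote `τ`, or to pay for `v` and choose
the vote that `v` casts), after which `next` holds of the new total cost and cast votes. -/
def HasGoodChoice (k : ℕ) (next : ℕ → List (WVote w C) → Prop)
    (v : Voter p w) (τ : Ranking C) (spent : ℕ) (U : List (WVote w C)) : Prop :=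
  (spent ≤ k ∧ next spent (U ++ [v.cast τ])) ∨
  (spent + p.val v.price ≤ k ∧
    ∃ τ' : Ranking C, next (spent + p.val v.price) (U ++ [v.cast τ']))

/-- The briber can reach `goal` against all votes that the remaining voters may be revealed to
have: these votes are revealed one by one, and the briber reacts to each of them at once. -/
def CanEnsure (k : ℕ) (goal : Multiset (Vote C) → Prop) :
    List (Voter p w) → ℕ → List (WVote w C) → Prop
  | [], _, U => goal (expand U)
  | v :: vs, spent, U =>
      ∀ τ : Ranking C, HasGoodChoice k (fun s U' => CanEnsure k goal vs s U') v τ spent U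

end Decisions

/-- The total cost of the bribes made before `u` votes. -/
def OBS.spent {p w : Attribute} (I : OBS p w) : ℕ :=
  (I.past.map fun v => if v.bribed then p.val v.price else 0).sum

/-- The votes cast before `u` votes. -/
def OBS.castVotes {p w : Attribute} (I : OBS p w) : List (WVote w I.C) :=
  I.past.map fun v => v.toVoter.cast v.ballot

/-- The briber, at the decision about `u`, can ensure `goal`. -/
def OBS.Succeeds {p w : Attribute} (I : OBS p w) (goal : Multiset (Vote I.C) → Prop) : Prop :=
  HasGoodChoice I.k (CanEnsure I.k goal I.future) I.current I.ballot I.spent I.castVotes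

/-- Some winner is liked by the briber at least as much as `d`. -/
def OBS.ConstructiveGoal {p w : Attribute} (E : ElectionSystem) (I : OBS p w)
    (U : Multiset (Vote I.C)) : Prop :=
  ∃ c ∈ E.winners I.C U, I.σ.WeaklyPrefers c I.d

/-- No winner is hated by the briber as much as `d` or more. -/
def OBS.DestructiveGoal {p w : Attribute} (E : ElectionSystem) (I : OBS p w)
    (U : Multiset (Vote I.C)) : Prop :=
  ∀ c ∈ E.winners I.C U, ¬ I.σ.WeaklyPrefers I.d c

/-- The constructive problem with prices `p` and weights `w`. -/
def constructiveProblem (E : ElectionSystem) (p w : Attribute) : Language Γ' :=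
  {s | ∃ (I : OBS p w) (L : List Name), L.Nodup ∧ L.toFinset = I.C ∧
    I.Succeeds (I.ConstructiveGoal E) ∧ s = I.enc L}

/-- The destructive problem with prices `p` and weights `w`. -/
def destructiveProblem (E : ElectionSystem) (p w : Attribute) : Language Γ' :=
  {s | ∃ (I : OBS p w) (L : List Name), L.Nodup ∧ L.toFinset = I.C ∧
    I.Succeeds (I.DestructiveGoal E) ∧ s = I.enc L}

/-! ## The winner problems and the eight bribery problems -/

def unweightedWinnerProblem (E : ElectionSystem) : Language Γ' := winnerProblem E .absent

def weightedWinnerProblem (E : ElectionSystem) : Language Γ' := winnerProblem E .given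

/-- unpriced, unweighted, constructive -/
def onlineBribery (E : ElectionSystem) : Language Γ' := constructiveProblem E .absent .absent

/-- unpriced, unweighted, destructive -/
def onlineDestructiveBribery (E : ElectionSystem) : Language Γ' :=
  destructiveProblem E .absent .absent

/-- priced, unweighted, constructive -/
def onlinePricedBribery (E : ElectionSystem) : Language Γ' := constructiveProblem E .given .absent

/-- priced, unweighted, destructive -/
def onlineDestructivePricedBribery (E : ElectionSystem) : Language Γ' :=
  destructiveProblem E .given .absent

/-- unpriced, weighted, constructive -/
def onlineWeightedBribery (E : ElectionSystem) : Language Γ' := constructiveProblem E .absent .given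

/-- unpriced, weighted, destructive -/
def onlineDestructiveWeightedBribery (E : ElectionSystem) : Language Γ' :=
  destructiveProblem E .absent .given

/-- priced, weighted, constructive -/
def onlinePricedWeightedBribery (E : ElectionSystem) : Language Γ' :=
  constructiveProblem E .given .given

/-- priced, weighted, destructive -/
def onlineDestructivePricedWeightedBribery (E : ElectionSystem) : Language Γ' :=
  destructiveProblem E .given .given

end OnlineBribery

/-! The remaining decisions form a game between the briber and nature, who reveals the votes. Its
value is the value of an and-or tree. Two changes make this tree shallow and narrow enough. In
`CanEnsure` the alternative "bribe" does not depend on the revealed vote, so the quantifier over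
that vote moves inside the disjunction. The briber may therefore decide whether to bribe before the
vote is known, and then either nature or the briber chooses the whole vote (`ensures_iff`). A vote
is chosen candidate by candidate, so a node has polynomially many children instead of one child per
order (`forall_orders`, `exists_orders`). The depth is then polynomial (`Pos.rank_kids_lt`), and so
is the size of each position (`Pos.potential_kids_le`). Weights stay in binary and votes are never
expanded; of the costs only the running total is kept.

Depth-first search stores one branch together with the siblings still to be visited. It thus needs
polynomial space, although it may run for exponentially many steps (`path_dfs`, `PS.dfs`). At a leaf
the goal is tested by asking the machine for the winner problem about each relevant candidate. The
queries have polynomial length, and the space of one query is reused for the next (`maps_oracle`). A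
winner problem in P is also in PSPACE, because a step pushes boundedly many symbols
(`PTIME_subset_PSPACE`).

Most of the work is to exhibit an actual stack machine. Programs are fragments of machine code,
composed by sequencing, branching and loops, and each run carries a bound on all stacks. Data are
binary trees in prefix notation on a main stack. The functions computed in this way (`Maps`, and
`PS` for encoded types) are closed under composition, pairing, case distinction, and loops whose
states have polynomial size, whatever the number of rounds (`Maps.loop`). List operations, binary
arithmetic, parsers and the search are derived from these closure properties, and
`mem_PSPACE_of_maps` turns the final program into a machine.

The program parses its input into plain tuples of lists, checks that they represent a setting and
that encoding them again gives back the input, and then evaluates the game (`decideOBS_iff`). -/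

namespace OnlineBribery

open Computability Turing

/-! ### Space-bounded runs and structured machine programs. -/

section

/-! ## Bounded runs of transition systems -/

/-- A finite run of a transition function that stays inside `P`. -/
inductive Path {C : Type*} (step : C → Option C) (P : C → Prop) : C → C → Prop
  | refl {c : C} : P c → Path step P c c
  | head {c c' c'' : C} : P c → step c = some c' → Path step P c' c'' → Path step P c c''

namespace Path

variable {C C' : Type*} {step : C → Option C} {step' : C' → Option C'} {P Q : C → Prop}
  {P' : C' → Prop}

theorem trans {a b c : C} (h : Path step P a b) (h' : Path step P b c) : Path step P a c := by
  induction h with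
  | refl _ => exact h'
  | head hp hs _ ih => exact .head hp hs (ih h')

theorem mono {a b : C} (h : Path step P a b) (hPQ : ∀ c, P c → Q c) : Path step Q a b := by
  induction h with
  | refl hp => exact .refl (hPQ _ hp)
  | head hp hs _ ih => exact .head (hPQ _ hp) hs ih

theorem last {a b : C} (h : Path step P a b) : P b := by
  induction h with
  | refl hp => exact hp
  | head _ _ _ ih => exact ih

theorem map {a b : C} (φ : C → C') (hstep : ∀ c c', step c = some c' → step' (φ c) = some (φ c'))
    (hP : ∀ c, P c → P' (φ c)) (h : Path step P a b) : Path step' P' (φ a) (φ b) := by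
  induction h with
  | refl hp => exact .refl (hP _ hp)
  | head hp hs _ ih => exact .head (hP _ hp) (hstep _ _ hs) ih

theorem of_reaches {a b : C} (h : StateTransition.Reaches step a b)
    (hP : ∀ c, StateTransition.Reaches step a c → P c) : Path step P a b := by
  induction h using Relation.ReflTransGen.head_induction_on with
  | refl => exact .refl (hP _ .refl)
  | head hs _ ih => exact .head (hP _ .refl) hs (ih fun c hc => hP c (.head hs hc))

/-- Steps are deterministic and `b` is final, so every reachable configuration lies on the given
path. This is how an invariant of one path yields a space bound for all reachable configurations. -/
theorem holds_of_reaches {a b : C} (h : Path step P a b) (hb : step b = none) {c : C}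
    (hc : StateTransition.Reaches step a c) : P c := by
  induction h with
  | refl hp =>
    cases hc using Relation.ReflTransGen.head_induction_on with
    | refl => exact hp
    | head hs _ => simp [hb] at hs
  | head hp hs _ ih =>
    cases hc using Relation.ReflTransGen.head_induction_on with
    | refl => exact hp
    | head hs' hr =>
      obtain rfl : _ = _ := Option.some.inj (hs.symm.trans hs')
      exact ih hb hr

/-- `TM2Outputs` speaks of iterates of the step function on options; this lemma and
`reaches_of_iterate` translate between the two views. -/
theorem exists_iterate {a b : C} (h : Path step P a b) :
    ∃ n, (flip bind step)^[n] (some a) = some b := by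
  induction h with
  | refl _ => exact ⟨0, rfl⟩
  | head _ hs _ ih =>
    obtain ⟨n, hn⟩ := ih
    refine ⟨n + 1, ?_⟩
    rw [Function.iterate_succ_apply]
    simpa [flip, hs] using hn

end Path

theorem reaches_of_iterate {C : Type*} {step : C → Option C} {a b : C} {n : ℕ}
    (h : (flip bind step)^[n] (some a) = some b) : StateTransition.Reaches step a b := by
  induction n generalizing a with
  | zero => cases h; exact .refl
  | succ n ih =>
    rw [Function.iterate_succ_apply] at h
    cases hs : step a with
    | none =>
      have : ∀ n, (flip bind step)^[n] (none : Option C) = none := fun n => by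
        induction n with
        | zero => rfl
        | succ n ih => rw [Function.iterate_succ_apply]; exact ih
      have h0 : flip bind step (some a) = none := by simp [flip, hs]
      rw [h0, this] at h
      cases h
    | some a' =>
      have h0 : flip bind step (some a) = some a' := by simp [flip, hs]
      rw [h0] at h
      exact .head hs (ih h)

/-! ## Program fragments -/

section Fragments

variable {K : Type} [DecidableEq K] {Γ : K → Type} {σ : Type}

/-- All stacks have at most `B` symbols. -/
def Within (B : ℕ) {Λ : Type} (c : TM2.Cfg Γ Λ σ) : Prop := ∀ k, (c.stk k).length ≤ B

/-- Rename the labels of a statement and continue at `e` instead of halting. -/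
def relabel {Λ Λ' : Type} (f : Λ → Λ') (e : Option Λ') : TM2.Stmt Γ Λ σ → TM2.Stmt Γ Λ' σ
  | .push k g q => .push k g (relabel f e q)
  | .peek k g q => .peek k g (relabel f e q)
  | .pop k g q => .pop k g (relabel f e q)
  | .load g q => .load g (relabel f e q)
  | .branch g q₁ q₂ => .branch g (relabel f e q₁) (relabel f e q₂)
  | .goto l => .goto fun v => f (l v)
  | .halt => e.elim .halt fun l => .goto fun _ => l

def relabelCfg {Λ Λ' : Type} (f : Λ → Λ') (e : Option Λ') (c : TM2.Cfg Γ Λ σ) :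
    TM2.Cfg Γ Λ' σ :=
  ⟨c.l.elim e fun l => some (f l), c.var, c.stk⟩

theorem stepAux_relabel {Λ Λ' : Type} (f : Λ → Λ') (e : Option Λ') (q : TM2.Stmt Γ Λ σ) (v : σ)
    (S : ∀ k, List (Γ k)) :
    TM2.stepAux (relabel f e q) v S = relabelCfg f e (TM2.stepAux q v S) := by
  induction q generalizing v S with
  | push k g q ih => simp [relabel, ih]
  | peek k g q ih => simp [relabel, ih]
  | pop k g q ih => simp [relabel, ih]
  | load g q ih => simp [relabel, ih]
  | branch g q₁ q₂ ih₁ ih₂ => cases h : g v <;> simp [relabel, ih₁, ih₂, h]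
  | goto l => rfl
  | halt => cases e <;> rfl

/-- Embedding a fragment changes labels but not stores, so its run survives with the same bound, and
the halted configuration becomes one standing at `e`. The rules for sequencing, branching and loops
glue such embedded runs together. -/
theorem Path.relabel {Λ Λ' : Type} {m : Λ → TM2.Stmt Γ Λ σ} {m' : Λ' → TM2.Stmt Γ Λ' σ}
    (f : Λ → Λ') (e : Option Λ') (hm : ∀ l, m' (f l) = OnlineBribery.relabel f e (m l)) {B : ℕ}
    {c c' : TM2.Cfg Γ Λ σ} (h : Path (TM2.step m) (Within B) c c') :
    Path (TM2.step m') (Within B) (relabelCfg f e c) (relabelCfg f e c') := by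
  refine h.map _ (fun c c' hc => ?_) (fun c hc => hc)
  obtain ⟨_ | l, v, S⟩ := c
  · simp at hc
  · simp only [TM2.step, Option.some.injEq] at hc
    subst hc
    simp only [relabelCfg, Option.elim_some, TM2.step, hm, stepAux_relabel]

variable (Γ σ) in
/-- A program fragment: control leaves it where it halts. -/
structure Frag where
  Λ : Type
  [fin : Fintype Λ]
  entry : Λ
  code : Λ → TM2.Stmt Γ Λ σ

/-- The fragment leads from the stores `(v, S)` to `(v', S')` without a stack growing beyond
`B` symbols. -/
def Frag.Run (F : Frag Γ σ) (B : ℕ) (v : σ) (S : ∀ k, List (Γ k)) (v' : σ)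
    (S' : ∀ k, List (Γ k)) : Prop :=
  Path (TM2.step F.code) (Within B) ⟨some F.entry, v, S⟩ ⟨none, v', S'⟩

namespace Frag

variable {v v' v'' : σ} {S S' S'' : ∀ k, List (Γ k)} {B : ℕ}

/-- A single statement that does not jump. -/
def stmt (q : TM2.Stmt Γ Unit σ) : Frag Γ σ := ⟨Unit, (), fun _ => q⟩

theorem run_stmt {q : TM2.Stmt Γ Unit σ} (h : TM2.stepAux q v S = ⟨none, v', S'⟩)
    (hS : ∀ k, (S k).length ≤ B) (hS' : ∀ k, (S' k).length ≤ B) :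
    (stmt q).Run B v S v' S' :=
  .head hS (by simp [stmt, h]) (.refl hS')

def seq (F G : Frag Γ σ) : Frag Γ σ :=
  have := F.fin
  have := G.fin
  { Λ := F.Λ ⊕ G.Λ
    entry := .inl F.entry
    code := Sum.elim (fun l => relabel .inl (some (.inr G.entry)) (F.code l))
      (fun l => relabel .inr none (G.code l)) }

theorem Run.seq {F G : Frag Γ σ} (hF : F.Run B v S v' S') (hG : G.Run B v' S' v'' S'') :
    (F.seq G).Run B v S v'' S'' :=
  (Path.relabel (m' := (F.seq G).code) Sum.inl (some (.inr G.entry)) (fun _ => rfl) hF).trans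
    (Path.relabel (m' := (F.seq G).code) Sum.inr none (fun _ => rfl) hG)

/-- Execute the statement `q`, whose exits `true` and `false` lead to `F` and `G`. -/
def split (q : TM2.Stmt Γ Bool σ) (F G : Frag Γ σ) : Frag Γ σ :=
  have := F.fin
  have := G.fin
  { Λ := Option (F.Λ ⊕ G.Λ)
    entry := none
    code := fun l => l.elim
      (relabel (fun b => some (cond b (.inl F.entry) (.inr G.entry))) none q)
      (Sum.elim (fun l => relabel (some ∘ .inl) none (F.code l))
        (fun l => relabel (some ∘ .inr) none (G.code l))) }

theorem run_split_true {q : TM2.Stmt Γ Bool σ} {F G : Frag Γ σ}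
    (hq : TM2.stepAux q v S = ⟨some true, v', S'⟩) (hS : ∀ k, (S k).length ≤ B)
    (hF : F.Run B v' S' v'' S'') : (split q F G).Run B v S v'' S'' := by
  refine .head hS ?_ (Path.relabel (m' := (split q F G).code) (some ∘ Sum.inl) none
    (fun _ => rfl) hF)
  simp [split, stepAux_relabel, hq, relabelCfg]

theorem run_split_false {q : TM2.Stmt Γ Bool σ} {F G : Frag Γ σ}
    (hq : TM2.stepAux q v S = ⟨some false, v', S'⟩) (hS : ∀ k, (S k).length ≤ B)
    (hG : G.Run B v' S' v'' S'') : (split q F G).Run B v S v'' S'' := by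
  refine .head hS ?_ (Path.relabel (m' := (split q F G).code) (some ∘ Sum.inr) none
    (fun _ => rfl) hG)
  simp [split, stepAux_relabel, hq, relabelCfg]

/-- Run the test `T` and then `q`; on a jump run `F` and repeat, on a halt stop. -/
def loop (T : Frag Γ σ) (q : TM2.Stmt Γ Unit σ) (F : Frag Γ σ) : Frag Γ σ :=
  have := F.fin
  have := T.fin
  { Λ := Option (T.Λ ⊕ F.Λ)
    entry := some (.inl T.entry)
    code := fun l => l.elim
      (relabel (fun _ => some (.inr F.entry)) none q)
      (Sum.elim (fun l => relabel (some ∘ .inl) (some none) (T.code l))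
        (fun l => relabel (some ∘ .inr) (some (some (.inl T.entry))) (F.code l))) }

theorem run_loop_stop {T F : Frag Γ σ} {q : TM2.Stmt Γ Unit σ} (hT : T.Run B v S v' S')
    (hq : TM2.stepAux q v' S' = ⟨none, v'', S''⟩) (hS : ∀ k, (S'' k).length ≤ B) :
    (loop T q F).Run B v S v'' S'' := by
  have h := Path.relabel (m' := (loop T q F).code) (some ∘ Sum.inl) (some none) (fun _ => rfl) hT
  refine h.trans (.head hT.last ?_ (.refl hS))
  simp [relabelCfg, loop, stepAux_relabel, hq]

theorem run_loop_step {T F : Frag Γ σ} {q : TM2.Stmt Γ Unit σ} {v₁ v₂ v₃ : σ}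
    {S₁ S₂ S₃ : ∀ k, List (Γ k)} (hT : T.Run B v S v₁ S₁)
    (hq : TM2.stepAux q v₁ S₁ = ⟨some (), v₂, S₂⟩) (hF : F.Run B v₂ S₂ v₃ S₃)
    (h : (loop T q F).Run B v₃ S₃ v' S') : (loop T q F).Run B v S v' S' := by
  have h₁ := Path.relabel (m' := (loop T q F).code) (some ∘ Sum.inl) (some none) (fun _ => rfl) hT
  have h₂ := Path.relabel (m' := (loop T q F).code) (some ∘ Sum.inr) (some (some (.inl T.entry)))
    (fun _ => rfl) hF
  refine h₁.trans (.head hT.last ?_ (h₂.trans h))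
  simp [relabelCfg, loop, stepAux_relabel, hq]

theorem Run.mono {F : Frag Γ σ} {B' : ℕ} (h : F.Run B v S v' S') (hB : B ≤ B') :
    F.Run B' v S v' S' :=
  Path.mono h fun _ hc k => (hc k).trans hB

end Frag

end Fragments

end

/-! ### Trees as data, and a stack machine that contains an oracle machine. -/

section

/-! ## Binary trees and their prefix notation -/

/-- Binary trees with symbols at their leaves: the data of the machine programs. -/
inductive BTree
  | leaf (a : Γ')
  | node (l r : BTree)

namespace BTree

/-- Prefix notation; `none` marks an inner node. -/
def ser : BTree → List (Option Γ')
  | leaf a => [some a]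
  | node l r => none :: (ser l ++ ser r)

def size : BTree → ℕ
  | leaf _ => 1
  | node l r => 1 + size l + size r

@[simp] theorem length_ser (t : BTree) : t.ser.length = t.size := by
  induction t with
  | leaf a => rfl
  | node l r hl hr => simp [ser, size, hl, hr]; omega

theorem size_pos (t : BTree) : 0 < t.size := by cases t <;> simp only [size] <;> omega

/-- The list of symbols `s` as a tree. -/
def ofString : List Γ' → BTree
  | [] => leaf Γ'.blank
  | a :: s => node (leaf a) (ofString s)

theorem size_ofString (s : List Γ') : (ofString s).size = 2 * s.length + 1 := by
  induction s with
  | nil => rfl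
  | cons a s ih => simp [ofString, size, ih]; omega

end BTree

/-! ## A machine with work stacks around an oracle machine -/

/-- The work stacks. -/
inductive Own
  | main | a | b | cnt | inp | out
  deriving DecidableEq

instance : Fintype Own :=
  ⟨{.main, .a, .b, .cnt, .inp, .out}, fun k => by cases k <;> simp⟩

abbrev OwnAlph : Own → Type
  | .inp => Γ'
  | .out => Bool
  | _ => Option Γ'

section Machine

variable (M : TM2ComputableAux Γ' Bool)

abbrev Alph : Own ⊕ M.tm.K → Type := Sum.elim OwnAlph M.tm.Γ

/-- The register holds the symbol popped last. -/
abbrev Reg : Type := Option (Option Γ') × M.tm.σ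

abbrev Code (Λ : Type) : Type := TM2.Stmt (Alph M) Λ (Reg M)

abbrev MFrag := Frag (Alph M) (Reg M)

variable {M}

/-- The store with the given contents of the work stacks and of the stacks of the oracle. -/
def st (m a b c : List (Option Γ')) (i : List Γ') (o : List Bool) (S : ∀ k, List (M.tm.Γ k)) :
    ∀ k, List (Alph M k)
  | .inl .main => m
  | .inl .a => a
  | .inl .b => b
  | .inl .cnt => c
  | .inl .inp => i
  | .inl .out => o
  | .inr k => S k

abbrev noStk : ∀ k, List (M.tm.Γ k) := fun _ => []

section Stacks

variable {m a b c : List (Option Γ')} {i : List Γ'} {o : List Bool}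
  {S : ∀ k, List (M.tm.Γ k)} {Λ : Type}

theorem update_main (x : List (Option Γ')) :
    Function.update (st (M := M) m a b c i o S) (.inl .main) x = st x a b c i o S := by
  funext k; rcases k with k | k
  · cases k <;> rfl
  · rfl

theorem update_a (x : List (Option Γ')) :
    Function.update (st (M := M) m a b c i o S) (.inl .a) x = st m x b c i o S := by
  funext k; rcases k with k | k
  · cases k <;> rfl
  · rfl

theorem update_b (x : List (Option Γ')) :
    Function.update (st (M := M) m a b c i o S) (.inl .b) x = st m a x c i o S := by
  funext k; rcases k with k | k
  · cases k <;> rfl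
  · rfl

theorem update_cnt (x : List (Option Γ')) :
    Function.update (st (M := M) m a b c i o S) (.inl .cnt) x = st m a b x i o S := by
  funext k; rcases k with k | k
  · cases k <;> rfl
  · rfl

theorem update_inp (x : List Γ') :
    Function.update (st (M := M) m a b c i o S) (.inl .inp) x = st m a b c x o S := by
  funext k; rcases k with k | k
  · cases k <;> rfl
  · rfl

theorem update_out (x : List Bool) :
    Function.update (st (M := M) m a b c i o S) (.inl .out) x = st m a b c i x S := by
  funext k; rcases k with k | k
  · cases k <;> rfl
  · rfl

theorem update_inr (k : M.tm.K) (x : List (M.tm.Γ k)) :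
    Function.update (st (M := M) m a b c i o S) (.inr k) x =
      st m a b c i o (Function.update S k x) := by
  funext j; rcases j with j | j
  · cases j <;> rfl
  · by_cases h : j = k
    · subst h
      exact (Function.update_self (β := fun k => List (Alph M k)) (Sum.inr j) x _).trans
        (Function.update_self (β := fun k => List (M.tm.Γ k)) j x S).symm
    · exact (Function.update_of_ne (β := fun k => List (Alph M k))
        (show (Sum.inr j : Own ⊕ M.tm.K) ≠ Sum.inr k by simpa using h) x _).trans
        (Function.update_of_ne (β := fun k => List (M.tm.Γ k)) h x S).symm

theorem st_le {B : ℕ} (hm : m.length ≤ B) (ha : a.length ≤ B) (hb : b.length ≤ B)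
    (hc : c.length ≤ B) (hi : i.length ≤ B) (ho : o.length ≤ B) (hS : ∀ k, (S k).length ≤ B)
    (k : Own ⊕ M.tm.K) : (st m a b c i o S k).length ≤ B := by
  rcases k with k | k
  · cases k <;> assumption
  · exact hS k

/-- Bounds for a store whose oracle stacks are empty. -/
theorem st_le' {B : ℕ} (h : m.length ≤ B ∧ a.length ≤ B ∧ b.length ≤ B ∧
    c.length ≤ B ∧ i.length ≤ B ∧ o.length ≤ B) (k : Own ⊕ M.tm.K) :
    (st m a b c i o noStk k).length ≤ B :=
  st_le h.1 h.2.1 h.2.2.1 h.2.2.2.1 h.2.2.2.2.1 h.2.2.2.2.2 (fun _ => Nat.zero_le _) k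

/-! ### Statements -/

/-- Pop a symbol into the register. -/
def popMain (q : Code M Λ) : Code M Λ :=
  .pop (.inl .main) (fun v (x : Option (Option Γ')) => (x, v.2)) q

-- With one such rule for each primitive statement, `simp` executes straight-line code symbolically
-- on stores of the form `st`.
@[simp] theorem stepAux_popMain (q : Code M Λ) (v : Reg M) :
    TM2.stepAux (popMain q) v (st m a b c i o S) =
      TM2.stepAux q (m.head?, v.2) (st m.tail a b c i o S) :=
  congrArg (TM2.stepAux q _) (update_main _)

def pushMain (f : Reg M → Option Γ') (q : Code M Λ) : Code M Λ := .push (.inl .main) f q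

@[simp] theorem stepAux_pushMain (f : Reg M → Option Γ') (q : Code M Λ) (v : Reg M) :
    TM2.stepAux (pushMain f q) v (st m a b c i o S) =
      TM2.stepAux q v (st (f v :: m) a b c i o S) :=
  congrArg (TM2.stepAux q _) (update_main _)

/-- Pop a symbol into the register. -/
def popA (q : Code M Λ) : Code M Λ :=
  .pop (.inl .a) (fun v (x : Option (Option Γ')) => (x, v.2)) q

@[simp] theorem stepAux_popA (q : Code M Λ) (v : Reg M) :
    TM2.stepAux (popA q) v (st m a b c i o S) =
      TM2.stepAux q (a.head?, v.2) (st m a.tail b c i o S) :=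
  congrArg (TM2.stepAux q _) (update_a _)

def pushA (f : Reg M → Option Γ') (q : Code M Λ) : Code M Λ := .push (.inl .a) f q

@[simp] theorem stepAux_pushA (f : Reg M → Option Γ') (q : Code M Λ) (v : Reg M) :
    TM2.stepAux (pushA f q) v (st m a b c i o S) =
      TM2.stepAux q v (st m (f v :: a) b c i o S) :=
  congrArg (TM2.stepAux q _) (update_a _)

/-- Pop a symbol into the register. -/
def popB (q : Code M Λ) : Code M Λ :=
  .pop (.inl .b) (fun v (x : Option (Option Γ')) => (x, v.2)) q

@[simp] theorem stepAux_popB (q : Code M Λ) (v : Reg M) :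
    TM2.stepAux (popB q) v (st m a b c i o S) =
      TM2.stepAux q (b.head?, v.2) (st m a b.tail c i o S) :=
  congrArg (TM2.stepAux q _) (update_b _)

def pushB (f : Reg M → Option Γ') (q : Code M Λ) : Code M Λ := .push (.inl .b) f q

@[simp] theorem stepAux_pushB (f : Reg M → Option Γ') (q : Code M Λ) (v : Reg M) :
    TM2.stepAux (pushB f q) v (st m a b c i o S) =
      TM2.stepAux q v (st m a (f v :: b) c i o S) :=
  congrArg (TM2.stepAux q _) (update_b _)

/-- Pop a symbol into the register. -/
def popCnt (q : Code M Λ) : Code M Λ :=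
  .pop (.inl .cnt) (fun v (x : Option (Option Γ')) => (x, v.2)) q

@[simp] theorem stepAux_popCnt (q : Code M Λ) (v : Reg M) :
    TM2.stepAux (popCnt q) v (st m a b c i o S) =
      TM2.stepAux q (c.head?, v.2) (st m a b c.tail i o S) :=
  congrArg (TM2.stepAux q _) (update_cnt _)

def pushCnt (f : Reg M → Option Γ') (q : Code M Λ) : Code M Λ := .push (.inl .cnt) f q

@[simp] theorem stepAux_pushCnt (f : Reg M → Option Γ') (q : Code M Λ) (v : Reg M) :
    TM2.stepAux (pushCnt f q) v (st m a b c i o S) =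
      TM2.stepAux q v (st m a b (f v :: c) i o S) :=
  congrArg (TM2.stepAux q _) (update_cnt _)

def resetReg (q : Code M Λ) : Code M Λ := .load (fun v => (none, v.2)) q

@[simp] theorem stepAux_resetReg (q : Code M Λ) (v : Reg M) (T) :
    TM2.stepAux (resetReg q) v T = TM2.stepAux q (none, v.2) T := rfl

/-- Branch on the register. -/
def branchReg (f : Option (Option Γ') → Bool) (q₁ q₂ : Code M Λ) : Code M Λ :=
  .branch (fun v => f v.1) q₁ q₂

@[simp] theorem stepAux_branchReg (f) (q₁ q₂ : Code M Λ) (v : Reg M) (T) :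
    TM2.stepAux (branchReg f q₁ q₂) v T =
      bif f v.1 then TM2.stepAux q₁ v T else TM2.stepAux q₂ v T := rfl

end Stacks

/-! ### Reading a tree -/

section Programs

variable {y : M.tm.σ}

/-- Read one tree off the main stack, executing `body` for each of its symbols; the stack `cnt`
holds one symbol per tree still to be read. -/
def readTrees (body : Code M Unit → Code M Unit) : MFrag M :=
  ⟨Unit, (), fun _ => popCnt (branchReg Option.isNone .halt
    (popMain (body (branchReg (· = some none)
      (pushCnt (fun _ => none) (pushCnt (fun _ => none) (.goto fun _ => ())))
      (.goto fun _ => ())))))⟩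

/-- The statements `body` push the images of the register under `ga` and `gb` on the stacks `a`
and `b`. -/
structure Pushes (y : M.tm.σ) (body : Code M Unit → Code M Unit)
    (ga gb : List (Option Γ') → List (Option Γ')) : Prop where
  step : ∀ q x m a b c, TM2.stepAux (body q) (some x, y) (st m a b c [] [] noStk) =
    TM2.stepAux q (some x, y) (st m (ga [x] ++ a) (gb [x] ++ b) c [] [] noStk)
  append_a : ∀ l l', ga (l ++ l') = ga l' ++ ga l
  append_b : ∀ l l', gb (l ++ l') = gb l' ++ gb l
  length_a : ∀ l, (ga l).length ≤ l.length
  length_b : ∀ l, (gb l).length ≤ l.length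

variable {body : Code M Unit → Code M Unit} {ga gb : List (Option Γ') → List (Option Γ')}

/-- Prefix notation delimits itself: a leaf settles one outstanding tree, and an inner node replaces
one outstanding tree by two. The factor `4` grants the size of the tree once to each of `main`, `a`,
`b` and `cnt`. -/
theorem path_readTrees (hb : Pushes y body ga gb)
    (t : BTree) {m a b c : List (Option Γ')} {B : ℕ} (r : Option (Option Γ'))
    (h : 4 * t.size + (m.length + a.length + b.length + c.length) + 1 ≤ B) :
    ∃ r', Path (TM2.step (readTrees body).code) (Within B)
      ⟨some (), (r, y), st (t.ser ++ m) a b (none :: c) [] [] noStk⟩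
      ⟨some (), (r', y), st m (ga t.ser ++ a) (gb t.ser ++ b) c [] [] noStk⟩ := by
  induction t generalizing m a b c r with
  | leaf x =>
    have h₁ := hb.length_a [some x]
    have h₂ := hb.length_b [some x]
    simp only [BTree.size, List.length_cons, List.length_nil] at h h₁ h₂
    refine ⟨some (some x), .head (st_le' ?_) ?_ (.refl (st_le' ?_))⟩
    · simp [BTree.ser]; omega
    · simp [readTrees, BTree.ser, hb.step]
    · simp [BTree.ser]; omega
  | node l r' hl hr =>
    simp only [BTree.size] at h
    have hr0 := r'.size_pos
    have hl0 := l.size_pos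
    have ha1 := hb.length_a [none]
    have ha2 := hb.length_a l.ser
    have hb1 := hb.length_b [none]
    have hb2 := hb.length_b l.ser
    simp only [List.length_cons, List.length_nil, BTree.length_ser] at ha1 ha2 hb1 hb2
    obtain ⟨r₁, h₁⟩ := hl (m := r'.ser ++ m) (a := ga [none] ++ a) (b := gb [none] ++ b)
      (c := none :: c) (some none) (by simp; omega)
    obtain ⟨r₂, h₂⟩ := hr (m := m) (a := ga l.ser ++ (ga [none] ++ a))
      (b := gb l.ser ++ (gb [none] ++ b)) (c := c) r₁ (by simp; omega)
    have e₁ : ga (BTree.node l r').ser = ga r'.ser ++ (ga l.ser ++ ga [none]) := by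
      rw [BTree.ser, ← List.singleton_append, hb.append_a, hb.append_a, List.append_assoc]
    have e₂ : gb (BTree.node l r').ser = gb r'.ser ++ (gb l.ser ++ gb [none]) := by
      rw [BTree.ser, ← List.singleton_append, hb.append_b, hb.append_b, List.append_assoc]
    rw [e₁, e₂]
    refine ⟨r₂, .head (st_le' ?_) ?_ (h₁.trans (by simpa using h₂))⟩
    · simp [BTree.ser]; omega
    · simp [readTrees, BTree.ser, hb.step]

/-- Read one tree. -/
def readTree (body : Code M Unit → Code M Unit) : MFrag M :=
  (Frag.stmt (pushCnt (fun _ => none) .halt)).seq (readTrees body)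

theorem run_readTree (hb : Pushes y body ga gb) (t : BTree) {m a b : List (Option Γ')} {B : ℕ}
    (h : 4 * t.size + (m.length + a.length + b.length) + 1 ≤ B) :
    (readTree body).Run B (none, y) (st (t.ser ++ m) a b [] [] [] noStk)
      (none, y) (st m (ga t.ser ++ a) (gb t.ser ++ b) [] [] [] noStk) := by
  have h₁ := hb.length_a t.ser
  have h₂ := hb.length_b t.ser
  simp only [BTree.length_ser] at h₁ h₂
  refine Frag.Run.seq (v' := (none, y)) (S' := st (t.ser ++ m) a b [none] [] [] noStk)
    (Frag.run_stmt ?_ (st_le' ?_) (st_le' ?_)) ?_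
  · simp
  · simp; omega
  · simp; omega
  · obtain ⟨r', hr⟩ := path_readTrees hb t (m := m) (a := a) (b := b) (c := []) none
      (B := B) (by simp; omega)
    -- The counter is empty now, so one more test pops nothing, clears the register and halts.
    refine hr.trans (.head (st_le' ?_) ?_ (.refl (st_le' ?_)))
    · simp; omega
    · simp [readTrees]
    · simp; omega

end Programs

end Machine

end

/-! ### Moving, dropping, duplicating and exchanging trees. -/

section

section Machine

variable {M : TM2ComputableAux Γ' Bool}

section Programs

variable {y : M.tm.σ}

theorem pushes_nothing : Pushes y (fun q => q) (fun _ => []) (fun _ => []) := by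
  constructor <;> simp

theorem pushes_a : Pushes y (pushA fun v => v.1.getD none) List.reverse (fun _ => []) := by
  constructor <;> simp

theorem pushes_b : Pushes y (pushB fun v => v.1.getD none) (fun _ => []) List.reverse := by
  constructor <;> simp

/-! ### Moving whole stacks -/

/-- Move the stack `a` to `main`. -/
def drainA : MFrag M :=
  ⟨Unit, (), fun _ => popA (branchReg Option.isNone .halt
    (pushMain (fun v => v.1.getD none) (.goto fun _ => ())))⟩

theorem run_drainA {m a b : List (Option Γ')} {B : ℕ} (h : m.length + a.length + b.length ≤ B)
    (r : Option (Option Γ')) :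
    drainA.Run B (r, y) (st m a b [] [] [] noStk)
      (none, y) (st (a.reverse ++ m) [] b [] [] [] noStk) := by
  induction a generalizing m r with
  | nil =>
    refine .head (st_le' ?_) ?_ (.refl (st_le' ?_))
    · simp at h ⊢; omega
    · simp [drainA]
    · simp at h ⊢; omega
  | cons x a ih =>
    refine .head (st_le' ?_) ?_ (c' := ⟨some (), (some x, y), st (x :: m) a b [] [] [] noStk⟩) ?_
    · simp at h ⊢; omega
    · simp [drainA]
    · rw [List.reverse_cons, List.append_assoc]
      exact ih (m := x :: m) (by simp at h ⊢; omega) (some x)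

/-- Move the stack `b` to `main`. -/
def drainB : MFrag M :=
  ⟨Unit, (), fun _ => popB (branchReg Option.isNone .halt
    (pushMain (fun v => v.1.getD none) (.goto fun _ => ())))⟩

theorem run_drainB {m a b : List (Option Γ')} {B : ℕ} (h : m.length + a.length + b.length ≤ B)
    (r : Option (Option Γ')) :
    drainB.Run B (r, y) (st m a b [] [] [] noStk)
      (none, y) (st (b.reverse ++ m) a [] [] [] [] noStk) := by
  induction b generalizing m r with
  | nil =>
    refine .head (st_le' ?_) ?_ (.refl (st_le' ?_))
    · simp at h ⊢; omega
    · simp [drainB]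
    · simp at h ⊢; omega
  | cons x b ih =>
    refine .head (st_le' ?_) ?_ (c' := ⟨some (), (some x, y), st (x :: m) a b [] [] [] noStk⟩) ?_
    · simp at h ⊢; omega
    · simp [drainB]
    · rw [List.reverse_cons, List.append_assoc]
      exact ih (m := x :: m) (by simp at h ⊢; omega) (some x)

/-- Move the stack `a` to `main` and to `b`. -/
def copyA : MFrag M :=
  ⟨Unit, (), fun _ => popA (branchReg Option.isNone .halt
    (pushMain (fun v => v.1.getD none) (pushB (fun v => v.1.getD none) (.goto fun _ => ()))))⟩

theorem run_copyA {m a b : List (Option Γ')} {B : ℕ} (h : m.length + 2 * a.length + b.length ≤ B)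
    (r : Option (Option Γ')) :
    copyA.Run B (r, y) (st m a b [] [] [] noStk)
      (none, y) (st (a.reverse ++ m) [] (a.reverse ++ b) [] [] [] noStk) := by
  induction a generalizing m b r with
  | nil =>
    refine .head (st_le' ?_) ?_ (.refl (st_le' ?_))
    · simp at h ⊢; omega
    · simp [copyA]
    · simp at h ⊢; omega
  | cons x a ih =>
    refine .head (st_le' ?_) ?_
      (c' := ⟨some (), (some x, y), st (x :: m) a (x :: b) [] [] [] noStk⟩) ?_
    · simp at h ⊢; omega
    · simp [copyA]
    · rw [List.reverse_cons, List.append_assoc]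
      rw [List.append_assoc]
      exact ih (m := x :: m) (b := x :: b) (by simp at h ⊢; omega) (some x)

/-! ### Operations on the trees on the main stack -/

theorem run_drop (t : BTree) {m : List (Option Γ')} {B : ℕ} (h : 4 * t.size + m.length + 1 ≤ B) :
    (readTree fun q => q).Run B (none, y) (st (t.ser ++ m) [] [] [] [] [] noStk)
      (none, y) (st m [] [] [] [] [] noStk) :=
  run_readTree pushes_nothing t (by simpa using h)

/-- Move the stack `b` to `a`. -/
def drainBA : MFrag M :=
  ⟨Unit, (), fun _ => popB (branchReg Option.isNone .halt
    (pushA (fun v => v.1.getD none) (.goto fun _ => ())))⟩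

theorem run_drainBA {m a b : List (Option Γ')} {B : ℕ} (h : m.length + a.length + b.length ≤ B)
    (r : Option (Option Γ')) :
    drainBA.Run B (r, y) (st m a b [] [] [] noStk)
      (none, y) (st m (b.reverse ++ a) [] [] [] [] noStk) := by
  induction b generalizing a r with
  | nil =>
    refine .head (st_le' ?_) ?_ (.refl (st_le' ?_))
    · simp at h ⊢; omega
    · simp [drainBA]
    · simp at h ⊢; omega
  | cons x b ih =>
    refine .head (st_le' ?_) ?_ (c' := ⟨some (), (some x, y), st m (x :: a) b [] [] [] noStk⟩) ?_
    · simp at h ⊢; omega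
    · simp [drainBA]
    · rw [List.reverse_cons, List.append_assoc]
      exact ih (a := x :: a) (by simp at h ⊢; omega) (some x)

/-- Duplicate the topmost tree. -/
def dup : MFrag M :=
  ((readTree (pushA fun v => v.1.getD none)).seq copyA).seq (drainBA.seq drainA)

/-- Reading puts the tree on `a` in reverse, and `copyA` restores its order on `main` and `b`.
Emptying `b` straight onto `main` would reverse the second copy, hence the detour through `a`. -/
theorem run_dup (t : BTree) {m : List (Option Γ')} {B : ℕ}
    (h : 4 * t.size + m.length + 1 ≤ B) :
    dup.Run B (none, y) (st (t.ser ++ m) [] [] [] [] [] noStk)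
      (none, y) (st (t.ser ++ (t.ser ++ m)) [] [] [] [] [] noStk) := by
  have h₁ := run_readTree (y := y) pushes_a t (m := m) (a := []) (b := []) (B := B)
    (by simp; omega)
  have h₂ := run_copyA (y := y) (m := m) (a := t.ser.reverse) (b := []) (B := B)
    (by simp; omega) none
  have h₃ := run_drainBA (y := y) (m := t.ser ++ m) (a := []) (b := t.ser) (B := B)
    (by simp; omega) none
  have h₄ := run_drainA (y := y) (m := t.ser ++ m) (a := t.ser.reverse) (b := []) (B := B)
    (by simp; omega) none
  simp only [List.append_nil, List.reverse_reverse] at h₁ h₂ h₃ h₄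
  exact (h₁.seq h₂).seq (h₃.seq h₄)

/-- Exchange the two topmost trees. -/
def swap : MFrag M :=
  ((readTree (pushA fun v => v.1.getD none)).seq
    (readTree (pushB fun v => v.1.getD none))).seq (drainA.seq drainB)

theorem run_swap (t u : BTree) {m : List (Option Γ')} {B : ℕ}
    (h : 4 * t.size + 4 * u.size + m.length + 1 ≤ B) :
    swap.Run B (none, y) (st (t.ser ++ (u.ser ++ m)) [] [] [] [] [] noStk)
      (none, y) (st (u.ser ++ (t.ser ++ m)) [] [] [] [] [] noStk) := by
  have h₁ := run_readTree (y := y) pushes_a t (m := u.ser ++ m) (a := []) (b := []) (B := B)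
    (by simp; omega)
  have h₂ := run_readTree (y := y) pushes_b u (m := m) (a := t.ser.reverse) (b := []) (B := B)
    (by simp; omega)
  have h₃ := run_drainA (y := y) (m := m) (a := t.ser.reverse) (b := u.ser.reverse) (B := B)
    (by simp; omega) none
  have h₄ := run_drainB (y := y) (m := t.ser ++ m) (a := []) (b := u.ser.reverse) (B := B)
    (by simp; omega) none
  simp only [List.append_nil, List.nil_append, List.reverse_reverse] at h₁ h₂ h₃ h₄
  exact (h₁.seq h₂).seq (h₃.seq h₄)

end Programs

end Machine

end

/-! ### Closure properties of tree functions computable in polynomial space. -/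

section

/-! ## Polynomial bounds -/

/-- `f` is bounded by a polynomial in `s`. -/
def PolyBdd {ι : Type*} (f s : ι → ℕ) : Prop := ∃ k, ∀ i, f i ≤ (s i + 2) ^ k

namespace PolyBdd

variable {ι κ : Type*} {f g s : ι → ℕ}

theorem mono (h : PolyBdd g s) (hfg : ∀ i, f i ≤ g i) : PolyBdd f s :=
  h.imp fun _ hk i => (hfg i).trans (hk i)

theorem self : PolyBdd s s := ⟨1, fun i => by simp⟩

theorem mul (hf : PolyBdd f s) (hg : PolyBdd g s) : PolyBdd (fun i => f i * g i) s := by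
  obtain ⟨k, hk⟩ := hf
  obtain ⟨l, hl⟩ := hg
  exact ⟨k + l, fun i => by rw [pow_add]; exact Nat.mul_le_mul (hk i) (hl i)⟩

/-- The base `s i + 2` is at least `2`, so its `c`-th power exceeds `c`. For the same reason a sum
of two powers costs only one more factor in `add`. -/
theorem const (c : ℕ) : PolyBdd (fun _ => c) s :=
  ⟨c, fun i => Nat.lt_two_pow_self.le.trans (Nat.pow_le_pow_left (by omega) c)⟩

theorem add (hf : PolyBdd f s) (hg : PolyBdd g s) : PolyBdd (fun i => f i + g i) s := by
  obtain ⟨k, hk⟩ := hf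
  obtain ⟨l, hl⟩ := hg
  refine ⟨k + l + 1, fun i => ?_⟩
  have h₁ := Nat.pow_le_pow_right (show 0 < s i + 2 by omega) (Nat.le_add_right k l)
  have h₂ := Nat.pow_le_pow_right (show 0 < s i + 2 by omega) (Nat.le_add_left l k)
  have h₃ : (s i + 2) ^ (k + l) * 2 ≤ (s i + 2) ^ (k + l + 1) := by
    rw [pow_succ]; exact Nat.mul_le_mul_left _ (by omega)
  have := hk i
  have := hl i
  dsimp only
  omega

theorem pow (hf : PolyBdd f s) (n : ℕ) : PolyBdd (fun i => f i ^ n) s := by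
  obtain ⟨k, hk⟩ := hf
  exact ⟨k * n, fun i => by rw [pow_mul]; exact Nat.pow_le_pow_left (hk i) n⟩

theorem trans (hf : PolyBdd f g) (hg : PolyBdd g s) : PolyBdd f s := by
  obtain ⟨k, hk⟩ := hf
  exact ((hg.add (const 2)).pow k).mono hk

theorem reindex (hf : PolyBdd f s) (u : κ → ι) : PolyBdd (fun j => f (u j)) fun j => s (u j) :=
  hf.imp fun _ hk j => hk (u j)

theorem poly (p : Polynomial ℕ) (hf : PolyBdd f s) : PolyBdd (fun i => p.eval (f i)) s := by
  induction p using Polynomial.induction_on' with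
  | add p q hp hq => simpa using hp.add hq
  | monomial n a => simpa using (const a).mul (hf.pow n)

end PolyBdd

/-! ## Tree functions computed in polynomial space -/

section Machine

/-- The store with the given contents of the main stack. -/
abbrev onMain {M : TM2ComputableAux Γ' Bool} (m : List (Option Γ')) : ∀ k, List (Alph M k) :=
  st m [] [] [] [] [] noStk

abbrev start {M : TM2ComputableAux Γ' Bool} : Reg M := (none, M.tm.initialState)

/-- A program with oracle machine `M` replaces the tree `e i` on top of the main stack by the tree
`e' i`, in polynomial space. -/
def Maps (M : TM2ComputableAux Γ' Bool) {ι : Type*} (e e' : ι → BTree) : Prop :=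
  ∃ (F : MFrag M) (B : ι → ℕ), PolyBdd B (fun i => (e i).size) ∧ ∀ i m,
    F.Run (m.length + B i) start (onMain ((e i).ser ++ m)) start (onMain ((e' i).ser ++ m))

variable {M : TM2ComputableAux Γ' Bool}

namespace Maps

variable {ι κ : Type*} {e e' e'' : ι → BTree}

/-- The last configuration of the run carries the output on its main stack and obeys the space
bound. Hence the bound of a second program is polynomial in the original input. -/
theorem size (h : Maps M e e') : PolyBdd (fun i => (e' i).size) fun i => (e i).size := by
  obtain ⟨F, B, hB, h⟩ := h
  refine hB.mono fun i => ?_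
  have : ((e' i).ser ++ []).length ≤ 0 + B i := (h i []).last (.inl .main)
  simpa using this

theorem reindex (h : Maps M e e') (u : κ → ι) : Maps M (fun j => e (u j)) fun j => e' (u j) := by
  obtain ⟨F, B, hB, h⟩ := h
  exact ⟨F, _, hB.reindex u, fun j => h (u j)⟩

theorem comp (h : Maps M e e') (h' : Maps M e' e'') : Maps M e e'' := by
  have hs := h.size
  obtain ⟨F, B, hB, h⟩ := h
  obtain ⟨F', B', hB', h'⟩ := h'
  exact ⟨F.seq F', _, hB.add (hB'.trans hs), fun i m =>
    ((h i m).mono (by omega)).seq ((h' i m).mono (by omega))⟩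

theorem of_stmt (q : Code M Unit)
    (h : ∀ i m, TM2.stepAux q start (onMain ((e i).ser ++ m)) =
      ⟨none, start, onMain ((e' i).ser ++ m)⟩)
    (he' : PolyBdd (fun i => (e' i).size) fun i => (e i).size) : Maps M e e' :=
  ⟨Frag.stmt q, _, PolyBdd.self.add he', fun i m => Frag.run_stmt (h i m)
    (st_le' (by simp; omega)) (st_le' (by simp; omega))⟩

theorem id : Maps M e e := of_stmt .halt (fun _ _ => rfl) .self

/-- Push the symbols of a list. -/
def pushList : List (Option Γ') → Code M Unit
  | [] => .halt
  | x :: l => pushMain (fun _ => x) (pushList l)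

theorem stepAux_pushList (l m : List (Option Γ')) (v : Reg M) :
    TM2.stepAux (pushList l) v (onMain m) = ⟨none, v, onMain (l.reverse ++ m)⟩ := by
  induction l generalizing m with
  | nil => rfl
  | cons x l ih => simp [pushList, ih]

theorem const (t : BTree) : Maps M e fun _ => t := by
  refine ⟨(readTree fun q => q).seq (Frag.stmt (pushList t.ser.reverse)), fun i =>
    (4 * (e i).size + 1) + t.size,
    (((PolyBdd.const 4).mul .self).add (.const 1)).add (.const _), fun i m => ?_⟩
  refine (run_drop (e i) (by dsimp only; omega)).seq (Frag.run_stmt (by rw [stepAux_pushList]; simp)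
    (st_le' ?_) (st_le' ?_)) <;> simp
  omega

/-- The input is duplicated; one copy becomes `g i`, the other is brought to the top and becomes `f
i`, and a pushed `none` joins the two trees into a node. -/
theorem node {f g : ι → BTree} (hf : Maps M e f) (hg : Maps M e g) :
    Maps M e fun i => .node (f i) (g i) := by
  have hs := hg.size
  have hs' := hf.size
  obtain ⟨F, B, hB, h⟩ := hf
  obtain ⟨F', B', hB', h'⟩ := hg
  refine ⟨(dup.seq F').seq (swap.seq (F.seq (Frag.stmt (pushMain (fun _ => none) .halt)))),
    fun i => B i + B' i + 8 * (e i).size + 8 * (g i).size + (f i).size + 1,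
    ((((hB.add hB').add ((PolyBdd.const 8).mul .self)).add ((PolyBdd.const 8).mul hs)).add hs').add
      (.const 1), fun i m => ?_⟩
  have h₁ := run_dup (M := M) (y := M.tm.initialState) (e i) (m := m)
    (B := m.length + (B i + B' i + 8 * (e i).size + 8 * (g i).size + (f i).size + 1)) (by omega)
  have h₂ := (h' i ((e i).ser ++ m)).mono
    (B' := m.length + (B i + B' i + 8 * (e i).size + 8 * (g i).size + (f i).size + 1))
    (by simp; omega)
  have h₃ := run_swap (M := M) (y := M.tm.initialState) (g i) (e i) (m := m)
    (B := m.length + (B i + B' i + 8 * (e i).size + 8 * (g i).size + (f i).size + 1)) (by omega)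
  have h₄ := (h i ((g i).ser ++ m)).mono
    (B' := m.length + (B i + B' i + 8 * (e i).size + 8 * (g i).size + (f i).size + 1))
    (by simp; omega)
  refine (h₁.seq h₂).seq (h₃.seq (h₄.seq (Frag.run_stmt ?_ (st_le' ?_) (st_le' ?_))))
  · simp [BTree.ser]
  · simp; omega
  · simp [BTree.ser]; omega

theorem snd {f g : ι → BTree} : Maps M (fun i => .node (f i) (g i)) g := by
  refine ⟨(Frag.stmt (popMain (resetReg .halt))).seq (readTree fun q => q), fun i =>
    4 * (BTree.node (f i) (g i)).size + 1,
    (((PolyBdd.const 4).mul .self).add (.const 1)), fun i m => ?_⟩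
  refine (Frag.run_stmt (S' := onMain ((f i).ser ++ ((g i).ser ++ m))) ?_ (st_le' ?_)
    (st_le' ?_)).seq (run_drop (f i) ?_)
  all_goals simp [BTree.ser, BTree.size]
  all_goals omega

/-- Exchange the two components. -/
theorem swap {f g : ι → BTree} :
    Maps M (fun i => .node (f i) (g i)) fun i => .node (g i) (f i) := by
  refine ⟨(Frag.stmt (popMain (resetReg .halt))).seq (OnlineBribery.swap.seq
    (Frag.stmt (pushMain (fun _ => none) .halt))), fun i =>
    4 * (BTree.node (f i) (g i)).size + 1,
    (((PolyBdd.const 4).mul .self).add (.const 1)), fun i m => ?_⟩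
  refine (Frag.run_stmt (S' := onMain ((f i).ser ++ ((g i).ser ++ m))) ?_ (st_le' ?_)
    (st_le' ?_)).seq ((run_swap (y := M.tm.initialState) (f i) (g i) ?_).seq (Frag.run_stmt ?_ (st_le' ?_) (st_le' ?_)))
  all_goals simp [BTree.ser, BTree.size]
  all_goals omega

theorem fst {f g : ι → BTree} : Maps M (fun i => .node (f i) (g i)) f := swap.comp snd

/-- Case distinction on the first symbol of the tree. -/
theorem split (φ : Option Γ' → Bool)
    (h₁ : Maps M (fun i : {i // φ ((e i).ser.head?.getD none) = true} => e i) fun i => e' i)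
    (h₂ : Maps M (fun i : {i // φ ((e i).ser.head?.getD none) = false} => e i) fun i => e' i) :
    Maps M e e' := by
  obtain ⟨F, B, ⟨k, hk⟩, h⟩ := h₁
  obtain ⟨F', B', ⟨k', hk'⟩, h'⟩ := h₂
  -- `B` and `B'` are defined on the two subtypes only, so their polynomial majorants serve as a
  -- bound for every `i`. The inspected symbol is pushed back.
  refine ⟨Frag.split (popMain (pushMain (fun v => v.1.getD none)
    (branchReg (fun r => φ (r.getD none)) (resetReg (.goto fun _ => true))
      (resetReg (.goto fun _ => false))))) F F', fun i =>
    ((e i).size + 2) ^ k + ((e i).size + 2) ^ k' + (e i).size,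
    (((PolyBdd.self.add (.const 2)).pow k).add ((PolyBdd.self.add (.const 2)).pow k')).add .self,
    fun i m => ?_⟩
  obtain ⟨x, l, hx⟩ : ∃ x l, (e i).ser = x :: l := by
    cases e i <;> exact ⟨_, _, rfl⟩
  cases hφ : φ ((e i).ser.head?.getD none) with
  | true =>
    refine Frag.run_split_true (S' := onMain ((e i).ser ++ m)) (v' := start) ?_
      (st_le' (by simp; omega)) ((h ⟨i, hφ⟩ m).mono ?_)
    · rw [hx] at hφ ⊢
      simp at hφ
      simp [hφ]
    · have := hk ⟨i, hφ⟩
      dsimp only at this ⊢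
      omega
  | false =>
    refine Frag.run_split_false (S' := onMain ((e i).ser ++ m)) (v' := start) ?_
      (st_le' (by simp; omega)) ((h' ⟨i, hφ⟩ m).mono ?_)
    · rw [hx] at hφ ⊢
      simp at hφ
      simp [hφ]
    · have := hk' ⟨i, hφ⟩
      dsimp only at this ⊢
      omega

/-- A loop whose intermediate trees have polynomial size. -/
theorem loop {α : Type*} {enc : α → BTree} {c : α → Bool} {f : α → α}
    (hc : Maps M enc fun x => .leaf (.bit (c x)))
    (hf : Maps M (fun x : {x // c x = true} => enc x) fun x => enc (f x))
    {ι : Type*} {a b : ι → α} (n : ι → ℕ) (hn : ∀ i, f^[n i] (a i) = b i)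
    (hcn : ∀ i, c (b i) = false) (hlt : ∀ i, ∀ j < n i, c (f^[j] (a i)) = true)
    {s : ι → ℕ} (hs : PolyBdd s fun i => (enc (a i)).size)
    (hle : ∀ i, ∀ j ≤ n i, (enc (f^[j] (a i))).size ≤ s i) :
    Maps M (fun i => enc (a i)) fun i => enc (b i) := by
  obtain ⟨F, B, ⟨k, hk⟩, h⟩ := hc
  obtain ⟨F', B', ⟨k', hk'⟩, h'⟩ := hf
  refine ⟨Frag.loop (dup.seq F) (popMain (branchReg (· = some (some (Γ'.bit true)))
    (resetReg (.goto fun _ => ())) (resetReg .halt))) F', fun i =>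
    (s i + 2) ^ k + (s i + 2) ^ k' + 8 * s i + 2,
    ((((hs.add (.const 2)).pow k).add ((hs.add (.const 2)).pow k')).add
      ((PolyBdd.const 8).mul hs)).add (.const 2), fun i m => ?_⟩
  -- Induction on the number `d` of rounds still to come. Every round reuses the same space, so `n
  -- i` does not enter the bound.
  suffices H : ∀ d ≤ n i, (Frag.loop (dup.seq F) (popMain (branchReg
      (· = some (some (Γ'.bit true))) (resetReg (.goto fun _ => ())) (resetReg .halt))) F').Run
      (m.length + ((s i + 2) ^ k + (s i + 2) ^ k' + 8 * s i + 2))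
      start (onMain ((enc (f^[n i - d] (a i))).ser ++ m)) start
      (onMain ((enc (b i)).ser ++ m)) by
    simpa using H (n i) le_rfl
  intro d hd
  -- The test consumes a duplicate and leaves its answer on top of the current state.
  have hT : ∀ j ≤ n i, (dup.seq F).Run
      (m.length + ((s i + 2) ^ k + (s i + 2) ^ k' + 8 * s i + 2)) start
      (onMain ((enc (f^[j] (a i))).ser ++ m)) start
      (onMain (some (Γ'.bit (c (f^[j] (a i)))) :: ((enc (f^[j] (a i))).ser ++ m))) := by
    intro j hj
    have h₁ := hle i j hj
    have h₂ := (hk (f^[j] (a i))).trans (Nat.pow_le_pow_left (Nat.add_le_add_right h₁ 2) k)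
    exact (run_dup _ (by omega)).seq ((h (f^[j] (a i)) _).mono (by simp; omega))
  induction d with
  | zero =>
    have h₁ := hle i (n i) le_rfl
    have h₂ := hT (n i) le_rfl
    rw [hn] at h₁ h₂
    rw [hcn] at h₂
    rw [Nat.sub_zero, hn]
    refine Frag.run_loop_stop h₂ ?_ (st_le' (by simp; omega))
    simp
  | succ d ih =>
    have h₁ := hle i (n i - (d + 1)) (by omega)
    have h₂ := hT (n i - (d + 1)) (by omega)
    have h₃ := hlt i (n i - (d + 1)) (by omega)
    have h₄ := (hk' ⟨_, h₃⟩).trans (Nat.pow_le_pow_left (Nat.add_le_add_right h₁ 2) k')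
    have h₅ := ih (by omega)
    rw [show n i - d = n i - (d + 1) + 1 by omega, Function.iterate_succ_apply'] at h₅
    refine Frag.run_loop_step h₂ ?_ ((h' ⟨_, h₃⟩ m).mono ?_) h₅
    · rw [h₃]; simp
    · omega

end Maps

end Machine

end

/-! ### Oracle calls, the machine of a program, and the inclusion of P in PSPACE. -/

section

section Machine

/-! ## Calling the oracle machine -/

section Oracle

variable {M : TM2ComputableAux Γ' Bool}

/-- A statement of the oracle machine, executed on the oracle stacks. -/
def lift : TM2.Stmt M.tm.Γ M.tm.Λ M.tm.σ → Code M M.tm.Λ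
  | .push k g q => .push (.inr k) (fun v => g v.2) (lift q)
  | .peek k g q => .peek (.inr k) (fun v x => (v.1, g v.2 x)) (lift q)
  | .pop k g q => .pop (.inr k) (fun v x => (v.1, g v.2 x)) (lift q)
  | .load g q => .load (fun v => (v.1, g v.2)) (lift q)
  | .branch g q₁ q₂ => .branch (fun v => g v.2) (lift q₁) (lift q₂)
  | .goto l => .goto fun v => l v.2
  | .halt => .halt

def liftCfg (m : List (Option Γ')) (c : TM2.Cfg M.tm.Γ M.tm.Λ M.tm.σ) :
    TM2.Cfg (Alph M) M.tm.Λ (Reg M) :=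
  ⟨c.l, (none, c.var), st m [] [] [] [] [] c.stk⟩

theorem stepAux_lift (m : List (Option Γ')) (q : TM2.Stmt M.tm.Γ M.tm.Λ M.tm.σ) (v : M.tm.σ)
    (S : ∀ k, List (M.tm.Γ k)) :
    TM2.stepAux (lift q) (none, v) (st m [] [] [] [] [] S) = liftCfg m (TM2.stepAux q v S) := by
  induction q generalizing v S with
  | push k g q ih =>
    exact (congrArg (TM2.stepAux (lift q) _) (update_inr k (g v :: S k))).trans (ih _ _)
  | peek k g q ih => exact ih _ _
  | pop k g q ih =>
    exact (congrArg (TM2.stepAux (lift q) _) (update_inr k (S k).tail)).trans (ih _ _)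
  | load g q ih => exact ih _ _
  | branch g q₁ q₂ ih₁ ih₂ => cases h : g v <;> simp [lift, ih₁, ih₂, h]
  | goto l => rfl
  | halt => rfl

variable (M) in
/-- The oracle machine as a fragment. -/
def oracle : MFrag M :=
  have := M.tm.ΛFin
  { Λ := M.tm.Λ, entry := M.tm.main, code := fun l => lift (M.tm.m l) }

/-- The oracle machine works on its own stacks while `m` rests on the main stack, so the two space
demands need at most be added. -/
theorem path_oracle {m : List (Option Γ')} {B : ℕ} {c c' : M.tm.Cfg}
    (h : Path M.tm.step (Within B) c c') :
    Path (TM2.step (oracle M).code) (Within (m.length + B)) (liftCfg m c) (liftCfg m c') := by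
  refine h.map _ (fun c c' hc => ?_) (fun c hc => ?_)
  · obtain ⟨_ | l, v, S⟩ := c
    · simp at hc
    · have hc' : TM2.stepAux (M.tm.m l) v S = c' := Option.some.inj hc
      subst hc'
      simp only [oracle, liftCfg, TM2.step, stepAux_lift]
  · refine st_le ?_ ?_ ?_ ?_ ?_ ?_ fun k => (hc k).trans (by omega)
    all_goals simp

/-- Move a tree that represents a string to the stack `a`. -/
def stringToA : MFrag M :=
  ⟨Unit, (), fun _ => popMain (branchReg (· = some none)
    (popMain (pushA (fun v => v.1.getD none) (.goto fun _ => ()))) (resetReg .halt))⟩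

/-- In prefix notation a string alternates `none` with its symbols and ends in the blank leaf:
reading `none` announces one more symbol, and anything else ends the string. -/
theorem run_stringToA (s : List Γ') {m a : List (Option Γ')} {B : ℕ}
    (h : m.length + a.length + 2 * s.length + 1 ≤ B) {y : M.tm.σ} (r : Option (Option Γ')) :
    stringToA.Run B (r, y) (st ((BTree.ofString s).ser ++ m) a [] [] [] [] noStk)
      (none, y) (st m ((s.map some).reverse ++ a) [] [] [] [] noStk) := by
  induction s generalizing a r with
  | nil =>
    refine .head (st_le' ?_) ?_ (.refl (st_le' ?_))
    · simp [BTree.ofString, BTree.ser] at h ⊢; omega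
    · simp [stringToA, BTree.ofString, BTree.ser]
    · simp at h ⊢; omega
  | cons x s ih =>
    refine .head (st_le' ?_) ?_ (c' := ⟨some (), (some (some x), y),
      st ((BTree.ofString s).ser ++ m) (some x :: a) [] [] [] [] noStk⟩) ?_
    · simp [BTree.ofString, BTree.ser, BTree.size_ofString] at h ⊢
      omega
    · simp [stringToA, BTree.ofString, BTree.ser]
    · rw [List.map_cons, List.reverse_cons, List.append_assoc]
      exact ih (by simp at h ⊢; omega) _

section OracleStack

variable {m a b c : List (Option Γ')} {i : List Γ'} {o : List Bool} {Λ : Type}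

theorem stepAux_pushOracle {k : M.tm.K} (f : Reg M → M.tm.Γ k) (q : Code M Λ) (v : Reg M)
    (l : List (M.tm.Γ k)) :
    TM2.stepAux (.push (.inr k) f q) v (st m a b c i o (Function.update noStk k l)) =
      TM2.stepAux q v (st m a b c i o (Function.update noStk k (f v :: l))) :=
  (congrArg (TM2.stepAux q v) (update_inr k (f v :: (Function.update noStk k l : ∀ k,
    List (M.tm.Γ k)) k))).trans (by rw [Function.update_idem, Function.update_self])

def popOracle (k : M.tm.K) (f : Reg M → Option (M.tm.Γ k) → Reg M) (q : Code M Λ) : Code M Λ :=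
  .pop (.inr k) f q

theorem stepAux_popOracle {k : M.tm.K} (f : Reg M → Option (M.tm.Γ k) → Reg M) (q : Code M Λ)
    (v : Reg M) (l : List (M.tm.Γ k)) :
    TM2.stepAux (popOracle k f q) v (st m a b c i o (Function.update noStk k l)) =
      TM2.stepAux q (f v l.head?) (st m a b c i o (Function.update noStk k l.tail)) :=
  (congrArg (TM2.stepAux q _) (update_inr k ((Function.update noStk k l : ∀ k,
    List (M.tm.Γ k)) k).tail)).trans (by
      rw [Function.update_idem]
      have h : st m a b c i o (Function.update noStk k l) (.inr k) = l :=
        Function.update_self (β := fun k => List (M.tm.Γ k)) k l noStk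
      rw [h, Function.update_self]
      rfl)

theorem update_noStk_le {k : M.tm.K} {l : List (M.tm.Γ k)} {B : ℕ} (h : l.length ≤ B) (j) :
    (Function.update (noStk (M := M)) k l j).length ≤ B := by
  by_cases hk : j = k
  · subst hk; simpa using h
  · simp [Function.update_of_ne hk]

end OracleStack

/-- Move the stack `a` to the input stack of the oracle machine. -/
def aToOracle : MFrag M :=
  ⟨Unit, (), fun _ => popA (branchReg Option.isNone .halt
    (.push (.inr M.tm.k₀) (fun v => M.inputAlphabet.symm ((v.1.getD none).getD Γ'.blank))
      (.goto fun _ => ())))⟩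

theorem run_aToOracle (s : List Γ') {m : List (Option Γ')} {l : List (M.tm.Γ M.tm.k₀)} {B : ℕ}
    (h : m.length + l.length + s.length ≤ B) {y : M.tm.σ} (r : Option (Option Γ')) :
    aToOracle.Run B (r, y)
      (st m (s.map some) [] [] [] [] (Function.update noStk M.tm.k₀ l)) (none, y)
      (st m [] [] [] [] [] (Function.update noStk M.tm.k₀
        ((s.map M.inputAlphabet.symm).reverse ++ l))) := by
  induction s generalizing l r with
  | nil =>
    refine .head (st_le ?_ ?_ ?_ ?_ ?_ ?_ (update_noStk_le ?_)) ?_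
      (.refl (st_le ?_ ?_ ?_ ?_ ?_ ?_ (update_noStk_le ?_)))
    case refine_8 => simp [aToOracle]
    all_goals simp at h ⊢
    all_goals omega
  | cons x s ih =>
    refine .head (st_le ?_ ?_ ?_ ?_ ?_ ?_ (update_noStk_le ?_)) ?_ (c' := ⟨some (), (some (some x), y),
      st m (s.map some) [] [] [] [] (Function.update noStk M.tm.k₀
        (M.inputAlphabet.symm x :: l))⟩) ?_
    case refine_8 => simp [aToOracle, stepAux_pushOracle]
    case refine_9 =>
      rw [List.map_cons, List.reverse_cons, List.append_assoc]
      exact ih (by simp at h ⊢; omega) _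
    all_goals simp at h ⊢
    all_goals omega

/-- Move the answer of the oracle machine to the main stack. -/
def answerToMain : MFrag M :=
  Frag.stmt (popOracle M.tm.k₁ (fun v x => (x.map fun b => some (.bit (M.outputAlphabet b)), v.2))
    (pushMain (fun v => v.1.getD none) (resetReg .halt)))

theorem run_answerToMain (x : Bool) {m : List (Option Γ')} {B : ℕ} (h : m.length + 1 ≤ B)
    {y : M.tm.σ} :
    answerToMain.Run B (none, y)
      (st m [] [] [] [] [] (Function.update noStk M.tm.k₁ [M.outputAlphabet.symm x])) (none, y)
      (onMain (some (.bit x) :: m)) := by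
  refine Frag.run_stmt ?_ (st_le ?_ ?_ ?_ ?_ ?_ ?_ (update_noStk_le ?_)) (st_le' ?_)
  case refine_1 =>
    have h : Function.update (noStk (M := M)) M.tm.k₁ [] = noStk := Function.update_eq_self _ _
    rw [stepAux_popOracle, List.tail_cons, h]
    simp
  all_goals first | omega | (simp; done) | (simp; omega)

theorem initList_stk (s : List (M.tm.Γ M.tm.k₀)) :
    initList M.tm s = ⟨some M.tm.main, M.tm.initialState, Function.update noStk M.tm.k₀ s⟩ := by
  unfold initList
  congr 1
  funext k
  by_cases h : k = M.tm.k₀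
  · subst h
    simp
  · simp [h]

/-- A machine that has produced its output is back in its initial state with all other stacks empty.
Once the answer is removed, the oracle is therefore ready for the next call. -/
theorem haltList_stk (s : List (M.tm.Γ M.tm.k₁)) :
    haltList M.tm s = ⟨none, M.tm.initialState, Function.update noStk M.tm.k₁ s⟩ := by
  unfold haltList
  congr 1
  funext k
  by_cases h : k = M.tm.k₁
  · subst h
    simp
  · simp [h]

end Oracle

open Classical in
theorem maps_oracle {L : Language Γ'} (D : DecidesInPolySpace L) :
    Maps D.toTM2ComputableAux BTree.ofString fun s => .leaf (.bit (decide (s ∈ L))) := by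
  refine ⟨(stringToA.seq aToOracle).seq ((oracle _).seq answerToMain), fun s =>
    2 * s.length + 1 + D.space.eval s.length,
    ((((PolyBdd.const 2).mul ?_).add (.const 1)).add (.poly D.space ?_)), fun s m => ?_⟩
  iterate 2 exact PolyBdd.self.mono fun s => by rw [BTree.size_ofString]; omega
  have hD : Path D.tm.step (Within (D.space.eval s.length))
      (initList D.tm (s.map D.inputAlphabet.symm))
      (haltList D.tm [D.outputAlphabet.symm (decide (s ∈ L))]) :=
    .of_reaches (reaches_of_iterate (D.outputsFun s).evals_in_steps) (D.space_le s)
  rw [initList_stk, haltList_stk] at hD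
  have h₁ := run_stringToA (M := D.toTM2ComputableAux) s (m := m) (a := [])
    (B := m.length + (2 * s.length + 1 + D.space.eval s.length)) (by simp; omega)
    (y := D.tm.initialState) none
  have h₂ := run_aToOracle (M := D.toTM2ComputableAux) s.reverse (m := m) (l := [])
    (B := m.length + (2 * s.length + 1 + D.space.eval s.length)) (by simp; omega)
    (y := D.tm.initialState) none
  have h₃ := (path_oracle (M := D.toTM2ComputableAux) (m := m) hD).mono
    (Q := Within (m.length + (2 * s.length + 1 + D.space.eval s.length)))
    fun c hc k => (hc k).trans (by omega)
  have h₄ := run_answerToMain (M := D.toTM2ComputableAux) (decide (s ∈ L)) (m := m)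
    (B := m.length + (2 * s.length + 1 + D.space.eval s.length)) (by omega)
    (y := D.tm.initialState)
  have e : Function.update (noStk (M := D.toTM2ComputableAux)) D.tm.k₀ [] = noStk :=
    Function.update_eq_self _ _
  rw [List.append_nil, ← List.map_reverse] at h₁
  rw [e, List.append_nil, ← List.map_reverse, List.reverse_reverse] at h₂
  exact (h₁.seq h₂).seq (Frag.Run.seq h₃ h₄)

/-! ## Deciding a language by a tree function -/

section Decide

variable {M : TM2ComputableAux Γ' Bool}

def inputToA : MFrag M :=
  ⟨Unit, (), fun _ => .pop (.inl .inp) (fun v (x : Option Γ') => (x.map some, v.2))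
    (branchReg Option.isNone .halt (pushA (fun v => v.1.getD none) (.goto fun _ => ())))⟩

theorem run_inputToA (s : List Γ') {a : List (Option Γ')} {B : ℕ} (h : a.length + s.length ≤ B)
    {y : M.tm.σ} (r : Option (Option Γ')) :
    inputToA.Run B (r, y) (st [] a [] [] s [] noStk) (none, y)
      (st [] ((s.map some).reverse ++ a) [] [] [] [] noStk) := by
  have hp : ∀ (q : Code M Unit) (v : Reg M) a i, TM2.stepAux
      (.pop (.inl .inp) (fun v (x : Option Γ') => (x.map some, v.2)) q) v
      (st [] a [] [] i [] noStk) =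
      TM2.stepAux q (i.head?.map some, v.2) (st [] a [] [] i.tail [] noStk) :=
    fun q v a i => congrArg (TM2.stepAux q _) (update_inp _)
  induction s generalizing a r with
  | nil =>
    refine .head (st_le' ?_) ?_ (.refl (st_le' ?_))
    · simp at h ⊢; omega
    · simp [inputToA, hp]
    · simp at h ⊢; omega
  | cons x s ih =>
    refine .head (st_le' ?_) ?_
      (c' := ⟨some (), (some (some x), y), st [] (some x :: a) [] [] s [] noStk⟩) ?_
    · simp at h ⊢; omega
    · simp [inputToA, hp]
    · rw [List.map_cons, List.reverse_cons, List.append_assoc]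
      exact ih (by simp at h ⊢; omega) _

/-- Turn the stack `a` into the tree of a string, on top of the tree on the main stack. -/
def aToString : MFrag M :=
  ⟨Unit, (), fun _ => popA (branchReg Option.isNone .halt
    (pushMain (fun v => v.1.getD none) (pushMain (fun _ => none) (.goto fun _ => ()))))⟩

theorem run_aToString (s t : List Γ') {B : ℕ} (h : 2 * s.length + 2 * t.length + 1 ≤ B)
    {y : M.tm.σ} (r : Option (Option Γ')) :
    aToString.Run B (r, y) (st (BTree.ofString t).ser (s.map some) [] [] [] [] noStk) (none, y)
      (onMain (BTree.ofString (s.reverse ++ t)).ser) := by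
  induction s generalizing t r with
  | nil =>
    refine .head (st_le' ?_) ?_ (.refl (st_le' ?_))
    · simp [BTree.size_ofString] at h ⊢; omega
    · simp [aToString]
    · simp [BTree.size_ofString] at h ⊢; omega
  | cons x s ih =>
    refine .head (st_le' ?_) ?_ (c' := ⟨some (), (some (some x), y),
      st (BTree.ofString (x :: t)).ser (s.map some) [] [] [] [] noStk⟩) ?_
    · simp [BTree.size_ofString] at h ⊢; omega
    · simp [aToString, BTree.ofString, BTree.ser]
    · rw [List.reverse_cons, List.append_assoc]
      exact ih (x :: t) (by simp at h ⊢; omega) _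

/-- Move the answer to the output stack. -/
def mainToOutput : MFrag M :=
  Frag.stmt (popMain (.push (.inl .out) (fun v => decide (v.1 = some (some (Γ'.bit true))))
    (resetReg .halt)))

theorem run_mainToOutput (x : Bool) {B : ℕ} (h : 1 ≤ B) {y : M.tm.σ} :
    mainToOutput.Run B (none, y) (onMain (BTree.leaf (.bit x)).ser) (none, y)
      (st [] [] [] [] [] [x] noStk) := by
  have hp : ∀ (q : Code M Unit) (v : Reg M) (f : Reg M → Bool), TM2.stepAux
      (.push (.inl .out) f q) v (st [] [] [] [] [] [] noStk) =
      TM2.stepAux q v (st [] [] [] [] [] [f v] noStk) :=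
    fun q v f => congrArg (TM2.stepAux q _) (update_out _)
  refine Frag.run_stmt ?_ (st_le' ?_) (st_le' ?_)
  · simp [BTree.ser, hp]
  all_goals simp [BTree.ser]
  all_goals omega

theorem run_mono_start {F : MFrag M} {S S' : ∀ k, List (Alph M k)} {B : ℕ}
    (h : F.Run B start S start S') {c : TM2.Cfg (Alph M) F.Λ (Reg M)}
    (hc : StateTransition.Reaches (TM2.step F.code) ⟨some F.entry, start, S⟩ c) : Within B c :=
  Path.holds_of_reaches h rfl hc

variable (M) in
/-- The machine of a program. -/
def machine (F : MFrag M) : TM2ComputableAux Γ' Bool :=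
  have := M.tm.kFin
  have := M.tm.σFin
  have := F.fin
  { tm := { K := Own ⊕ M.tm.K
            k₀ := .inl .inp
            k₁ := .inl .out
            Γ := Alph M
            Λ := F.Λ
            main := F.entry
            σ := Reg M
            initialState := start
            Γk₀Fin := inferInstanceAs (Fintype Γ')
            m := F.code }
    inputAlphabet := Equiv.refl Γ'
    outputAlphabet := Equiv.refl Bool }

-- The program is wrapped by code that builds the tree of the input from its last symbol backwards,
-- on top of the blank leaf, and by code that moves the answer to the output stack.
open Classical in
theorem mem_PSPACE_of_maps {L : Language Γ'}
    (h : Maps M BTree.ofString fun s => .leaf (.bit (decide (s ∈ L)))) : L ∈ PSPACE := by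
  obtain ⟨F, B, ⟨k, hk⟩, h⟩ := h
  let G : MFrag M := ((inputToA.seq (Frag.stmt (pushMain (fun _ => some Γ'.blank) .halt))).seq
    aToString).seq (F.seq mainToOutput)
  -- A string of length `n` is a tree of size `2 * n + 1`, and `PolyBdd` adds `2` to form the base
  -- of the power.
  have hG : ∀ s : List Γ', G.Run (2 * s.length + 2 + (2 * s.length + 3) ^ k) start
      (st [] [] [] [] s [] noStk) start (st [] [] [] [] [] [decide (s ∈ L)] noStk) := by
    intro s
    have h₁ := run_inputToA (M := M) s (a := [])
      (B := 2 * s.length + 2 + (2 * s.length + 3) ^ k) (by simp; omega)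
      (y := M.tm.initialState) none
    have h₂ := run_aToString (M := M) s.reverse []
      (B := 2 * s.length + 2 + (2 * s.length + 3) ^ k) (by simp; omega)
      (y := M.tm.initialState) none
    have h₃ := (h s []).mono (B' := 2 * s.length + 2 + (2 * s.length + 3) ^ k) (by
      have := hk s
      simp only [BTree.size_ofString, show 2 * s.length + 1 + 2 = 2 * s.length + 3 by rfl] at this
      simp
      omega)
    have h₄ := run_mainToOutput (M := M) (decide (s ∈ L))
      (B := 2 * s.length + 2 + (2 * s.length + 3) ^ k) (by omega) (y := M.tm.initialState)
    simp only [List.append_nil, List.reverse_reverse, List.map_reverse] at h₁ h₂ h₃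
    refine ((h₁.seq (Frag.run_stmt ?_ (st_le' ?_) (st_le' ?_))).seq h₂).seq (h₃.seq h₄)
    · simp [BTree.ofString, BTree.ser]
    all_goals simp [BTree.ofString, BTree.ser]
    all_goals omega
  have hi : ∀ s : List Γ', initList (machine M G).tm (s.map (machine M G).inputAlphabet.invFun) =
      (⟨some G.entry, start, st [] [] [] [] s [] noStk⟩ : TM2.Cfg (Alph M) G.Λ (Reg M)) := by
    intro s
    unfold initList
    congr 1
    funext k
    rcases k with k | k
    · cases k <;> try rfl
      exact List.map_id s
    · rfl
  have ho : ∀ b : Bool, haltList (machine M G).tm ((encodeBool b).map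
      (machine M G).outputAlphabet.invFun) =
      (⟨none, start, st [] [] [] [] [] [b] noStk⟩ : TM2.Cfg (Alph M) G.Λ (Reg M)) := by
    intro s
    unfold haltList
    congr 1
    funext k
    rcases k with k | k
    · cases k <;> rfl
    · rfl
  refine ⟨{ toTM2ComputableAux := machine M G
            space := 2 * .X + 2 + (2 * .X + 3) ^ k
            outputsFun := fun s => ?_
            space_le := fun s c hc j => ?_ }⟩
  · refine ⟨(hG s).exists_iterate.choose, ?_⟩
    rw [hi, Option.map_some, ho]
    exact (hG s).exists_iterate.choose_spec
  · rw [hi] at hc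
    have := run_mono_start (hG s) hc j
    exact le_of_le_of_eq this (by simp)

end Decide

/-! ## Polynomial time is polynomial space -/

section Time

variable {K : Type} [DecidableEq K] {Γ : K → Type} {Λ σ : Type}

/-- The number of pushes in a statement. -/
def pushes : TM2.Stmt Γ Λ σ → ℕ
  | .push _ _ q => pushes q + 1
  | .peek _ _ q => pushes q
  | .pop _ _ q => pushes q
  | .load _ q => pushes q
  | .branch _ q₁ q₂ => pushes q₁ + pushes q₂
  | .goto _ => 0
  | .halt => 0

theorem length_stepAux_le (q : TM2.Stmt Γ Λ σ) (v : σ) (S : ∀ k, List (Γ k)) (k : K) :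
    ((TM2.stepAux q v S).stk k).length ≤ (S k).length + pushes q := by
  induction q generalizing v S with
  | push j g q ih =>
    refine (ih _ _).trans ?_
    by_cases h : k = j
    · subst h; simp [pushes]; omega
    · simp [pushes, Function.update_of_ne h]
      try omega
  | pop j g q ih =>
    refine (ih _ _).trans ?_
    by_cases h : k = j
    · subst h; simp [pushes]
    · simp [pushes, Function.update_of_ne h]
  | peek j g q ih => exact ih _ _
  | load g q ih => exact ih _ _
  | branch g q₁ q₂ ih₁ ih₂ =>
    have h₁ := ih₁ v S
    have h₂ := ih₂ v S
    cases h : g v <;> simp [h, pushes] <;> omega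
  | goto => simp
  | halt => simp

/-- There are finitely many labels, so the sum over all of them is a constant that bounds the growth
of a stack in any single step. -/
theorem length_iterate_le [Fintype Λ] (m : Λ → TM2.Stmt Γ Λ σ) (n : ℕ) {c c' : TM2.Cfg Γ Λ σ}
    (h : (flip bind (TM2.step m))^[n] (some c) = some c') (k : K) :
    (c'.stk k).length ≤ (c.stk k).length + n * ∑ l, pushes (m l) := by
  induction n generalizing c' with
  | zero => cases h; simp
  | succ n ih =>
    rw [Function.iterate_succ_apply'] at h
    cases hc : (flip bind (TM2.step m))^[n] (some c) with
    | none => rw [hc] at h; cases h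
    | some d =>
      rw [hc] at h
      replace h : TM2.step m d = some c' := h
      obtain ⟨_ | l, v, S⟩ := d
      · simp at h
      · simp only [TM2.step, Option.some.injEq] at h
        subst h
        have h₁ := length_stepAux_le (m l) v S k
        have h₂ := ih hc
        have h₃ := Finset.single_le_sum (f := fun l => pushes (m l)) (fun _ _ => Nat.zero_le _)
          (Finset.mem_univ l)
        simp only at h₁ h₂ h₃ ⊢
        rw [Nat.add_mul, one_mul]
        omega

end Time

theorem exists_iterate_of_reaches {C : Type*} {step : C → Option C} {a c : C}
    (h : StateTransition.Reaches step a c) : ∃ n, (flip bind step)^[n] (some a) = some c :=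
  (Path.of_reaches h (P := fun _ => True) fun _ _ => trivial).exists_iterate

theorem iterate_none {C : Type*} (step : C → Option C) (n : ℕ) :
    (flip bind step)^[n] none = none := by
  induction n with
  | zero => rfl
  | succ n ih => rw [Function.iterate_succ_apply]; exact ih

theorem PTIME_subset_PSPACE : (PTIME : Set (Language Γ')) ⊆ PSPACE := by
  rintro L ⟨T⟩
  have := T.tm.ΛFin
  refine ⟨{ toTM2ComputableAux := T.toTM2ComputableAux
            space := .X + T.time * .C (∑ l, pushes (T.tm.m l))
            outputsFun := fun s => (T.outputsFun s).toTM2Outputs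
            space_le := fun s c hc k => ?_ }⟩
  obtain ⟨n, hn⟩ := exists_iterate_of_reaches hc
  have hN := (T.outputsFun s).evals_in_steps
  have hle := (T.outputsFun s).steps_le_m
  -- No configuration is reached later than the halting one, since that one has no successor.
  have hn' : n ≤ (T.outputsFun s).steps := by
    by_contra hlt
    obtain ⟨d, rfl⟩ := Nat.exists_eq_add_of_lt (not_le.mp hlt)
    rw [show (T.outputsFun s).steps + d + 1 = d + 1 + (T.outputsFun s).steps by omega,
      Function.iterate_add_apply] at hn
    erw [hN] at hn
    rw [Function.iterate_succ_apply] at hn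
    have hnone : ∀ l, flip bind T.tm.step (Option.map (haltList T.tm) (some l)) = none :=
      fun _ => rfl
    rw [hnone, iterate_none] at hn
    cases hn
  have h₁ := length_iterate_le T.tm.m n hn k
  have h₂ : ((initList T.tm (s.map T.inputAlphabet.invFun)).stk k).length ≤ s.length := by
    rw [initList_stk (M := T.toTM2ComputableAux)]
    by_cases h : k = T.tm.k₀
    · subst h; simp
    · simp [Function.update_of_ne h]
  have h₃ := Nat.mul_le_mul_right (∑ l, pushes (T.tm.m l)) (hn'.trans hle)
  simp only [Polynomial.eval_add, Polynomial.eval_X, Polynomial.eval_mul, Polynomial.eval_C]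
  refine h₁.trans (Nat.add_le_add h₂ h₃)

end Machine

end

/-! ### Computability in polynomial space for functions between encoded types. -/

section

/-! ## Functions between encoded types that are computed in polynomial space -/

/-- Types whose elements are represented by trees. -/
class TreeCode (α : Type) where
  enc : α → BTree

open TreeCode

instance : TreeCode Bool := ⟨fun b => .leaf (.bit b)⟩

instance : TreeCode Γ' := ⟨.leaf⟩

instance {α β : Type} [TreeCode α] [TreeCode β] : TreeCode (α × β) :=
  ⟨fun p => .node (enc p.1) (enc p.2)⟩

def encTreeList {α : Type} [TreeCode α] : List α → BTree
  | [] => .leaf .blank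
  | a :: l => .node (enc a) (encTreeList l)

instance {α : Type} [TreeCode α] : TreeCode (List α) := ⟨encTreeList⟩

section Size

variable {α β : Type} [TreeCode α] [TreeCode β]

/-- The size of the tree that represents `a`. -/
def sz (a : α) : ℕ := (enc a).size

theorem sz_pos (a : α) : 0 < sz a := BTree.size_pos _

@[simp] theorem sz_bool (b : Bool) : sz b = 1 := rfl
@[simp] theorem sz_symbol (a : Γ') : sz a = 1 := rfl
@[simp] theorem sz_pair (p : α × β) : sz p = 1 + sz p.1 + sz p.2 := rfl
@[simp] theorem sz_nil : sz ([] : List α) = 1 := rfl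
@[simp] theorem sz_cons (a : α) (l : List α) : sz (a :: l) = 1 + sz a + sz l := rfl

theorem enc_string (s : List Γ') : enc s = BTree.ofString s := by
  induction s with
  | nil => rfl
  | cons a s ih => exact congrArg (BTree.node _) ih

theorem sz_append (l l' : List α) : sz (l ++ l') + 1 = sz l + sz l' := by
  induction l with
  | nil => simp; omega
  | cons a l ih => simp; omega

theorem length_lt_sz (l : List α) : l.length < sz l := by
  induction l with
  | nil => simp
  | cons a l ih => simp; omega

theorem sz_le_of_mem {a : α} {l : List α} (h : a ∈ l) : sz a ≤ sz l := by
  induction l with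
  | nil => simp at h
  | cons b l ih =>
    rcases List.mem_cons.1 h with rfl | h
    · simp; omega
    · have := ih h
      simp; omega

theorem sz_tail_le (l : List α) : sz l.tail ≤ sz l := by
  cases l <;> simp

end Size

/-- The function `f` is computed in polynomial space by a program with oracle machine `M`. -/
@[fun_prop]
def PS (M : TM2ComputableAux Γ' Bool) {α β : Type} [TreeCode α] [TreeCode β] (f : α → β) : Prop :=
  Maps M (fun a => enc a) fun a => enc (f a)

variable {M : TM2ComputableAux Γ' Bool} {α β γ δ σ : Type} [TreeCode α] [TreeCode β] [TreeCode γ]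
  [TreeCode δ] [TreeCode σ]

theorem Maps.congr {ι : Type*} {e e' e₁ e₁' : ι → BTree} (h : Maps M e e') (h₁ : ∀ i, e i = e₁ i)
    (h₂ : ∀ i, e' i = e₁' i) : Maps M e₁ e₁' := by
  obtain rfl : e = e₁ := funext h₁
  obtain rfl : e' = e₁' := funext h₂
  exact h

namespace PS

theorem bdd {f : α → β} (h : PS M f) : PolyBdd (fun a => sz (f a)) fun a : α => sz a := h.size

@[fun_prop]
theorem id' : PS M fun a : α => a := Maps.id

@[fun_prop]
theorem const' (b : β) : PS M fun _ : α => b := Maps.const _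

@[fun_prop]
theorem comp {f : β → γ} {g : α → β} (hf : PS M f) (hg : PS M g) : PS M fun a => f (g a) :=
  Maps.comp hg (hf.reindex g)

@[fun_prop]
theorem pair {f : α → β} {g : α → γ} (hf : PS M f) (hg : PS M g) : PS M fun a => (f a, g a) :=
  Maps.node hf hg

@[fun_prop]
theorem fst : PS M (Prod.fst : α × β → α) := Maps.fst

@[fun_prop]
theorem snd : PS M (Prod.snd : α × β → β) := Maps.snd

theorem of_enc_eq {f : α → β} (h : ∀ a, enc (f a) = enc a) : PS M f :=
  Maps.id.congr (fun _ => rfl) fun a => (h a).symm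

@[fun_prop]
theorem cons {f : α → β} {g : α → List β} (hf : PS M f) (hg : PS M g) :
    PS M fun a => f a :: g a := Maps.node hf hg

/-- Case distinction for a predicate that can be read off the root of the tree. -/
theorem root (φ : Option Γ' → Bool) : PS M fun a : α => φ ((enc a).ser.head?.getD none) :=
  Maps.split φ
    ((Maps.const (.leaf (.bit true))).congr (fun _ => rfl) fun i =>
      congrArg (fun b => BTree.leaf (.bit b)) i.2.symm)
    ((Maps.const (.leaf (.bit false))).congr (fun _ => rfl) fun i =>
      congrArg (fun b => BTree.leaf (.bit b)) i.2.symm)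

-- The empty list is a leaf and a nonempty list is a node, so the first symbol of the prefix
-- notation decides.
@[fun_prop]
theorem isEmpty : PS M (List.isEmpty : List α → Bool) := by
  refine Maps.congr (root fun x => x.isSome) (fun _ => rfl) fun l => ?_
  cases l <;> rfl

theorem eq_symbol (c : Γ') : PS M fun a : Γ' => decide (a = c) := by
  refine Maps.congr (root fun x => decide (x = some c)) (fun _ => rfl) fun a => ?_
  simp [enc, BTree.ser]

-- The condition is computed next to its argument. Popping the node marker and the answer leaves the
-- argument to the selected branch.
@[fun_prop]
theorem cond {c : α → Bool} {f g : α → β} (hc : PS M c) (hf : PS M f) (hg : PS M g) :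
    PS M fun a => bif c a then f a else g a := by
  have h : Maps M (fun a : α => enc (c a, a)) fun a => enc (bif c a then f a else g a) := by
    refine Maps.comp (e' := fun a => BTree.node (enc (c a)) (enc a)) Maps.id ?_
    obtain ⟨F, B, hB, hF⟩ := hf
    obtain ⟨G, B', hB', hG⟩ := hg
    refine ⟨(Frag.stmt (popMain (resetReg .halt))).seq (Frag.split (popMain
      (branchReg (· = some (some (Γ'.bit true))) (resetReg (.goto fun _ => true))
        (resetReg (.goto fun _ => false)))) F G), fun a => B a + B' a + (enc a).size + 2, ?_,
      fun a m => ?_⟩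
    · have h : PolyBdd (fun a => B a + B' a + (enc a).size + 2) fun a : α => (enc a).size :=
        ((hB.add hB').add .self).add (.const 2)
      exact h.trans (PolyBdd.self.mono fun a => by simp [BTree.size])
    · refine Frag.Run.seq (v' := start) (S' := onMain ((enc (c a)).ser ++ ((enc a).ser ++ m)))
        (Frag.run_stmt ?_ (st_le' ?_) (st_le' ?_)) ?_
      · simp [BTree.ser]
      · simp [BTree.size, enc]; omega
      · simp [enc, BTree.ser]; try omega
      · dsimp only
        cases hca : c a with
        | true =>
          refine Frag.run_split_true (v' := start) (S' := onMain ((enc a).ser ++ m)) ?_ (st_le' ?_)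
            ((hF a m).mono ?_)
          · simp [enc, BTree.ser]
          · simp [enc, BTree.ser]; omega
          · omega
        | false =>
          refine Frag.run_split_false (v' := start) (S' := onMain ((enc a).ser ++ m)) ?_
            (st_le' ?_) ((hG a m).mono ?_)
          · simp [enc, BTree.ser]
          · simp [enc, BTree.ser]; omega
          · omega
  exact Maps.comp (Maps.node hc Maps.id) h

theorem congr' {f g : α → β} (hf : PS M f) (h : ∀ a, f a = g a) : PS M g := by
  obtain rfl : f = g := funext h
  exact hf

@[fun_prop]
theorem not' {c : α → Bool} (hc : PS M c) : PS M fun a => !c a :=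
  Maps.congr (cond hc (const' false) (const' true)) (fun _ => rfl) fun a => by cases c a <;> rfl

@[fun_prop]
theorem and' {c d : α → Bool} (hc : PS M c) (hd : PS M d) : PS M fun a => c a && d a :=
  (cond hc hd (const' false)).congr' fun a => by cases c a <;> simp

@[fun_prop]
theorem or' {c d : α → Bool} (hc : PS M c) (hd : PS M d) : PS M fun a => c a || d a :=
  (cond hc (const' true) hd).congr' fun a => by cases c a <;> simp

@[fun_prop]
theorem xor' {c d : α → Bool} (hc : PS M c) (hd : PS M d) : PS M fun a => c a ^^ d a :=
  (cond hc (not' hd) hd).congr' fun a => by cases c a <;> simp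

@[fun_prop]
theorem tail : PS M (List.tail : List α → List α) := by
  refine Maps.split (fun x => x.isNone) ?_ ?_
  · refine (Maps.snd (f := fun i : {l : List α // _} => enc (i.1.head (by
      rintro h; have := i.2; rw [h] at this; simp [enc, encTreeList, BTree.ser] at this)))
      (g := fun i => enc i.1.tail)).congr (fun i => ?_) fun _ => rfl
    obtain ⟨l, hl⟩ := i
    cases l with
    | nil => simp [enc, encTreeList, BTree.ser] at hl
    | cons a l => rfl
  · refine Maps.id.congr (fun _ => rfl) fun i => ?_
    obtain ⟨l, hl⟩ := i
    cases l with
    | nil => rfl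
    | cons a l => exact absurd hl (by simp [enc, encTreeList, BTree.ser])

@[fun_prop]
theorem headD {f : α → List β} (hf : PS M f) (b : β) : PS M fun a => (f a).headD b := by
  refine comp (f := fun l : List β => l.headD b) ?_ hf
  refine Maps.split (fun x => x.isNone) ?_ ?_
  · refine (Maps.fst (f := fun i : {l : List β // _} => enc (i.1.headD b))
      (g := fun i => enc i.1.tail)).congr (fun i => ?_) fun _ => rfl
    obtain ⟨l, hl⟩ := i
    cases l with
    | nil => simp [enc, encTreeList, BTree.ser] at hl
    | cons a l => rfl
  · refine (Maps.const (enc b)).congr (fun _ => rfl) fun i => ?_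
    obtain ⟨l, hl⟩ := i
    cases l with
    | nil => rfl
    | cons a l => exact absurd hl (by simp [enc, encTreeList, BTree.ser])

end PS

/-- Loops are easier to analyse as paths, which compose; this recovers the number of rounds that
`Maps.loop` asks for. -/
theorem Path.exists_loop {S : Type*} {c : S → Bool} {f : S → S} {P : S → Prop} {a b : S}
    (h : Path (fun s => if c s then some (f s) else none) P a b) :
    ∃ n, f^[n] a = b ∧ (∀ j < n, c (f^[j] a) = true) ∧ ∀ j ≤ n, P (f^[j] a) := by
  induction h with
  | refl hp => exact ⟨0, rfl, by simp, fun j hj => by obtain rfl := Nat.le_zero.1 hj; exact hp⟩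
  | @head s s' s'' hp hs _ ih =>
    have hc : c s = true := by
      by_contra hc
      simp [hc] at hs
    obtain rfl : f s = s' := by simpa [hc] using hs
    obtain ⟨n, h₁, h₂, h₃⟩ := ih
    refine ⟨n + 1, h₁, fun j hj => ?_, fun j hj => ?_⟩
    · cases j with
      | zero => exact hc
      | succ j => exact h₂ j (by omega)
    · cases j with
      | zero => exact hp
      | succ j => exact h₃ j (by omega)

/-- A loop whose states have polynomial size. -/
theorem PS.loop {S : Type} [TreeCode S] {c : S → Bool} {f : S → S} (hc : PS M c)
    (hf : Maps M (fun x : {x // c x = true} => enc x.1) fun x => enc (f x))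
    {a b : α → S} (ha : PS M a) {s : α → ℕ} (hs : PolyBdd s fun i : α => sz i)
    (h : ∀ i, Path (fun s => if c s then some (f s) else none) (fun t => sz t ≤ s i) (a i) (b i))
    (hb : ∀ i, c (b i) = false) : PS M b := by
  choose n h₁ h₂ h₃ using fun i => (h i).exists_loop
  -- `a i` may be much smaller than `i`. Carrying `i` along makes the bound `s`, polynomial in the
  -- size of `i`, also polynomial in the size of the initial loop state.
  refine Maps.comp (e' := fun i => TreeCode.enc (i, a i))
    (Maps.node Maps.id ha) ?_
  have : Maps M (fun i => enc (i, a i)) fun i => enc (i, b i) := by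
    refine Maps.loop (α := α × S) (enc := fun p => enc p) (c := fun p => c p.2)
      (f := fun p => (p.1, f p.2)) (hc.comp snd) ?_ (a := fun i => (i, a i))
      (b := fun i => (i, b i)) n (fun i => ?_) (fun i => hb i) (fun i j hj => ?_)
      (s := fun i => 1 + sz i + s i) ?_ (fun i j hj => ?_)
    · refine Maps.node Maps.fst ?_
      refine Maps.comp (e' := fun x : {x : α × S // c x.2 = true} => enc x.1.2) Maps.snd ?_
      exact hf.reindex fun x : {x : α × S // c x.2 = true} => (⟨x.1.2, x.2⟩ : {x // c x = true})
    · have : ∀ m s, (fun p : α × S => (p.1, f p.2))^[m] (i, s) = (i, f^[m] s) := by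
        intro m
        induction m with
        | zero => intro s; rfl
        | succ m ih => intro s; exact ih _
      rw [this, h₁]
    · have : ∀ m s, (fun p : α × S => (p.1, f p.2))^[m] (i, s) = (i, f^[m] s) := by
        intro m
        induction m with
        | zero => intro s; rfl
        | succ m ih => intro s; exact ih _
      rw [this]
      exact h₂ i j hj
    · refine PolyBdd.trans (((PolyBdd.const 1).add .self).add hs)
        (PolyBdd.self.mono fun i => ?_)
      change sz i ≤ sz (i, a i)
      simp; omega
    · have : ∀ m s, (fun p : α × S => (p.1, f p.2))^[m] (i, s) = (i, f^[m] s) := by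
        intro m
        induction m with
        | zero => intro s; rfl
        | succ m ih => intro s; exact ih _
      rw [this]
      have := h₃ i j hj
      change sz (i, _) ≤ _
      simp; omega
  exact Maps.comp this Maps.snd

end

/-! ### Folds, the list operations derived from them, and equality tests. -/

section

open TreeCode

variable {M : TM2ComputableAux Γ' Bool} {α β γ δ σ : Type} [TreeCode α] [TreeCode β] [TreeCode γ]
  [TreeCode δ] [TreeCode σ]

namespace PS

/-! ### Folds -/

/-- A loop carries the argument, the accumulator and the unread part of the list. Its accumulators
are the folds over the prefixes of the list, so only these have to be bounded. -/
theorem foldl_of_bdd {f : α → σ → β → σ} {s : α → σ} {l : α → List β}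
    (hf : PS M fun q : α × σ × β => f q.1 q.2.1 q.2.2) (hs : PS M s) (hl : PS M l) {b : α → ℕ}
    (hb : PolyBdd b fun x : α => sz x)
    (h : ∀ x l', l' <+: l x → sz (l'.foldl (f x) (s x)) ≤ b x) :
    PS M fun x => (l x).foldl (f x) (s x) := by
  let step : α × σ × List β → α × σ × List β := fun y => match y.2.2 with
    | [] => y
    | c :: t => (y.1, f y.1 y.2.1 c, t)
  have hstep : Maps M (fun y : {y : α × σ × List β // (!y.2.2.isEmpty) = true} => enc y.1)
      fun y => enc (step y.1) := by
    have h₁ : PS M fun q : α × σ × β × List β => (q.1, f q.1 q.2.1 q.2.2.1, q.2.2.2) := by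
      have := hf.comp (show PS M fun q : α × σ × β × List β => (q.1, q.2.1, q.2.2.1) by fun_prop)
      fun_prop
    have hne : ∀ y : {y : α × σ × List β // (!y.2.2.isEmpty) = true}, y.1.2.2 ≠ [] := by
      rintro ⟨⟨x, s, _ | ⟨c, t⟩⟩, hy⟩
      · simp at hy
      · simp
    -- A nonempty list and the pair of its head and its tail are the same tree, so the tuple
    -- function `h₁` acts directly on the loop state.
    refine (h₁.reindex fun y : {y : α × σ × List β // (!y.2.2.isEmpty) = true} =>
      (y.1.1, y.1.2.1, y.1.2.2.head (hne y), y.1.2.2.tail)).congr ?_ ?_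
    all_goals
      rintro ⟨⟨x, s, _ | ⟨c, t⟩⟩, hy⟩
      · simp at hy
      · rfl
  have hpath : ∀ x (l₁ : List β) s₁ L, (∀ l', l' <+: l₁ → sz (l'.foldl (f x) s₁) ≤ b x) →
      sz l₁ ≤ L → Path (fun y : α × σ × List β => if !y.2.2.isEmpty then some (step y) else none)
        (fun t => sz t ≤ 2 + sz x + b x + L) (x, s₁, l₁) (x, l₁.foldl (f x) s₁, []) := by
    intro x l₁
    induction l₁ with
    | nil =>
      intro s₁ L h₁ h₂
      have := h₁ [] List.prefix_rfl
      refine .refl ?_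
      simp at this h₂ ⊢
      omega
    | cons c t ih =>
      intro s₁ L h₁ h₂
      have h₀ := h₁ [] (List.nil_prefix)
      refine .head ?_ (by simp [step]) (ih (f x s₁ c) L (fun l' hl' =>
        h₁ (c :: l') (List.cons_prefix_cons.2 ⟨rfl, hl'⟩)) (by simp at h₂; omega))
      simp at h₀ h₂ ⊢; omega
  have := PS.loop (α := α) (c := fun y : α × σ × List β => !y.2.2.isEmpty) (by fun_prop) hstep
    (a := fun x => (x, s x, l x)) (b := fun x => (x, (l x).foldl (f x) (s x), []))
    (by fun_prop) (s := fun x => 2 + sz x + b x + sz (l x))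
    ((((PolyBdd.const 2).add .self).add hb).add hl.bdd)
    (fun x => hpath x (l x) (s x) _ (h x) le_rfl) (fun _ => rfl)
  exact (show PS M fun y : α × σ × List β => y.2.1 by fun_prop).comp this

/-- A fold is computed in polynomial space if each step adds a polynomial amount to the size. -/
theorem foldl {f : α → σ → β → σ} {s : α → σ} {l : α → List β}
    (hf : PS M fun q : α × σ × β => f q.1 q.2.1 q.2.2) (hs : PS M s) (hl : PS M l)
    {c : α × β → ℕ} (hc : PolyBdd c fun p => sz p)
    (h : ∀ x t a, sz (f x t a) ≤ sz t + c (x, a)) :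
    PS M fun x => (l x).foldl (f x) (s x) := by
  obtain ⟨k, hk⟩ := hc
  refine foldl_of_bdd hf hs hl
    (b := fun x => sz (s x) + sz (l x) * (1 + sz x + sz (l x) + 2) ^ k)
    (hs.bdd.add (hl.bdd.mul ((((((PolyBdd.const 1).add .self).add hl.bdd)).add (.const 2)).pow k)))
    fun x l' hl' => ?_
  have key : ∀ (l₁ : List β) t, (∀ a ∈ l₁, a ∈ l x) → sz (l₁.foldl (f x) t) ≤
      sz t + l₁.length * (1 + sz x + sz (l x) + 2) ^ k := by
    intro l₁
    induction l₁ with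
    | nil => intro t _; simp
    | cons a l₁ ih =>
      intro t ht
      refine (ih (f x t a) fun b hb => ht b (List.mem_cons_of_mem _ hb)).trans ?_
      have h₁ := h x t a
      have h₂ : c (x, a) ≤ (sz (x, a) + 2) ^ k := hk (x, a)
      have h₃ := sz_le_of_mem (ht a List.mem_cons_self)
      have h₄ : (sz (x, a) + 2) ^ k ≤ (1 + sz x + sz (l x) + 2) ^ k :=
        Nat.pow_le_pow_left (by simp; omega) k
      rw [List.length_cons, Nat.add_mul, Nat.one_mul]
      omega
  refine (key l' (s x) fun a ha => hl'.subset ha).trans ?_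
  have h₁ := hl'.length_le
  have h₂ := length_lt_sz (l x)
  exact Nat.add_le_add_left (Nat.mul_le_mul_right _ (by omega)) _

/-- A fold whose states have bounded size. -/
theorem foldl_const {f : α → σ → β → σ} {s : α → σ} {l : α → List β}
    (hf : PS M fun q : α × σ × β => f q.1 q.2.1 q.2.2) (hs : PS M s) (hl : PS M l)
    (c : ℕ) (h : ∀ x t a, sz (f x t a) ≤ sz t + c) :
    PS M fun x => (l x).foldl (f x) (s x) :=
  foldl hf hs hl (.const c) h

@[fun_prop]
theorem reverse {l : α → List β} (hl : PS M l) : PS M fun x => (l x).reverse := by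
  have := foldl (M := M) (f := fun (_ : α) (t : List β) a => a :: t) (s := fun _ => [])
    (by fun_prop) (by fun_prop) hl PolyBdd.self fun x t a => by simp; omega
  exact this.congr' fun x => by simp

@[fun_prop]
theorem append {l l' : α → List β} (hl : PS M l) (hl' : PS M l') :
    PS M fun x => l x ++ l' x := by
  have := foldl (M := M) (f := fun (_ : α) (t : List β) a => a :: t) (s := l')
    (by fun_prop) hl' hl.reverse PolyBdd.self fun x t a => by simp; omega
  refine this.congr' fun x => ?_
  simp

theorem flatMap {f : α → β → List γ} {l : α → List β} (hf : PS M fun q : α × β => f q.1 q.2)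
    (hl : PS M l) : PS M fun x => (l x).flatMap (f x) := by
  have h₁ := hf.comp (show PS M fun q : α × List γ × β => (q.1, q.2.2) by fun_prop)
  have := foldl (M := M) (f := fun x (t : List γ) a => t ++ f x a) (s := fun _ => [])
    (by fun_prop) (by fun_prop) hl hf.bdd fun x t a => by
      have := sz_append t (f x a)
      dsimp only
      omega
  refine this.congr' fun x => ?_
  have : ∀ (l : List β) t, l.foldl (fun t a => t ++ f x a) t = t ++ l.flatMap (f x) := by
    intro l
    induction l with
    | nil => simp
    | cons a l ih => intro t; simp [ih]
  simpa using this (l x) []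

theorem map {f : α → β → γ} {l : α → List β} (hf : PS M fun q : α × β => f q.1 q.2)
    (hl : PS M l) : PS M fun x => (l x).map (f x) := by
  refine (flatMap (f := fun x a => [f x a]) (by fun_prop) hl).congr' fun x => ?_
  induction l x <;> simp_all

theorem any {f : α → β → Bool} {l : α → List β} (hf : PS M fun q : α × β => f q.1 q.2)
    (hl : PS M l) : PS M fun x => (l x).any (f x) := by
  have h₁ := hf.comp (show PS M fun q : α × Bool × β => (q.1, q.2.2) by fun_prop)
  have := foldl_const (M := M) (f := fun x (t : Bool) a => t || f x a) (s := fun _ => false)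
    (by fun_prop) (by fun_prop) hl 0 fun x t a => by simp
  refine this.congr' fun x => ?_
  have : ∀ (l : List β) t, l.foldl (fun t a => t || f x a) t = (t || l.any (f x)) := by
    intro l
    induction l with
    | nil => simp
    | cons a l ih => intro t; simp [ih, Bool.or_assoc]
  simpa using this (l x) false

theorem all {f : α → β → Bool} {l : α → List β} (hf : PS M fun q : α × β => f q.1 q.2)
    (hl : PS M l) : PS M fun x => (l x).all (f x) := by
  refine (any (f := fun x a => !f x a) (by fun_prop) hl).not'.congr' fun x => ?_
  simp [List.all_eq_not_any_not]

theorem filter {f : α → β → Bool} {l : α → List β} (hf : PS M fun q : α × β => f q.1 q.2)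
    (hl : PS M l) : PS M fun x => (l x).filter (f x) := by
  refine (flatMap (f := fun x a => bif f x a then [a] else []) (by fun_prop) hl).congr'
    fun x => ?_
  induction l x with
  | nil => rfl
  | cons a l ih => cases h : f x a <;> simp [h, ih]

theorem dropWhile {f : α → β → Bool} {l : α → List β} (hf : PS M fun q : α × β => f q.1 q.2)
    (hl : PS M l) : PS M fun x => (l x).dropWhile (f x) := by
  have h₁ := hf.comp (show PS M fun q : α × List β × β => (q.1, q.2.2) by fun_prop)
  -- An empty accumulator means that nothing has been kept so far, so no separate flag is needed.
  have := foldl (M := M) (f := fun x (t : List β) a => bif t.isEmpty && f x a then [] else a :: t)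
    (s := fun _ => []) (by fun_prop) (by fun_prop) hl .self fun x t a => by
      cases t <;> cases f x a <;> simp <;> omega
  refine this.reverse.congr' fun x => ?_
  have h₂ : ∀ (l : List β) t, t ≠ [] →
      l.foldl (fun t a => bif t.isEmpty && f x a then [] else a :: t) t = l.reverse ++ t := by
    intro l
    induction l with
    | nil => simp
    | cons a l ih =>
      intro t ht
      have : t.isEmpty = false := by simpa using ht
      simp [this, ih]
  induction l x with
  | nil => rfl
  | cons a l ih =>
    cases h : f x a with
    | true => simpa [h] using ih
    | false => simp [h, h₂]

theorem takeWhile {f : α → β → Bool} {l : α → List β} (hf : PS M fun q : α × β => f q.1 q.2)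
    (hl : PS M l) : PS M fun x => (l x).takeWhile (f x) := by
  have h₁ := hf.comp (show PS M fun q : α × (Bool × List β) × β => (q.1, q.2.2) by fun_prop)
  have := foldl (M := M) (σ := Bool × List β)
    (f := fun x t a => bif t.1 && f x a then (true, a :: t.2) else (false, t.2))
    (s := fun _ => (true, [])) (by fun_prop) (by fun_prop) hl .self fun x t a => by
      cases t.1 <;> cases f x a <;> first | (simp; done) | (simp; omega)
  refine ((show PS M fun p : Bool × List β => p.2.reverse by fun_prop).comp this).congr'
    fun x => ?_
  have h₂ : ∀ (l t : List β),
      l.foldl (fun t a => bif t.1 && f x a then (true, a :: t.2) else (false, t.2)) (false, t) =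
        (false, t) := by
    intro l
    induction l with
    | nil => simp
    | cons a l ih => intro t; simp [ih]
  have h₃ : ∀ (l t : List β),
      (l.foldl (fun t a => bif t.1 && f x a then (true, a :: t.2) else (false, t.2))
        (true, t)).2 = (l.takeWhile (f x)).reverse ++ t := by
    intro l
    induction l with
    | nil => simp
    | cons a l ih =>
      intro t
      cases h : f x a <;> simp [h, h₂, ih]
  rw [h₃]
  simp

/-! ### Equality tests -/

theorem decide_symbol : PS M fun p : Γ' × Γ' => decide (p.1 = p.2) := by
  have h₁ : ∀ c, PS M fun p : Γ' × Γ' => decide (p.1 = c) && decide (p.2 = c) := fun c => by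
    have h₁ := (eq_symbol (M := M) c).comp (fst (α := Γ') (β := Γ'))
    have h₂ := (eq_symbol (M := M) c).comp (snd (α := Γ') (β := Γ'))
    fun_prop
  have h₂ := h₁ .blank
  have h₃ := h₁ (.bit true)
  have h₄ := h₁ (.bit false)
  have h₅ := h₁ .bra
  have h₆ := h₁ .ket
  have h₇ := h₁ .comma
  refine ((((((h₂.or' h₃).or' h₄).or' h₅).or' h₆).or' h₇)).congr' ?_
  decide

theorem decide_bool : PS M fun p : Bool × Bool => decide (p.1 = p.2) :=
  (not' (xor' fst snd)).congr' (by decide)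

theorem decide_list [DecidableEq β] (h : PS M fun p : β × β => decide (p.1 = p.2)) (b : β) :
    PS M fun p : List β × List β => decide (p.1 = p.2) := by
  have h₁ := h.comp (show PS M fun q : (List β × List β) × (Bool × List β) × β =>
    (q.2.2, q.2.1.2.headD b) by fun_prop)
  -- The fold over one list consumes the other. Emptiness is tested along with the head, so the
  -- default `b` cannot cause a false match, and a final emptiness test catches a longer second
  -- list.
  have := foldl_const (M := M) (f := fun (_ : List β × List β) (t : Bool × List β) (a : β) =>
    (t.1 && (!t.2.isEmpty && decide (a = t.2.headD b)), t.2.tail))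
    (s := fun p => (true, p.2)) (l := fun p => p.1) (by fun_prop) (by fun_prop) (by fun_prop) 0
    fun x t a => by simpa using sz_tail_le t.2
  refine ((show PS M fun p : Bool × List β => p.1 && p.2.isEmpty by fun_prop).comp this).congr' ?_
  rintro ⟨l, l'⟩
  have : ∀ (l l' : List β) (t : Bool),
      ((l.foldl (fun t a => (t.1 && (!t.2.isEmpty && decide (a = t.2.headD b)), t.2.tail))
        (t, l')).1 && (l.foldl (fun t a => (t.1 && (!t.2.isEmpty && decide (a = t.2.headD b)),
          t.2.tail)) (t, l')).2.isEmpty) = (t && decide (l = l')) := by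
    intro l
    induction l with
    | nil => intro l' t; cases l' <;> simp
    | cons a l ih =>
      intro l' t
      rw [List.foldl_cons, ih]
      cases l' with
      | nil => simp
      | cons a' l' => rw [Bool.eq_iff_iff]; simp [and_assoc]; exact fun _ _ => decide_eq_true_iff
  simpa using this l l' true

end PS

end

/-! ### Membership tests and depth-first evaluation of and-or trees. -/

section

open TreeCode

variable {M : TM2ComputableAux Γ' Bool} {α β γ δ σ : Type} [TreeCode α] [TreeCode β] [TreeCode γ]
  [TreeCode δ] [TreeCode σ]

namespace PS

theorem decide_mem [DecidableEq β] (h : PS M fun p : β × β => decide (p.1 = p.2)) :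
    PS M fun p : β × List β => decide (p.1 ∈ p.2) := by
  have h₁ := h.comp (show PS M fun q : (β × List β) × β => (q.1.1, q.2) by fun_prop)
  refine (any (f := fun (p : β × List β) b => decide (p.1 = b)) h₁ snd).congr' fun p => ?_
  rw [Bool.eq_iff_iff]
  simp

theorem decide_nodup [DecidableEq β] (h : PS M fun p : β × β => decide (p.1 = p.2)) :
    PS M fun l : List β => decide l.Nodup := by
  have h₁ := (decide_mem h).comp (show PS M fun q : List β × (List β × Bool) × β =>
    (q.2.2, q.2.1.1) by fun_prop)
  have := foldl (M := M) (f := fun (_ : List β) (t : List β × Bool) (a : β) =>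
    (a :: t.1, t.2 && !decide (a ∈ t.1))) (s := fun _ => ([], true)) (l := fun l => l)
    (by fun_prop) (by fun_prop) (by fun_prop) .self fun x t a => by simp; omega
  refine (snd.comp this).congr' fun l => ?_
  have : ∀ (l : List β) (t : List β × Bool),
      (l.foldl (fun t a => (a :: t.1, t.2 && !decide (a ∈ t.1))) t).2 =
        (t.2 && decide (l.Nodup ∧ ∀ a ∈ l, a ∉ t.1)) := by
    intro l
    induction l with
    | nil => intro t; simp
    | cons a l ih =>
      intro t
      rw [List.foldl_cons, ih]
      rw [Bool.eq_iff_iff]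
      simp only [Bool.and_eq_true, Bool.not_eq_true', decide_eq_false_iff_not, decide_eq_true_eq,
        List.nodup_cons, List.mem_cons, forall_eq_or_imp, not_or]
      constructor
      · rintro ⟨⟨h₁, h₂⟩, h₃, h₄⟩
        exact ⟨h₁, ⟨fun h => (h₄ a h).1 rfl, h₃⟩, h₂, fun b hb => (h₄ b hb).2⟩
      · rintro ⟨h₁, ⟨h₂, h₃⟩, h₄, h₅⟩
        exact ⟨⟨h₁, h₄⟩, h₃, fun b hb => ⟨fun e => h₂ (e ▸ hb), h₅ b hb⟩⟩
  simpa using this l ([], true)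

end PS

/-! ### Evaluation of and-or trees by depth-first search -/

/-- The value of a node of type "and" (`true`) or "or" (`false`) with the given children. -/
def frameVal {P : Type} (val : P → Bool) (fr : Bool × List P) : Bool :=
  bif fr.1 then fr.2.all val else fr.2.any val

section DFS

variable {P : Type} [TreeCode P]

/-- One step of the search. A state is the stack of the nodes entered, each with its type and those
of its children that are still to be evaluated; a node without children is its own value. -/
def dfsStep (kids : P → Bool × List P) (p₀ : P) (st : List (Bool × List P)) :
    List (Bool × List P) :=
  bif (st.headD (false, [])).2.isEmpty then
    bif (st.headD (false, [])).1 ^^ (st.tail.headD (false, [])).1 then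
      st.headD (false, []) :: st.tail.tail
    else st.tail
  else kids ((st.headD (false, [])).2.headD p₀) ::
    ((st.headD (false, [])).1, (st.headD (false, [])).2.tail) :: st.tail

def dfsRuns (st : List (Bool × List P)) : Bool :=
  !((st.headD (false, [])).2.isEmpty && st.tail.isEmpty)

/-- The type of a node is the neutral element of its connective, and hence its value when no
children are left. A child whose value differs from the type decides its parent, and any other child
is discarded. The induction is on the rank bound `r` and, inside, on the list of children. Above
`rest` there are at most `r + 1` frames, each of size at most `K` plus one for the list cell. -/
theorem path_dfs {kids : P → Bool × List P} {p₀ : P} {val : P → Bool} {Ok : P → Prop}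
    {rk : P → ℕ} {K B : ℕ} (hval : ∀ p, Ok p → val p = frameVal val (kids p))
    (hkids : ∀ p, Ok p → ∀ q ∈ (kids p).2, Ok q ∧ rk q < rk p)
    (hK : ∀ p, Ok p → sz (kids p) ≤ K) (hK3 : 3 ≤ K) (r : ℕ) (fr : Bool × List P)
    (rest : List (Bool × List P)) (hfr : ∀ p ∈ fr.2, Ok p ∧ rk p < r) (hsz : sz fr ≤ K)
    (hB : sz rest + (r + 1) * (K + 1) ≤ B) :
    Path (fun s => if dfsRuns s then some (dfsStep kids p₀ s) else none) (fun s => sz s ≤ B)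
      (fr :: rest) ((frameVal val fr, []) :: rest) := by
  induction r generalizing fr rest with
  | zero =>
    obtain ⟨q, _ | ⟨p, ps⟩⟩ := fr
    · have : frameVal val (q, []) = q := by cases q <;> rfl
      rw [this]
      exact .refl (by simp at hsz hB ⊢; omega)
    · exact absurd (hfr p List.mem_cons_self).2 (by omega)
  | succ r ihr =>
    obtain ⟨q, ps⟩ := fr
    have hmul : (r + 1 + 1) * (K + 1) = (r + 1) * (K + 1) + (K + 1) := by ring
    induction ps with
    | nil =>
      have : frameVal val (q, []) = q := by cases q <;> rfl
      rw [this]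
      refine .refl ?_
      simp only [sz_cons] at hsz hB ⊢
      omega
    | cons p ps ih =>
      obtain ⟨hp, hrp⟩ := hfr p List.mem_cons_self
      have hsz' : sz (q, ps) ≤ K := by simp at hsz ⊢; omega
      have h₁ := ihr (kids p) ((q, ps) :: rest)
        (fun p' hp' => ⟨(hkids p hp p' hp').1, by have := (hkids p hp p' hp').2; omega⟩)
        (hK p hp) (by rw [sz_cons]; omega)
      rw [← hval p hp] at h₁
      -- The first child is expanded above its remaining siblings and evaluated by the induction on
      -- the rank.
      have h₀ : Path (fun s => if dfsRuns s then some (dfsStep kids p₀ s) else none)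
          (fun s => sz s ≤ B) ((q, p :: ps) :: rest) ((val p, []) :: (q, ps) :: rest) := by
        refine .head ?_ ?_ h₁
        · rw [sz_cons]; omega
        · simp [dfsRuns, dfsStep]
      refine h₀.trans ?_
      by_cases hq : val p = q
      · have h₂ := ih (fun p' hp' => hfr p' (List.mem_cons_of_mem _ hp')) hsz'
        have h₃ : frameVal val (q, p :: ps) = frameVal val (q, ps) := by
          cases q <;> simp [frameVal, hq]
        rw [h₃]
        exact .head h₀.last (by simp [dfsRuns, dfsStep, hq]) h₂
      · have h₃ : frameVal val (q, p :: ps) = val p := by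
          cases q <;> simp at hq <;> simp [frameVal, hq]
        have h₄ : (val p ^^ q) = true := by
          cases h : val p <;> cases q <;> simp_all
        have h₅ : K + 1 ≤ (r + 1) * (K + 1) := Nat.le_mul_of_pos_left _ (by omega)
        rw [h₃]
        refine .head h₀.last ?_ (.refl ?_)
        · simp [dfsRuns, dfsStep, h₄]
        · simp only [sz_cons, sz_pair, sz_bool, sz_nil] at hsz' ⊢; omega

/-- `Ok x` is an invariant of the descendants of `root x` that limits their size, and `rk` limits
the depth below the root. The number of nodes is not restricted. -/
theorem PS.dfs {kids : P → Bool × List P} (hk : PS M kids) (p₀ : P) {val : P → Bool}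
    {root : α → P} (hroot : PS M root) (Ok : α → P → Prop) (rk : P → ℕ)
    (hOk : ∀ x, Ok x (root x)) (hval : ∀ x p, Ok x p → val p = frameVal val (kids p))
    (hkids : ∀ x p, Ok x p → ∀ q ∈ (kids p).2, Ok x q ∧ rk q < rk p)
    (hrk : PolyBdd (fun x => rk (root x)) fun x : α => sz x) {N : α → ℕ}
    (hN : PolyBdd N fun x : α => sz x) (hsz : ∀ x p, Ok x p → sz p ≤ N x) :
    PS M fun x => val (root x) := by
  obtain ⟨k, hk'⟩ := hk.bdd
  -- The summand `3` is the size of an evaluated frame `(b, [])`.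
  have hK : ∀ x p, Ok x p → sz (kids p) ≤ (N x + 2) ^ k + 3 := fun x p hp =>
    ((hk' p).trans (Nat.pow_le_pow_left (Nat.add_le_add_right (hsz x p hp) 2) k)).trans
      (Nat.le_add_right _ _)
  have hstep : PS M (dfsStep kids p₀) := by
    unfold dfsStep
    fun_prop
  have hruns : PS M (dfsRuns (P := P)) := by
    unfold dfsRuns
    fun_prop
  have := PS.loop (M := M) hruns (hstep.reindex Subtype.val) (a := fun x : α => [kids (root x)])
    (b := fun x => [(val (root x), [])]) (by fun_prop)
    (s := fun x => 1 + (rk (root x) + 1) * ((N x + 2) ^ k + 3 + 1))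
    ((PolyBdd.const 1).add ((hrk.add (.const 1)).mul
      ((((hN.add (.const 2)).pow k).add (.const 3)).add (.const 1))))
    (fun x => by
      rw [hval x _ (hOk x)]
      exact path_dfs (hval x) (hkids x) (hK x) (by omega) (rk (root x)) _ []
        (fun q hq => hkids x _ (hOk x) q hq) (hK x _ (hOk x)) (by simp))
    (fun x => by simp [dfsRuns])
  exact (show PS M fun s : List (Bool × List P) => (s.headD (false, [])).1 by fun_prop).comp this

end DFS

end

/-! ### Parsers, their correctness and their space. -/

section

open TreeCode

/-! ## Parsing -/

/-- The function `p` reads an element `a` encoded by `e` off the front of a string, and returns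
`f a`. -/
def Reads {α β : Type*} (p : List Γ' → β × List Γ') (e : α → List Γ') (f : α → β) : Prop :=
  ∀ a r, p (e a ++ r) = (f a, r)

/-- Unique readability: the parser recovers `f a` from the code of `a` alone. -/
theorem Reads.eq_of_eq {α β : Type*} {p : List Γ' → β × List Γ'} {e : α → List Γ'} {f : α → β}
    (h : Reads p e f) {a b : α} (hab : e a = e b) : f a = f b := by
  have h₁ := h a []
  rw [hab, h b []] at h₁
  exact (congrArg Prod.fst h₁).symm

theorem Reads.congr {α β : Type*} {p : List Γ' → β × List Γ'} {e e' : α → List Γ'} {f : α → β}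
    (h : Reads p e f) (he : ∀ a, e a = e' a) : Reads p e' f := fun a r => he a ▸ h a r

section Parsers

variable {α : Type} {β γ : Type}

def isBit : Γ' → Bool
  | .bit _ => true
  | _ => false

def parseName (s : List Γ') : Name × List Γ' :=
  ((s.takeWhile isBit).map fun a => decide (a = .bit true), (s.dropWhile isBit).tail)

theorem reads_name : Reads parseName encName fun x => x := by
  intro x r
  have h₁ : (encName x ++ r).takeWhile isBit = x.map Γ'.bit := by
    induction x with
    | nil => rfl
    | cons b x ih => exact congrArg (Γ'.bit b :: ·) ih
  have h₂ : (encName x ++ r).dropWhile isBit = Γ'.comma :: r := by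
    clear h₁
    induction x with
    | nil => rfl
    | cons b x ih => exact ih
  rw [parseName, h₁, h₂]
  simp [Function.comp_def]

def parsePair (p : List Γ' → β × List Γ') (q : List Γ' → γ × List Γ') (s : List Γ') :
    (β × γ) × List Γ' :=
  (((p s).1, (q (p s).2).1), (q (p s).2).2)

theorem Reads.pair {p : List Γ' → β × List Γ'} {q : List Γ' → γ × List Γ'} {e e' : α → List Γ'}
    {f : α → β} {g : α → γ} (hp : Reads p e f) (hq : Reads q e' g) :
    Reads (parsePair p q) (fun x => e x ++ e' x) fun x => (f x, g x) := by
  intro x r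
  simp only [parsePair, List.append_assoc, hp x, hq x]

def parseStep (p : List Γ' → β × List Γ') (t : List β × List Γ') : List β × List Γ' :=
  bif decide (t.2.headD .ket = .ket) then t else ((p t.2).1 :: t.1, (p t.2).2)

/-- Read items between brackets; the input also serves as a bound for the number of the items. -/
def parseList (p : List Γ' → β × List Γ') (s : List Γ') : List β × List Γ' :=
  let t := s.foldl (fun t _ => parseStep p t) ([], s.tail)
  (t.1.reverse, t.2.tail)

/-- At the closing bracket `parseStep` becomes idle, so any number of rounds that is at least the
number of items gives the same result. The input length is such a number: by `he` no item code
begins with the bracket, and none is empty. -/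
theorem Reads.list {p : List Γ' → β × List Γ'} {e : α → List Γ'} {f : α → β}
    (hp : Reads p e f)
    (he : ∀ a r, (e a ++ r).headD .ket ≠ .ket) :
    Reads (parseList p) (encList e) (List.map f) := by
  have key : ∀ (u : List Γ') (l : List α) (acc : List β) (r : List Γ'),
      l.length ≤ u.length → u.foldl (fun t _ => parseStep p t) (acc, l.flatMap e ++ Γ'.ket :: r) =
        ((l.map f).reverse ++ acc, Γ'.ket :: r) := by
    intro u
    induction u with
    | nil =>
      intro l acc r hl
      obtain rfl : l = [] := by simpa using hl
      rfl
    | cons x u ih =>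
      intro l acc r hl
      cases l with
      | nil => exact ih [] acc r (by simp)
      | cons a l =>
        have h₁ : parseStep p (acc, (a :: l).flatMap e ++ Γ'.ket :: r) =
            (f a :: acc, l.flatMap e ++ Γ'.ket :: r) := by
          rw [List.flatMap_cons, List.append_assoc, parseStep]
          simp only [he, hp a, decide_false, cond_false]
        rw [List.foldl_cons, h₁, ih l _ r (by simpa using hl)]
        simp
  intro l r
  have hne : ∀ a, 0 < (e a).length := fun a => by
    rw [List.length_pos_iff]
    intro h
    exact he a [] (by rw [h]; rfl)
  have hlen : ∀ l : List α, l.length ≤ (l.flatMap e).length := by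
    intro l
    induction l with
    | nil => simp
    | cons a l ih => have := hne a; simp at ih ⊢; omega
  have h₁ : encList e l ++ r = Γ'.bra :: (l.flatMap e ++ Γ'.ket :: r) := by simp [encList]
  rw [h₁, parseList, List.tail_cons, key _ l [] r (by
    have := hlen l
    simp only [List.length_cons, List.length_append]
    omega)]
  simp

end Parsers

theorem headD_encName (x : Name) (r : List Γ') : (encName x ++ r).headD .ket ≠ .ket := by
  cases x <;> simp [encName]

/-! ### Parsers and encoders in polynomial space -/

section Space

variable {M : TM2ComputableAux Γ' Bool} {α β γ : Type} [TreeCode α] [TreeCode β] [TreeCode γ]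

/-- A parser computed in polynomial space that does not lengthen the input. -/
structure IsParser (M : TM2ComputableAux Γ' Bool) (p : List Γ' → β × List Γ') : Prop where
  ps : PS M p
  length_le : ∀ s, (p s).2.length ≤ s.length

theorem sz_string (s : List Γ') : sz s = 2 * s.length + 1 := by
  rw [sz, enc_string, BTree.size_ofString]

theorem ps_isBit : PS M isBit := by
  refine ((PS.eq_symbol (.bit true)).or' (PS.eq_symbol (.bit false))).congr' ?_
  rintro (_ | ⟨_ | _⟩ | _ | _ | _) <;> rfl

theorem isParser_name : IsParser M parseName := by
  have h₁ : PS M fun s : List Γ' => s.takeWhile isBit :=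
    PS.takeWhile (f := fun _ => isBit) (ps_isBit.comp PS.snd) PS.id'
  have h₂ : PS M fun s : List Γ' => s.dropWhile isBit :=
    PS.dropWhile (f := fun _ => isBit) (ps_isBit.comp PS.snd) PS.id'
  refine ⟨PS.pair (PS.map (f := fun _ a => decide (a = Γ'.bit true))
    ((PS.eq_symbol (.bit true)).comp PS.snd) h₁) (by fun_prop), fun s => ?_⟩
  have := (List.dropWhile_sublist isBit (l := s)).length_le
  simp only [parseName, List.length_tail]
  omega

theorem IsParser.pair {p : List Γ' → β × List Γ'} {q : List Γ' → γ × List Γ'} (hp : IsParser M p)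
    (hq : IsParser M q) : IsParser M (parsePair p q) := by
  refine ⟨?_, fun s => (hq.length_le _).trans (hp.length_le s)⟩
  have := hp.ps
  have := hq.ps
  unfold parsePair
  fun_prop

/-- As the remaining input never gets longer, every round adds an item of size polynomial in the
original input. Without `length_le` the polynomial bounds of the rounds could compound. -/
theorem IsParser.list {p : List Γ' → β × List Γ'} (hp : IsParser M p) :
    IsParser M (parseList p) := by
  have hket : PS M fun t : List β × List Γ' => decide (t.2.headD Γ'.ket = Γ'.ket) :=
    (PS.eq_symbol .ket).comp (by fun_prop)
  have hstep : PS M (parseStep p) := by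
    have := hp.ps
    unfold parseStep
    fun_prop
  obtain ⟨k, hk⟩ := hp.ps.bdd
  have hlen : ∀ (f : List Γ') (t : List β × List Γ'),
      (f.foldl (fun t _ => parseStep p t) t).2.length ≤ t.2.length := by
    intro f
    induction f with
    | nil => simp
    | cons x f ih =>
      intro t
      refine (ih _).trans ?_
      change (parseStep p t).2.length ≤ _
      rw [parseStep]
      cases decide (t.2.headD .ket = .ket)
      · exact hp.length_le _
      · exact le_rfl
  have hsz : ∀ (f : List Γ') (t : List β × List Γ'),
      sz (f.foldl (fun t _ => parseStep p t) t).1 ≤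
        sz t.1 + f.length * (1 + (sz t.2 + 2) ^ k) := by
    intro f
    induction f with
    | nil => simp
    | cons x f ih =>
      intro t
      have h₁ : sz (parseStep p t).1 ≤ sz t.1 + (1 + (sz t.2 + 2) ^ k) := by
        rw [parseStep]
        cases decide (t.2.headD .ket = .ket)
        · have : sz (p t.2) ≤ (sz t.2 + 2) ^ k := hk t.2
          simp only [cond_false, sz_cons, sz_pair] at this ⊢
          omega
        · simp
      have h₂ : sz (parseStep p t).2 ≤ sz t.2 := by
        have := hlen [x] t
        simp only [List.foldl_cons, List.foldl_nil] at this
        rw [sz_string, sz_string]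
        omega
      have h₃ : f.length * (1 + (sz (parseStep p t).2 + 2) ^ k) ≤
          f.length * (1 + (sz t.2 + 2) ^ k) :=
        Nat.mul_le_mul_left _ (Nat.add_le_add_left
          (Nat.pow_le_pow_left (Nat.add_le_add_right h₂ 2) k) 1)
      have h₄ := ih (parseStep p t)
      rw [List.foldl_cons, List.length_cons, Nat.add_mul, Nat.one_mul]
      omega
  have hfold : PS M fun s : List Γ' =>
      s.foldl (fun t _ => parseStep p t) (([] : List β), s.tail) := by
    refine PS.foldl_of_bdd (f := fun _ t _ => parseStep p t) (s := fun s => ([], s.tail))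
      (l := fun s => s) (hstep.comp (by fun_prop)) (by fun_prop) (by fun_prop)
      (b := fun s => 2 + sz s * (1 + (sz s + 2) ^ k) + sz s)
      (((PolyBdd.const 2).add (PolyBdd.self.mul ((PolyBdd.const 1).add
        ((PolyBdd.self.add (.const 2)).pow k)))).add .self) fun s f hf => ?_
    have h₁ := hsz f ([], s.tail)
    have h₂ := hlen f ([], s.tail)
    have h₃ := sz_tail_le s
    have h₄ : f.length * (1 + (sz s.tail + 2) ^ k) ≤ sz s * (1 + (sz s + 2) ^ k) :=
      Nat.mul_le_mul (hf.length_le.trans (length_lt_sz s).le) (Nat.add_le_add_left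
        (Nat.pow_le_pow_left (Nat.add_le_add_right h₃ 2) k) 1)
    simp only [sz_nil] at h₁
    simp only [sz_pair]
    have h₅ := sz_string (f.foldl (fun t _ => parseStep p t) (([] : List β), s.tail)).2
    have h₆ := sz_string s.tail
    simp only at h₂
    omega
  refine ⟨?_, fun s => ?_⟩
  · exact (show PS M fun t : List β × List Γ' => (t.1.reverse, t.2.tail) by fun_prop).comp hfold
  · have := hlen s ([], s.tail)
    simp only [parseList, List.length_tail] at this ⊢
    omega

@[fun_prop]
theorem ps_encName : PS M encName := by
  have : PS M fun b : Bool => Γ'.bit b := PS.of_enc_eq fun _ => rfl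
  have := PS.map (M := M) (f := fun (_ : Name) b => Γ'.bit b) (this.comp PS.snd) PS.id'
  unfold encName
  fun_prop

theorem ps_encList {e : β → List Γ'} (he : PS M e) : PS M (encList e) := by
  have := PS.flatMap (M := M) (f := fun _ : List β => e) (he.comp PS.snd) PS.id'
  unfold encList
  fun_prop

end Space

end

/-! ### Addition and comparison of binary numbers. -/

section

open TreeCode

/-! ## Binary numbers, least significant digit first -/

def binVal : List Bool → ℕ
  | [] => 0
  | b :: l => b.toNat + 2 * binVal l

theorem binVal_append (l l' : List Bool) :
    binVal (l ++ l') = binVal l + 2 ^ l.length * binVal l' := by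
  induction l with
  | nil => simp [binVal]
  | cons b l ih => simp [binVal, ih, pow_succ]; ring

@[simp] theorem binVal_encodeNat (n : ℕ) : binVal (encodeNat n) = n := by
  have hp : ∀ p : PosNum, binVal (encodePosNum p) = (p : ℕ) := by
    intro p
    induction p with
    | one => rfl
    | bit0 p ih => simp [encodePosNum, binVal, ih, PosNum.cast_bit0]; omega
    | bit1 p ih => simp [encodePosNum, binVal, ih, PosNum.cast_bit1]; omega
  have hn : ∀ m : Num, binVal (encodeNum m) = (m : ℕ) := by
    rintro (_ | p)
    · rfl
    · exact hp p
  rw [encodeNat, hn, Num.to_of_nat]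

theorem encodeNat_injective : Function.Injective encodeNat := fun a b h => by
  rw [← binVal_encodeNat a, h, binVal_encodeNat]

/-- The canonical digit sequences are those that do not end in `false`. -/
theorem exists_encodeNat_iff (d : List Bool) :
    d.reverse.headD true = true ↔ ∃ n, encodeNat n = d := by
  have hcons : ∀ (b : Bool) (l : List Bool), l ≠ [] →
      (b :: l).reverse.headD true = l.reverse.headD true := by
    intro b l hl
    rw [List.reverse_cons]
    cases h : l.reverse with
    | nil => exact absurd (List.reverse_eq_nil_iff.1 h) hl
    | cons c t => rfl
  constructor
  · intro h
    have hpos : ∀ l : List Bool, l ≠ [] → l.reverse.headD true = true →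
        ∃ p : PosNum, encodePosNum p = l := by
      intro l
      induction l with
      | nil => intro h; exact absurd rfl h
      | cons b l ih =>
        intro _ hl
        by_cases hl' : l = []
        · subst hl'
          obtain rfl : b = true := by simpa using hl
          exact ⟨.one, rfl⟩
        · rw [hcons b l hl'] at hl
          obtain ⟨p, hp⟩ := ih hl' hl
          cases b
          · exact ⟨.bit0 p, by rw [encodePosNum, hp]⟩
          · exact ⟨.bit1 p, by rw [encodePosNum, hp]⟩
    -- The default `true` admits the empty sequence, which is the code of `0`.
    by_cases hd : d = []
    · exact ⟨0, hd ▸ rfl⟩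
    · obtain ⟨p, hp⟩ := hpos d hd h
      exact ⟨(p : ℕ), by rw [encodeNat, PosNum.of_to_nat, encodeNum, hp]⟩
  · rintro ⟨n, rfl⟩
    have hp : ∀ p : PosNum, (encodePosNum p).reverse.headD true = true := by
      intro p
      induction p with
      | one => rfl
      | bit0 p ih => rw [encodePosNum, hcons _ _ (encodePosNum_nonempty p), ih]
      | bit1 p ih => rw [encodePosNum, hcons _ _ (encodePosNum_nonempty p), ih]
    rw [encodeNat]
    cases (n : Num) with
    | zero => rfl
    | pos p => exact hp p

/-- The state holds the carry, the unread digits of the second summand, and the output with its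
latest digit first. The new carry is the majority of the two digits and the old carry. -/
def addStep (t : Bool × List Bool × List Bool) (a : Bool) : Bool × List Bool × List Bool :=
  (bif a then t.2.1.headD false || t.1 else t.2.1.headD false && t.1, t.2.1.tail,
    (a ^^ (t.2.1.headD false ^^ t.1)) :: t.2.2)

/-- Padding `xs` with as many zeros as `ys` has digits ensures that the fold exhausts `ys`. The sum
may have leading zeros; later only its value and its length matter. -/
def addLoop (xs ys : List Bool) : Bool × List Bool × List Bool :=
  (xs ++ ys.map fun _ => false).foldl addStep (false, ys, [])

def binAdd (xs ys : List Bool) : List Bool := ((addLoop xs ys).1 :: (addLoop xs ys).2.2).reverse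

theorem binVal_pad (xs ys : List Bool) :
    binVal (xs ++ ys.map fun _ => false) = binVal xs := by
  have h : ∀ l : List Bool, binVal (l.map fun _ => false) = 0 := fun l => by
    induction l with
    | nil => rfl
    | cons b l ih => rw [List.map_cons, binVal, ih]; rfl
  rw [binVal_append, h]
  simp

theorem binVal_binAdd (xs ys : List Bool) : binVal (binAdd xs ys) = binVal xs + binVal ys := by
  have key : ∀ (zs : List Bool) (c : Bool) (ys out : List Bool), ys.length ≤ zs.length →
      binVal ((zs.foldl addStep (c, ys, out)).1 ::
        (zs.foldl addStep (c, ys, out)).2.2).reverse =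
        binVal out.reverse + 2 ^ out.length * (binVal zs + binVal ys + c.toNat) := by
    intro zs
    induction zs with
    | nil =>
      intro c ys out h
      obtain rfl : ys = [] := by simpa using h
      simp [binVal_append, binVal]
    | cons a zs ih =>
      intro c ys out h
      rw [List.foldl_cons, addStep, ih _ _ _ (by simp at h ⊢; omega)]
      have hy : binVal ys = (ys.headD false).toNat + 2 * binVal ys.tail := by
        cases ys <;> simp [binVal]
      rw [hy, List.reverse_cons, binVal_append, List.length_reverse, List.length_cons, pow_succ]
      simp only [binVal]
      cases a <;> cases c <;> cases ys.headD false <;> simp <;> ring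
  have := key (xs ++ ys.map fun _ => false) false ys [] (by simp)
  rw [binVal_pad] at this
  simpa [binAdd, addLoop, binVal] using this

theorem length_binAdd (xs ys : List Bool) :
    (binAdd xs ys).length = xs.length + ys.length + 1 := by
  have key : ∀ (zs : List Bool) t, (zs.foldl addStep t).2.2.length = t.2.2.length + zs.length := by
    intro zs
    induction zs with
    | nil => simp
    | cons a zs ih => intro t; rw [List.foldl_cons, ih]; simp [addStep]; omega
  simp [binAdd, addLoop, key]

/-- Digits arrive in increasing significance, so wherever they differ the new pair overrides the
verdict reached so far. -/
def leStep (t : Bool × List Bool) (a : Bool) : Bool × List Bool :=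
  (bif a ^^ t.2.headD false then t.2.headD false else t.1, t.2.tail)

def binLe (xs ys : List Bool) : Bool :=
  ((xs ++ ys.map fun _ => false).foldl leStep (true, ys)).1

theorem binLe_eq (xs ys : List Bool) : binLe xs ys = decide (binVal xs ≤ binVal ys) := by
  have key : ∀ (zs : List Bool) (c : Bool) (ys : List Bool), ys.length ≤ zs.length →
      (zs.foldl leStep (c, ys)).1 =
        decide (binVal zs < binVal ys ∨ (binVal zs = binVal ys ∧ c = true)) := by
    intro zs
    induction zs with
    | nil =>
      intro c ys h
      obtain rfl : ys = [] := by simpa using h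
      simp [binVal]
    | cons a zs ih =>
      intro c ys h
      rw [List.foldl_cons, leStep, ih _ _ (by simp at h ⊢; omega)]
      have hy : binVal ys = (ys.headD false).toNat + 2 * binVal ys.tail := by
        cases ys <;> simp [binVal]
      refine decide_eq_decide.2 ?_
      rw [hy]
      simp only [binVal]
      generalize binVal zs = u
      generalize binVal ys.tail = w
      cases a <;> cases c <;> cases ys.headD false <;> simp <;> omega
  have := key (xs ++ ys.map fun _ => false) true ys (by simp)
  rw [binVal_pad] at this
  rw [binLe, this, Bool.eq_iff_iff]
  simp
  omega

section Space

variable {M : TM2ComputableAux Γ' Bool} {α : Type} [TreeCode α]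

theorem sz_digits (d : List Bool) : sz d = 2 * d.length + 1 := by
  induction d with
  | nil => rfl
  | cons b d ih => simp [ih]; omega

@[fun_prop]
theorem ps_binAdd {f g : α → List Bool} (hf : PS M f) (hg : PS M g) :
    PS M fun a => binAdd (f a) (g a) := by
  have h₁ : PS M fun a => (g a).map fun _ => false :=
    PS.map (f := fun _ _ => false) (by fun_prop) hg
  have h₂ : PS M fun a => addLoop (f a) (g a) := by
    refine PS.foldl_const (f := fun _ => addStep) (s := fun a => (false, g a, []))
      (l := fun a => f a ++ (g a).map fun _ => false) (by unfold addStep; fun_prop)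
      (by fun_prop) (by fun_prop) 2 fun x t a => ?_
    have := sz_tail_le t.2.1
    simp [addStep]
    omega
  unfold binAdd
  fun_prop

@[fun_prop]
theorem ps_binLe {f g : α → List Bool} (hf : PS M f) (hg : PS M g) :
    PS M fun a => binLe (f a) (g a) := by
  have h₁ : PS M fun a => (g a).map fun _ => false :=
    PS.map (f := fun _ _ => false) (by fun_prop) hg
  refine PS.fst.comp (PS.foldl_const (f := fun _ => leStep) (s := fun a => (true, g a))
    (l := fun a => f a ++ (g a).map fun _ => false) (by unfold leStep; fun_prop)
    (by fun_prop) (by fun_prop) 0 fun x t a => ?_)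
  have := sz_tail_le t.2
  simp [leStep]
  omega

end Space

end

/-! ### Settings as tuples of lists: reading, writing and validating them. -/

section

open TreeCode

/-! ## Settings as tuples of lists -/

/-- A representation of the data of an attribute by lists of digits. -/
structure Attribute.Repr (p : Attribute) where
  isGiven : Bool
  raw : p.Data → List Bool
  raw_injective : Function.Injective raw
  enc_eq : ∀ n, p.enc n = bif isGiven then encName (raw n) else []
  val_eq : ∀ n, p.val n = binVal (bif isGiven then raw n else [true])
  raw_eq_nil : isGiven = false → ∀ n, raw n = []
  exists_iff : ∀ d, (bif isGiven then d.reverse.headD true else d.isEmpty) = true ↔ ∃ n, raw n = d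

def Attribute.Repr.given : Attribute.given.Repr where
  isGiven := true
  raw := encodeNat
  raw_injective := encodeNat_injective
  enc_eq _ := rfl
  val_eq n := (binVal_encodeNat n).symm
  raw_eq_nil h := nomatch h
  exists_iff := exists_encodeNat_iff

def Attribute.Repr.absent : Attribute.absent.Repr where
  isGiven := false
  raw _ := []
  raw_injective _ _ _ := rfl
  enc_eq _ := rfl
  val_eq _ := rfl
  raw_eq_nil _ _ := rfl
  exists_iff d := by
    rw [cond_false, List.isEmpty_iff]
    exact ⟨fun h => ⟨(), h.symm⟩, fun ⟨_, h⟩ => h.symm⟩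

/-- Voter name, digits of the price, digits of the weight. -/
abbrev RawVoter : Type := Name × List Bool × List Bool

/-- Voter, ballot, bribed. -/
abbrev RawPast : Type := RawVoter × List Name × Bool

/-- Voter name, digits of the weight, ballot. -/
abbrev RawVote : Type := Name × List Bool × List Name

/-- Candidates, past voters, current voter and ballot, future voters, order of the briber,
distinguished candidate, budget. -/
abbrev RawOBS : Type :=
  List Name × List RawPast × (RawVoter × List Name) × List RawVoter × List Name × Name × List Bool

section Raw

variable {p w : Attribute} (rp : p.Repr) (rq : w.Repr) {C : Finset Name}

def rawVoter (v : Voter p w) : RawVoter := (v.name, rp.raw v.price, rq.raw v.weight)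

def rawPast (v : PastVoter p w C) : RawPast := (rawVoter rp rq v.toVoter, v.ballot.1, v.bribed)

def rawVote (v : WVote w C) : RawVote := (v.1, rq.raw v.2.1, v.2.2.1)

def rawOBS (I : OBS p w) (L : List Name) : RawOBS :=
  (L, I.past.map (rawPast rp rq), (rawVoter rp rq I.current, I.ballot.1),
    I.future.map (rawVoter rp rq), I.σ.1, I.d, encodeNat I.k)

/-! ### Reading settings -/

def parseAttr (g : Bool) (s : List Γ') : List Bool × List Γ' :=
  bif g then parseName s else ([], s)

theorem reads_attr : Reads (parseAttr rp.isGiven) p.enc rp.raw := by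
  intro n r
  rw [rp.enc_eq, parseAttr]
  cases h : rp.isGiven
  · rw [rp.raw_eq_nil h]; rfl
  · exact reads_name _ r

def parseBit (s : List Γ') : Bool × List Γ' := (decide (s.headD .blank = .bit true), s.tail)

theorem reads_bit : Reads parseBit (fun b => [Γ'.bit b]) fun b => b := by
  intro b r
  cases b <;> rfl

def parseVoter (g h : Bool) : List Γ' → RawVoter × List Γ' :=
  parsePair parseName (parsePair (parseAttr g) (parseAttr h))

def parsePast (g h : Bool) : List Γ' → RawPast × List Γ' :=
  parsePair (parseVoter g h) (parsePair (parseList parseName) parseBit)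

def parseOBS (g h : Bool) : List Γ' → RawOBS × List Γ' :=
  parsePair (parseList parseName) <| parsePair (parseList (parsePast g h)) <|
    parsePair (parsePair (parseVoter g h) (parseList parseName)) <|
    parsePair (parseList (parseVoter g h)) <| parsePair (parseList parseName) <|
    parsePair parseName parseName

theorem reads_voter :
    Reads (parseVoter rp.isGiven rq.isGiven) (encVoter (p := p) (w := w)) (rawVoter rp rq) :=
  Reads.congr (Reads.pair (fun v : Voter p w => reads_name v.name)
    (Reads.pair (fun v => reads_attr rp v.price) fun v => reads_attr rq v.weight))
    fun v => by simp [encVoter]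

theorem headD_encVoter (v : Voter p w) (r : List Γ') :
    (encVoter v ++ r).headD .ket ≠ .ket := by
  rw [encVoter, List.append_assoc, List.append_assoc]
  exact headD_encName _ _

theorem reads_names : Reads (parseList parseName) (encList encName) fun l => l := by
  intro l r
  rw [reads_name.list headD_encName l r, List.map_id']

theorem reads_past : Reads (parsePast rp.isGiven rq.isGiven)
    (encPastVoter (p := p) (w := w) (C := C)) (rawPast rp rq) :=
  Reads.congr (Reads.pair (fun v : PastVoter p w C => reads_voter rp rq v.toVoter)
    (Reads.pair (fun v => reads_names v.ballot.1) fun v => reads_bit v.bribed))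
    fun v => by simp [encPastVoter]

theorem headD_encPastVoter (v : PastVoter p w C) (r : List Γ') :
    (encPastVoter v ++ r).headD .ket ≠ .ket := by
  rw [encPastVoter, List.append_assoc, List.append_assoc]
  exact headD_encVoter _ _

theorem reads_OBS : Reads (parseOBS rp.isGiven rq.isGiven)
    (fun x : OBS p w × List Name => x.1.enc x.2) fun x => rawOBS rp rq x.1 x.2 :=
  Reads.congr (Reads.pair (fun x : OBS p w × List Name => reads_names x.2) <|
    Reads.pair (fun x => (reads_past rp rq).list headD_encPastVoter x.1.past) <|
    Reads.pair (Reads.pair (fun x => reads_voter rp rq x.1.current)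
      fun x => reads_names x.1.ballot.1) <|
    Reads.pair (fun x => (reads_voter rp rq).list headD_encVoter x.1.future) <|
    Reads.pair (fun x => reads_names x.1.σ.1) <|
    Reads.pair (fun x => reads_name x.1.d) fun x => reads_name (encodeNat x.1.k))
    fun x => by simp [OBS.enc, encNat]

/-! ### Reading the triples of the winner problem -/

theorem headD_append_encName (x : Name) (s r : List Γ') :
    (encName x ++ s ++ r).headD .ket ≠ .ket := by
  rw [List.append_assoc]
  exact headD_encName _ _

/-- Membership only provides some election with the given code. Parsing into raw votes, whose type
does not depend on the candidate set, identifies the two candidate lists, hence the candidate sets,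
and finally the votes by injectivity of `rawVote`. -/
theorem mem_winnerProblem_iff (rq : w.Repr) (E : ElectionSystem) {L : List Name}
    (V : List (WVote w C)) (c : Name) (hL : L.Nodup) (hC : L.toFinset = C) :
    (encList encName L ++
      encList (fun v => encName v.1 ++ w.enc v.2.1 ++ encList encName v.2.2.1) V ++
      encName c) ∈ winnerProblem E w ↔ c ∈ E.winners C (expand V) := by
  constructor
  · rintro ⟨C', L', V', c', hL', hC', hc', hw, h⟩
    have hvote : ∀ D : Finset Name, Reads
        (parsePair parseName (parsePair (parseAttr rq.isGiven) (parseList parseName)))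
        (fun v : WVote w D => encName v.1 ++ w.enc v.2.1 ++ encList encName v.2.2.1)
        (rawVote rq) := fun D =>
      Reads.congr (Reads.pair (fun v : WVote w D => reads_name v.1)
        (Reads.pair (fun v => reads_attr rq v.2.1) fun v => reads_names v.2.2.1))
        fun v => by simp
    have hread : Reads (parsePair (parseList parseName) (parsePair
        (parseList (parsePair parseName (parsePair (parseAttr rq.isGiven) (parseList parseName))))
        parseName))
        (fun x : (D : Finset Name) × List Name × List (WVote w D) × Name =>
          encList encName x.2.1 ++ encList (fun v => encName v.1 ++ w.enc v.2.1 ++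
            encList encName v.2.2.1) x.2.2.1 ++ encName x.2.2.2)
        (fun x => (x.2.1, x.2.2.1.map (rawVote rq), x.2.2.2)) :=
      Reads.congr (Reads.pair
        (fun x : (D : Finset Name) × List Name × List (WVote w D) × Name => reads_names x.2.1)
        (Reads.pair (fun x => (hvote x.1).list (fun v r => by
            rw [List.append_assoc]; exact headD_append_encName _ _ _) x.2.2.1)
          fun x => reads_name x.2.2.2))
        fun x => by simp
    have heq := hread.eq_of_eq (a := ⟨C, L, V, c⟩) (b := ⟨C', L', V', c'⟩) h
    simp only [Prod.mk.injEq] at heq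
    obtain ⟨rfl, hV, rfl⟩ := heq
    obtain rfl : C = C' := hC.symm.trans hC'
    have hinj : Function.Injective (rawVote rq (C := C)) := by
      rintro ⟨n, a, τ⟩ ⟨n', a', τ'⟩ hv
      simp only [rawVote, Prod.mk.injEq] at hv
      obtain ⟨rfl, ha, hτ⟩ := hv
      rw [rq.raw_injective ha, Subtype.ext hτ]
    rw [List.map_injective_iff.2 hinj hV]
    exact hw
  · intro h
    exact ⟨C, L, V, c, hL, hC, E.winners_subset _ _ h, h, rfl⟩

end Raw

/-! ### Encoding and checking raw settings -/

def encAttr (g : Bool) (d : List Bool) : List Γ' := bif g then encName d else []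

def encRawVoter (g h : Bool) (v : RawVoter) : List Γ' :=
  encName v.1 ++ encAttr g v.2.1 ++ encAttr h v.2.2

def encRawPast (g h : Bool) (v : RawPast) : List Γ' :=
  encRawVoter g h v.1 ++ encList encName v.2.1 ++ [Γ'.bit v.2.2]

def encRawOBS (g h : Bool) (r : RawOBS) : List Γ' :=
  encList encName r.1 ++ encList (encRawPast g h) r.2.1 ++
    (encRawVoter g h r.2.2.1.1 ++ encList encName r.2.2.1.2) ++
    encList (encRawVoter g h) r.2.2.2.1 ++
    encList encName r.2.2.2.2.1 ++ encName r.2.2.2.2.2.1 ++ encName r.2.2.2.2.2.2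

def encRawQuery (h : Bool) (L : List Name) (V : List RawVote) (c : Name) : List Γ' :=
  encList encName L ++ encList (fun v => encName v.1 ++ encAttr h v.2.1 ++ encList encName v.2.2) V ++
    encName c

def validDigits (g : Bool) (d : List Bool) : Bool := bif g then d.reverse.headD true else d.isEmpty

def validVoter (g h : Bool) (v : RawVoter) : Bool := validDigits g v.2.1 && validDigits h v.2.2

def isRanking (L l : List Name) : Bool :=
  decide l.Nodup && (l.all (fun c => decide (c ∈ L)) && L.all fun c => decide (c ∈ l))

def validOBS (g h : Bool) (r : RawOBS) : Bool :=
  decide r.1.Nodup && (r.2.1.all (fun v => validVoter g h v.1 && isRanking r.1 v.2.1) &&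
    (validVoter g h r.2.2.1.1 && (isRanking r.1 r.2.2.1.2 &&
    (r.2.2.2.1.all (validVoter g h) && (isRanking r.1 r.2.2.2.2.1 &&
    (decide (r.2.2.2.2.2.1 ∈ r.1) && validDigits true r.2.2.2.2.2.2))))))

section Correct

variable {p w : Attribute} (rp : p.Repr) (rq : w.Repr) {C : Finset Name}

theorem encAttr_raw (n : p.Data) : encAttr rp.isGiven (rp.raw n) = p.enc n := (rp.enc_eq n).symm

theorem encRawVoter_rawVoter (v : Voter p w) :
    encRawVoter rp.isGiven rq.isGiven (rawVoter rp rq v) = encVoter v := by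
  simp [encRawVoter, rawVoter, encVoter, encAttr_raw]

theorem encList_map {α β : Type} (e : β → List Γ') (f : α → β) (l : List α) :
    encList e (l.map f) = encList (fun a => e (f a)) l := by
  simp [encList, List.flatMap_map]

theorem encRawOBS_rawOBS (I : OBS p w) (L : List Name) :
    encRawOBS rp.isGiven rq.isGiven (rawOBS rp rq I L) = I.enc L := by
  have h : ∀ v : PastVoter p w I.C,
      encRawPast rp.isGiven rq.isGiven (rawPast rp rq v) = encPastVoter v := fun v => by
    simp [encRawPast, rawPast, encPastVoter, encRawVoter_rawVoter]
  simp only [encRawOBS, rawOBS, OBS.enc, encList_map, encRawVoter_rawVoter, h, encNat]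

theorem encRawQuery_rawVote (L : List Name) (V : List (WVote w C)) (c : Name) :
    encRawQuery rq.isGiven L (V.map (rawVote rq)) c = encList encName L ++
      encList (fun v => encName v.1 ++ w.enc v.2.1 ++ encList encName v.2.2.1) V ++ encName c := by
  simp only [encRawQuery, encList_map, rawVote, encAttr_raw]

theorem isRanking_iff {L : List Name} (hC : L.toFinset = C) (l : List Name) :
    isRanking L l = true ↔ l.Nodup ∧ l.toFinset = C := by
  subst hC
  simp only [isRanking, Bool.and_eq_true, decide_eq_true_eq, List.all_eq_true,
    Finset.ext_iff, List.mem_toFinset]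
  exact and_congr_right fun _ => ⟨fun h c => ⟨h.1 c, h.2 c⟩, fun h => ⟨fun c => (h c).1,
    fun c => (h c).2⟩⟩

theorem validVoter_iff (v : RawVoter) : validVoter rp.isGiven rq.isGiven v = true ↔
    ∃ v', rawVoter rp rq v' = v := by
  obtain ⟨n, a, b⟩ := v
  simp only [validVoter, validDigits, Bool.and_eq_true, rp.exists_iff, rq.exists_iff]
  constructor
  · rintro ⟨⟨x, rfl⟩, y, rfl⟩
    exact ⟨⟨n, x, y⟩, rfl⟩
  · rintro ⟨v', hv⟩
    simp only [rawVoter, Prod.mk.injEq] at hv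
    exact ⟨⟨_, hv.2.1⟩, _, hv.2.2⟩

theorem exists_map_eq {α β : Type} {f : α → β} {l : List β} (h : ∀ b ∈ l, ∃ a, f a = b) :
    ∃ l', List.map f l' = l := by
  have : l ∈ Set.range (List.map f) := by
    rw [Set.range_list_map]
    exact h
  exact this

theorem validOBS_iff (r : RawOBS) : validOBS rp.isGiven rq.isGiven r = true ↔
    ∃ (I : OBS p w) (L : List Name), L.Nodup ∧ L.toFinset = I.C ∧ rawOBS rp rq I L = r := by
  obtain ⟨L, past, ⟨cur, ballot⟩, fut, σ, d, k⟩ := r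
  simp only [validOBS, Bool.and_eq_true, decide_eq_true_eq, List.all_eq_true,
    validVoter_iff, isRanking_iff (C := L.toFinset) rfl,
    show ∀ d, validDigits true d = true ↔ ∃ n, encodeNat n = d from exists_encodeNat_iff]
  constructor
  · rintro ⟨hL, hpast, ⟨u, rfl⟩, hb, hfut, hσ, hd, ⟨k, rfl⟩⟩
    obtain ⟨past, rfl⟩ := exists_map_eq (f := rawPast rp rq (C := L.toFinset)) (l := past) (by
      rintro ⟨v, l, b⟩ hv
      obtain ⟨⟨v', rfl⟩, hl⟩ := hpast _ hv
      exact ⟨⟨v', ⟨l, hl⟩, b⟩, rfl⟩)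
    obtain ⟨fut, rfl⟩ := exists_map_eq (f := rawVoter rp rq) hfut
    exact ⟨⟨L.toFinset, past, u, ⟨ballot, hb⟩, fut, ⟨σ, hσ⟩, d, List.mem_toFinset.2 hd, k⟩, L, hL,
      rfl, rfl⟩
  · rintro ⟨I, L', hL, hC, h⟩
    simp only [rawOBS, Prod.mk.injEq] at h
    obtain ⟨rfl, rfl, ⟨rfl, rfl⟩, rfl, rfl, rfl, rfl⟩ := h
    rw [hC]
    refine ⟨hL, ?_, ⟨_, rfl⟩, I.ballot.2, ?_, I.σ.2, ?_, _, rfl⟩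
    · rintro v hv
      obtain ⟨v', _, rfl⟩ := List.mem_map.1 hv
      exact ⟨⟨_, rfl⟩, v'.ballot.2⟩
    · rintro v hv
      obtain ⟨v', _, rfl⟩ := List.mem_map.1 hv
      exact ⟨_, rfl⟩
    · rw [← List.mem_toFinset, hC]
      exact I.d_mem

end Correct

section Space

variable {M : TM2ComputableAux Γ' Bool} {α : Type} [TreeCode α]

theorem isParser_attr (g : Bool) : IsParser M (parseAttr g) := by
  cases g
  · exact ⟨show PS M fun s => (([] : List Bool), s) by fun_prop, fun _ => le_rfl⟩
  · exact isParser_name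

theorem isParser_bit : IsParser M parseBit := by
  refine ⟨?_, fun s => by simp [parseBit]⟩
  have := (PS.eq_symbol (M := M) (.bit true)).comp (PS.headD PS.id' Γ'.blank)
  unfold parseBit
  fun_prop

theorem isParser_voter (g h : Bool) : IsParser M (parseVoter g h) :=
  isParser_name.pair ((isParser_attr g).pair (isParser_attr h))

theorem isParser_OBS (g h : Bool) : IsParser M (parseOBS g h) :=
  isParser_name.list.pair <|
    ((isParser_voter g h).pair (isParser_name.list.pair isParser_bit)).list.pair <|
    ((isParser_voter g h).pair isParser_name.list).pair <|
    (isParser_voter g h).list.pair <| isParser_name.list.pair <| isParser_name.pair isParser_name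

@[fun_prop]
theorem ps_encAttr (g : Bool) : PS M (encAttr g) := by unfold encAttr; fun_prop

@[fun_prop]
theorem ps_encRawVoter (g h : Bool) : PS M (encRawVoter g h) := by unfold encRawVoter; fun_prop

@[fun_prop]
theorem ps_encNames : PS M (encList encName) := ps_encList ps_encName

@[fun_prop]
theorem ps_encRawOBS (g h : Bool) : PS M (encRawOBS g h) := by
  have h₁ : PS M (encRawPast g h) := by
    have : PS M fun b : Bool => Γ'.bit b := PS.of_enc_eq fun _ => rfl
    unfold encRawPast
    fun_prop
  have h₂ := ps_encList h₁
  have h₃ := ps_encList (ps_encRawVoter (M := M) g h)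
  unfold encRawOBS
  fun_prop

theorem ps_encRawQuery (h : Bool) :
    PS M fun q : List Name × List RawVote × Name => encRawQuery h q.1 q.2.1 q.2.2 := by
  have := ps_encList (M := M) (e := fun v : RawVote => encName v.1 ++ encAttr h v.2.1 ++
    encList encName v.2.2) (by fun_prop)
  unfold encRawQuery
  fun_prop

theorem decide_name : PS M fun q : Name × Name => decide (q.1 = q.2) :=
  PS.decide_list PS.decide_bool false

@[fun_prop]
theorem ps_mem_names {f : α → Name} {g : α → List Name} (hf : PS M f) (hg : PS M g) :
    PS M fun a => decide (f a ∈ g a) :=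
  ((PS.decide_mem decide_name).comp (hf.pair hg)).congr' fun _ => decide_eq_decide.2 Iff.rfl

@[fun_prop]
theorem ps_validVoter (g h : Bool) : PS M (validVoter g h) := by
  unfold validVoter validDigits
  fun_prop

@[fun_prop]
theorem ps_isRanking {f g : α → List Name} (hf : PS M f) (hg : PS M g) :
    PS M fun a => isRanking (f a) (g a) := by
  have h₁ : PS M fun a => decide (g a).Nodup :=
    ((PS.decide_nodup decide_name).comp hg).congr' fun _ => decide_eq_decide.2 Iff.rfl
  have h₂ := PS.all (M := M) (f := fun a c => decide (c ∈ f a)) (by fun_prop) hg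
  have h₃ := PS.all (M := M) (f := fun a c => decide (c ∈ g a)) (by fun_prop) hf
  unfold isRanking
  fun_prop

@[fun_prop]
theorem ps_validOBS (g h : Bool) : PS M (validOBS g h) := by
  have h₁ := PS.all (M := M) (α := RawOBS)
    (f := fun r v => validVoter g h v.1 && isRanking r.1 v.2.1)
    (l := fun r => r.2.1) (by fun_prop) (by fun_prop)
  have h₂ := PS.all (M := M) (α := RawOBS) (f := fun _ v => validVoter g h v)
    (l := fun r => r.2.2.2.1) (by fun_prop) (by fun_prop)
  have h₃ : PS M fun r : RawOBS => decide r.1.Nodup :=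
    ((PS.decide_nodup decide_name).comp (show PS M fun r : RawOBS => r.1 by fun_prop)).congr'
      fun _ => decide_eq_decide.2 Iff.rfl
  unfold validOBS
  unfold validDigits
  fun_prop

end Space

end

/-! ### The game tree, its values, and bounds for its depth and its positions. -/

section

open TreeCode

/-! ## The game tree -/

/-- A position of the game on raw data: either (if `active` is false) the vote of the first of
`voters` is about to be revealed, or the vote of `voter` is being determined, by nature (if `nature`
is true) or by the briber, candidate by candidate: `chosen` has been fixed, `rest` is left. -/
structure Pos where
  cands : List Name
  liked : List Name
  budget : List Bool
  spent : List Bool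
  voters : List RawVoter
  votes : List RawVote
  active : Bool
  nature : Bool
  voter : Name × List Bool
  chosen : List Name
  rest : List Name

/-- The digits of the cost of a bribe. -/
def bribeCost (g : Bool) (v : RawVoter) : List Bool := bif g then v.2.1 else [true]

namespace Pos

def toTuple (p : Pos) : List Name × List Name × List Bool × List Bool × List RawVoter ×
    List RawVote × Bool × Bool × (Name × List Bool) × List Name × List Name :=
  (p.cands, p.liked, p.budget, p.spent, p.voters, p.votes, p.active, p.nature, p.voter, p.chosen,
    p.rest)

instance : TreeCode Pos := ⟨fun p => enc p.toTuple⟩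

/-- Start to determine the vote of the next voter. -/
def choose (p : Pos) (nature : Bool) (spent : List Bool) : Pos :=
  ⟨p.cands, p.liked, p.budget, spent, p.voters.tail, p.votes, true, nature,
    ((p.voters.headD ([], [], [])).1, (p.voters.headD ([], [], [])).2.2), [], p.cands⟩

/-- Put `c` on the next place of the vote. -/
def pick (p : Pos) (c : Name) : Pos :=
  ⟨p.cands, p.liked, p.budget, p.spent, p.voters, p.votes, true, p.nature, p.voter,
    p.chosen ++ [c], p.rest.filter fun a => !decide (a = c)⟩

/-- Cast the vote that has been determined. -/
def cast (p : Pos) : Pos :=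
  ⟨p.cands, p.liked, p.budget, p.spent, p.voters, p.votes ++ [(p.voter.1, p.voter.2, p.chosen)],
    false, false, ([], []), [], []⟩

/-- The cost after bribing the next voter. -/
def raised (g : Bool) (p : Pos) : List Bool :=
  binAdd p.spent (bribeCost g (p.voters.headD ([], [], [])))

/-- A finished game is a childless node whose type is the outcome. The decision to bribe or not is
an "or" node made before the vote is revealed. If no candidate is left, there is one child and the
type is irrelevant. -/
def kids (g : Bool) (goal : List Name × List Name × List RawVote → Bool) (p : Pos) :
    Bool × List Pos :=
  bif p.active then
    (p.nature, bif p.rest.isEmpty then [p.cast] else p.rest.map p.pick)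
  else bif p.voters.isEmpty then (goal (p.cands, p.liked, p.votes), [])
  else (false, (bif binLe p.spent p.budget then [p.choose true p.spent] else []) ++
    bif binLe (p.raised g) p.budget then [p.choose false (p.raised g)] else [])

end Pos

/-- The list `l` is an order over the members of `L`. -/
def Orders (L l : List Name) : Prop := l.Nodup ∧ ∀ c, c ∈ l ↔ c ∈ L

theorem orders_nil {l : List Name} : Orders [] l ↔ l = [] := by
  constructor
  · rintro ⟨_, h⟩
    exact List.eq_nil_iff_forall_not_mem.2 fun c hc => List.not_mem_nil ((h c).1 hc)
  · rintro rfl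
    exact ⟨List.nodup_nil, fun _ => Iff.rfl⟩

theorem orders_cons {L l : List Name} {c : Name} : Orders L (c :: l) ↔
    c ∈ L ∧ Orders (L.filter fun a => !decide (a = c)) l := by
  simp only [Orders, List.nodup_cons, List.mem_cons, List.mem_filter, Bool.not_eq_true',
    decide_eq_false_iff_not]
  constructor
  · rintro ⟨⟨h₁, h₂⟩, h₃⟩
    exact ⟨(h₃ c).1 (.inl rfl), h₂, fun a => ⟨fun ha => ⟨(h₃ a).1 (.inr ha), fun e => h₁ (e ▸ ha)⟩,
      fun ha => ((h₃ a).2 ha.1).resolve_left ha.2⟩⟩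
  · rintro ⟨h₁, h₂, h₃⟩
    refine ⟨⟨fun h => ((h₃ c).1 h).2 rfl, h₂⟩, fun a => ⟨?_, fun ha => ?_⟩⟩
    · rintro (rfl | ha)
      exacts [h₁, ((h₃ a).1 ha).1]
    · exact or_iff_not_imp_left.2 fun hne => (h₃ a).2 ⟨ha, hne⟩

/-- A quantifier over all orders is split into one over the top candidate and one over the orders of
the others, which keeps the branching of the game tree linear. -/
theorem forall_orders {L : List Name} (hL : L ≠ []) {Q : List Name → Prop} :
    (∀ l, Orders L l → Q l) ↔
      ∀ c ∈ L, ∀ l, Orders (L.filter fun a => !decide (a = c)) l → Q (c :: l) := by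
  constructor
  · exact fun h c hc l hl => h _ (orders_cons.2 ⟨hc, hl⟩)
  · rintro h (_ | ⟨c, l⟩) hl
    · exact absurd (List.eq_nil_iff_forall_not_mem.2 fun c hc =>
        List.not_mem_nil ((hl.2 c).2 hc)) hL
    · exact h c (orders_cons.1 hl).1 l (orders_cons.1 hl).2

theorem exists_orders {L : List Name} (hL : L ≠ []) {Q : List Name → Prop} :
    (∃ l, Orders L l ∧ Q l) ↔
      ∃ c ∈ L, ∃ l, Orders (L.filter fun a => !decide (a = c)) l ∧ Q (c :: l) := by
  have := (forall_orders hL (Q := fun l => ¬ Q l)).not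
  push Not at this
  exact this

/-- The briber can ensure `goal`: a form of `CanEnsure` on raw data. -/
def Ensures (g : Bool) (goal : List RawVote → Bool) (L : List Name) (k : List Bool) :
    List RawVoter → List Bool → List RawVote → Prop
  | [], _, U => goal U = true
  | v :: vs, s, U =>
    (binVal s ≤ binVal k ∧
      ∀ l, Orders L l → Ensures g goal L k vs s (U ++ [(v.1, v.2.2, l)])) ∨
    (binVal (binAdd s (bribeCost g v)) ≤ binVal k ∧
      ∃ l, Orders L l ∧ Ensures g goal L k vs (binAdd s (bribeCost g v)) (U ++ [(v.1, v.2.2, l)]))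

namespace Pos

section Value

variable (g : Bool) (goal : List Name × List Name × List RawVote → Bool)

/-- The briber wins after the vote `l` has been cast by the voter whose vote is being determined. -/
def After (p : Pos) (l : List Name) : Prop :=
  Ensures g (fun U => goal (p.cands, p.liked, U)) p.cands p.budget p.voters p.spent
    (p.votes ++ [(p.voter.1, p.voter.2, l)])

/-- The briber wins from the position. -/
def Wins (p : Pos) : Prop :=
  if p.active then
    if p.nature then ∀ l, Orders p.rest l → After g goal p (p.chosen ++ l)
    else ∃ l, Orders p.rest l ∧ After g goal p (p.chosen ++ l)
  else Ensures g (fun U => goal (p.cands, p.liked, U)) p.cands p.budget p.voters p.spent p.votes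

-- `Wins` quantifies over whole votes and continuations; this is the local recursion that the
-- depth-first search needs.
open Classical in
theorem decide_wins (p : Pos) :
    decide (p.Wins g goal) = frameVal (fun q => decide (q.Wins g goal)) (p.kids g goal) := by
  obtain ⟨L, D, k, s, vs, U, active, nature, v, l, rest⟩ := p
  rw [Bool.eq_iff_iff]
  cases active
  · cases vs with
    | nil => cases h : goal (L, D, U) <;> simp [Wins, Ensures, kids, frameVal, h]
    | cons w vs =>
      simp only [Wins, Ensures, kids, frameVal, raised, binLe_eq, choose, List.headD_cons,
        List.tail_cons, After]
      by_cases h₁ : binVal s ≤ binVal k <;>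
        by_cases h₂ : binVal (binAdd s (bribeCost g w)) ≤ binVal k <;> simp [h₁, h₂]
  · by_cases hr : rest = []
    · cases nature <;> simp [Wins, kids, frameVal, After, cast, orders_nil, hr]
    · have hr' : rest.isEmpty = false := by simpa using hr
      cases nature
      · simp [Wins, kids, frameVal, After, pick, exists_orders hr, hr']
      · simp [Wins, kids, frameVal, After, pick, forall_orders hr, hr']

end Value

/-! ### Evaluation in polynomial space -/

/-- A bound on the variable part of a position that never increases along the tree. Each waiting
voter holds a reserve for a later ballot and a raised cost, and the `8` of an active position pays
for the constructors when the vote is cast. -/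
def potential (p : Pos) : ℕ :=
  sz p.spent + sz p.votes + 4 * sz p.cands * sz p.voters + sz p.voter + sz p.chosen + sz p.rest +
    bif p.active then 8 else 0

theorem sz_eq (p : Pos) : sz p = 12 + sz p.cands + sz p.liked + sz p.budget + sz p.spent +
    sz p.voters + sz p.votes + sz p.voter + sz p.chosen + sz p.rest := by
  change sz p.toTuple = _
  simp only [toTuple, sz_pair, sz_bool]
  omega

/-- Removing a candidate from `rest` frees at least the room that it takes up in `chosen`. -/
theorem sz_filter_add_le {c : Name} {l : List Name} (h : c ∈ l) :
    sz (l.filter fun a => !decide (a = c)) + 1 + sz c ≤ sz l := by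
  have hle : ∀ l : List Name, sz (l.filter fun a => !decide (a = c)) ≤ sz l := by
    intro l
    induction l with
    | nil => simp
    | cons a l ih => rw [List.filter_cons]; split <;> simp only [sz_cons] <;> omega
  induction l with
  | nil => simp at h
  | cons a l ih =>
    rw [List.filter_cons]
    by_cases hac : a = c
    · have := hle l
      subst hac
      simp only [decide_true, Bool.not_true, Bool.false_eq_true, if_false, sz_cons]
      omega
    · have := ih ((List.mem_cons.1 h).resolve_left (Ne.symm hac))
      simp only [hac, decide_false, Bool.not_false, if_true, sz_cons]
      omega

/-- Taking `v` from the queue releases `4 * sz p.cands * (1 + sz v)`. This covers the new list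
`rest`, the copied name and weight, the growth of `spent`, and the `8`. -/
theorem potential_choose_le {p : Pos} {v : RawVoter} {vs : List RawVoter} (hp : p.voters = v :: vs)
    (nature : Bool) {s : List Bool} (hs : sz s ≤ sz p.spent + 2 * sz v.2.1 + 2) :
    (p.choose nature s).potential ≤ p.potential := by
  have h₁ : 4 * sz p.cands * (1 + sz v + sz vs) =
      4 * sz p.cands + 4 * (sz p.cands * sz v) + 4 * sz p.cands * sz vs := by ring
  have h₂ : sz v ≤ sz p.cands * sz v := Nat.le_mul_of_pos_left _ (sz_pos _)
  have h₃ := sz_pos p.cands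
  have h₄ := sz_pos v.1
  have h₅ := sz_pos v.2.2
  have h₆ : sz v = 1 + sz v.1 + (1 + sz v.2.1 + sz v.2.2) := rfl
  have h₇ : sz (v.1, v.2.2) = 1 + sz v.1 + sz v.2.2 := rfl
  have h₈ := sz_pos p.voter
  simp only [potential, choose, hp, List.headD_cons, List.tail_cons, sz_cons, sz_nil, h₁, cond_true]
  omega

theorem potential_kids_le (g : Bool) (goal : List Name × List Name × List RawVote → Bool) (p : Pos) :
    ∀ q ∈ (p.kids g goal).2, (q.cands = p.cands ∧ q.liked = p.liked ∧ q.budget = p.budget) ∧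
      q.potential ≤ p.potential := by
  intro q hq
  rw [kids] at hq
  cases hact : p.active
  · cases hv : p.voters with
    | nil => simp [hact, hv] at hq
    | cons v vs =>
      simp only [hact, hv, List.isEmpty_cons, cond_false, List.mem_append] at hq
      obtain hq | hq := hq
      · cases h : binLe p.spent p.budget
        · simp [h] at hq
        · obtain rfl : q = _ := by simpa [h] using hq
          exact ⟨⟨rfl, rfl, rfl⟩, potential_choose_le hv _ (by omega)⟩
      · cases h : binLe (p.raised g) p.budget
        · simp [h] at hq
        · obtain rfl : q = _ := by simpa [h] using hq
          refine ⟨⟨rfl, rfl, rfl⟩, potential_choose_le hv _ ?_⟩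
          have : (bribeCost g v).length ≤ sz v.2.1 := by
            cases g
            · exact sz_pos _
            · rw [sz_digits]; simp only [bribeCost, cond_true]; omega
          rw [raised, hv, List.headD_cons, sz_digits, length_binAdd, sz_digits]
          omega
  · simp only [hact, cond_true] at hq
    cases hr : p.rest.isEmpty
    · simp only [hr, cond_false, List.mem_map] at hq
      obtain ⟨c, hc, rfl⟩ := hq
      refine ⟨⟨rfl, rfl, rfl⟩, ?_⟩
      have h₁ := sz_filter_add_le hc
      have h₂ := sz_append p.chosen [c]
      simp only [potential, pick, hact, cond_true, sz_cons, sz_nil] at h₂ ⊢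
      omega
    · obtain rfl : q = _ := by simpa [hr] using hq
      refine ⟨⟨rfl, rfl, rfl⟩, ?_⟩
      have h₁ := sz_append p.votes [(p.voter.1, p.voter.2, p.chosen)]
      have h₂ := sz_pair p.voter
      simp only [potential, cast, hact, cond_true, cond_false, sz_cons, sz_nil, sz_pair] at h₁ h₂ ⊢
      omega

/-- An upper bound for the number of moves left: each voter takes one `choose`, at most one `pick`
per candidate, and one `cast`. -/
def rank (p : Pos) : ℕ :=
  p.voters.length * (p.cands.length + 2) + bif p.active then p.rest.length + 1 else 0

theorem rank_kids_lt (g : Bool) (goal : List Name × List Name × List RawVote → Bool) (p : Pos) :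
    ∀ q ∈ (p.kids g goal).2, q.rank < p.rank := by
  intro q hq
  rw [kids] at hq
  cases hact : p.active
  · cases hv : p.voters with
    | nil => simp [hact, hv] at hq
    | cons v vs =>
      have : ∃ n s, q = p.choose n s := by
        simp only [hact, hv, List.isEmpty_cons, cond_false, List.mem_append] at hq
        obtain hq | hq := hq
        · cases h : binLe p.spent p.budget
          · simp [h] at hq
          · exact ⟨_, _, by simpa [h] using hq⟩
        · cases h : binLe (p.raised g) p.budget
          · simp [h] at hq
          · exact ⟨_, _, by simpa [h] using hq⟩
      obtain ⟨n, s, rfl⟩ := this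
      simp only [rank, choose, hv, hact, List.tail_cons, List.length_cons, cond_true, cond_false,
        Nat.add_mul]
      omega
  · simp only [hact, cond_true] at hq
    cases hr : p.rest.isEmpty
    · simp only [hr, cond_false, List.mem_map] at hq
      obtain ⟨c, hc, rfl⟩ := hq
      have : (p.rest.filter fun a => !decide (a = c)).length < p.rest.length :=
        List.length_filter_lt_length_iff_exists.2 ⟨c, hc, by simp⟩
      simp only [rank, pick, hact, cond_true]
      omega
    · obtain rfl : q = _ := by simpa [hr] using hq
      simp only [rank, cast, hact, cond_true, cond_false]
      omega

section Space

variable {M : TM2ComputableAux Γ' Bool} {α : Type} [TreeCode α]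

theorem ps_toTuple : PS M toTuple := PS.of_enc_eq fun _ => rfl

@[fun_prop] theorem ps_cands : PS M cands :=
  (show PS M fun t : List Name × _ => t.1 by fun_prop).comp ps_toTuple

@[fun_prop] theorem ps_liked : PS M liked := (PS.fst.comp PS.snd).comp ps_toTuple

@[fun_prop] theorem ps_budget : PS M budget := (PS.fst.comp (PS.snd.comp PS.snd)).comp ps_toTuple

@[fun_prop] theorem ps_spent : PS M spent :=
  (PS.fst.comp (PS.snd.comp (PS.snd.comp PS.snd))).comp ps_toTuple

@[fun_prop] theorem ps_voters : PS M voters :=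
  (PS.fst.comp (PS.snd.comp (PS.snd.comp (PS.snd.comp PS.snd)))).comp ps_toTuple

@[fun_prop] theorem ps_votes : PS M votes :=
  (PS.fst.comp (PS.snd.comp (PS.snd.comp (PS.snd.comp (PS.snd.comp PS.snd))))).comp ps_toTuple

theorem ps_last : PS M fun p : Pos =>
    (p.active, p.nature, p.voter, p.chosen, p.rest) :=
  (PS.snd.comp (PS.snd.comp (PS.snd.comp (PS.snd.comp (PS.snd.comp PS.snd))))).comp ps_toTuple

@[fun_prop] theorem ps_active : PS M active := PS.fst.comp ps_last

@[fun_prop] theorem ps_nature : PS M nature := (PS.fst.comp PS.snd).comp ps_last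

@[fun_prop] theorem ps_voter : PS M voter := (PS.fst.comp (PS.snd.comp PS.snd)).comp ps_last

@[fun_prop] theorem ps_chosen : PS M chosen :=
  (PS.fst.comp (PS.snd.comp (PS.snd.comp PS.snd))).comp ps_last

@[fun_prop] theorem ps_rest : PS M rest :=
  (PS.snd.comp (PS.snd.comp (PS.snd.comp PS.snd))).comp ps_last

@[fun_prop] theorem ps_mk {f₁ f₂ : α → List Name} {f₃ f₄ : α → List Bool} {f₅ : α → List RawVoter}
    {f₆ : α → List RawVote} {f₇ f₈ : α → Bool} {f₉ : α → Name × List Bool}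
    {f₁₀ f₁₁ : α → List Name} (h₁ : PS M f₁) (h₂ : PS M f₂) (h₃ : PS M f₃) (h₄ : PS M f₄)
    (h₅ : PS M f₅) (h₆ : PS M f₆) (h₇ : PS M f₇) (h₈ : PS M f₈) (h₉ : PS M f₉) (h₁₀ : PS M f₁₀)
    (h₁₁ : PS M f₁₁) : PS M fun a =>
      Pos.mk (f₁ a) (f₂ a) (f₃ a) (f₄ a) (f₅ a) (f₆ a) (f₇ a) (f₈ a) (f₉ a) (f₁₀ a) (f₁₁ a) :=
  h₁.pair (h₂.pair (h₃.pair (h₄.pair (h₅.pair (h₆.pair (h₇.pair (h₈.pair (h₉.pair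
    (h₁₀.pair h₁₁)))))))))

theorem ps_kids (g : Bool) {goal : List Name × List Name × List RawVote → Bool} (hg : PS M goal) :
    PS M (kids g goal) := by
  have h₁ : PS M fun q : Pos × Name => q.1.rest.filter fun a => !decide (a = q.2) :=
    PS.filter (f := fun (q : Pos × Name) a => !decide (a = q.2))
      ((decide_name.comp (show PS M fun q : (Pos × Name) × Name => (q.2, q.1.2) by fun_prop)).not')
      (by fun_prop)
  have h₂ : PS M fun p : Pos => p.rest.map p.pick :=
    PS.map (f := fun (p : Pos) c => p.pick c) (by unfold pick; fun_prop) (by fun_prop)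
  have h₃ : PS M (raised g) := by
    unfold raised bribeCost
    fun_prop
  unfold kids choose cast
  fun_prop

-- Descendants share the candidates, the liked list and the budget, and their potential is at most
-- that of the root. The potential of the root is quadratic in its size because of the product of
-- candidates and voters, whence `N`.
open Classical in
theorem ps_wins (g : Bool) {goal : List Name × List Name × List RawVote → Bool} (hg : PS M goal) :
    PS M fun p : Pos => decide (p.Wins g goal) := by
  refine PS.dfs (ps_kids g hg) ⟨[], [], [], [], [], [], false, false, ([], []), [], []⟩
    (val := fun p => decide (p.Wins g goal)) PS.id'
    (fun x p => (p.cands = x.cands ∧ p.liked = x.liked ∧ p.budget = x.budget) ∧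
      p.potential ≤ x.potential) rank (fun x => ⟨⟨rfl, rfl, rfl⟩, le_rfl⟩)
    (fun _ p _ => decide_wins g goal p) (fun x p hp q hq => ?_) ?_
    (N := fun x => 30 + 4 * sz x + 4 * sz x * sz x)
    (((PolyBdd.const 30).add ((PolyBdd.const 4).mul .self)).add
      (((PolyBdd.const 4).mul .self).mul .self)) fun x p hp => ?_
  · obtain ⟨⟨h₁, h₂, h₃⟩, h₄⟩ := potential_kids_le g goal p q hq
    exact ⟨⟨⟨h₁.trans hp.1.1, h₂.trans hp.1.2.1, h₃.trans hp.1.2.2⟩, h₄.trans hp.2⟩,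
      rank_kids_lt g goal p q hq⟩
  · refine ((PolyBdd.self.mul (.add .self (.const 2))).add .self).mono fun x => ?_
    have h₀ := sz_eq x
    have h₁ := length_lt_sz x.voters
    have h₂ := length_lt_sz x.cands
    have h₃ := length_lt_sz x.rest
    have h₄ : x.voters.length * (x.cands.length + 2) ≤ sz x * (sz x + 2) :=
      Nat.mul_le_mul (by omega) (by omega)
    have h₅ : (bif x.active then x.rest.length + 1 else 0) ≤ sz x := by
      cases x.active
      · exact Nat.zero_le _
      · simp only [cond_true]; omega
    exact Nat.add_le_add h₄ h₅
  · obtain ⟨⟨h₁, h₂, h₃⟩, h₄⟩ := hp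
    have h₀ := sz_eq x
    have h₅ : sz p.voters ≤ 4 * sz x.cands * sz p.voters :=
      Nat.le_mul_of_pos_left _ (by have := sz_pos x.cands; omega)
    have h₆ : 4 * sz x.cands * sz x.voters ≤ 4 * sz x * sz x :=
      Nat.mul_le_mul (by omega) (by omega)
    have h₇ : (bif x.active then 8 else 0) ≤ 8 := by cases x.active <;> simp
    rw [sz_eq p, h₁, h₂, h₃]
    simp only [potential, h₁] at h₄
    omega

end Space

end Pos

end

/-! ### Solving settings, and the membership in PSPACE. -/

section

open TreeCode

/-! ## Solving bribery settings -/

theorem mem_takeWhile_iff_idxOf_lt (d c : Name) (l : List Name) :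
    c ∈ l.takeWhile (fun a => !decide (a = d)) ↔ l.idxOf c < l.idxOf d := by
  induction l with
  | nil => simp
  | cons a l ih =>
    by_cases had : a = d
    · subst had
      simp
    · by_cases hac : a = c
      · subst hac
        simp [had, List.idxOf_cons_ne _ had]
      · simp [had, Ne.symm hac, List.idxOf_cons_ne _ had, List.idxOf_cons_ne _ hac, ih]

theorem mem_dropWhile_iff_idxOf_le (d : Name) {c : Name} {l : List Name} (hl : l.Nodup)
    (hc : c ∈ l) :
    c ∈ l.dropWhile (fun a => !decide (a = d)) ↔ l.idxOf d ≤ l.idxOf c := by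
  induction l with
  | nil => simp at hc
  | cons a l ih =>
    obtain ⟨h₁, h₂⟩ := List.nodup_cons.1 hl
    by_cases had : a = d
    · subst had
      simpa using hc
    · by_cases hac : a = c
      · subst hac
        have : a ∉ l.dropWhile (fun a => !decide (a = d)) :=
          fun h => h₁ ((List.dropWhile_sublist _).subset h)
        simp [had, List.idxOf_cons_ne _ had, this]
      · simp [had, List.idxOf_cons_ne _ had, List.idxOf_cons_ne _ hac,
          ih h₂ ((List.mem_cons.1 hc).resolve_left (Ne.symm hac))]

/-- The candidates that the briber likes at least as much as `d`. -/
def likedFrom (r : RawOBS) : List Name :=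
  r.2.2.2.2.1.takeWhile (fun a => !decide (a = r.2.2.2.2.2.1)) ++ [r.2.2.2.2.2.1]

/-- The candidates that the briber likes at most as much as `d`. -/
def dislikedFrom (r : RawOBS) : List Name :=
  r.2.2.2.2.1.dropWhile fun a => !decide (a = r.2.2.2.2.2.1)

def rawSpent (g : Bool) (past : List RawPast) : List Bool :=
  past.foldl (fun s v => bif v.2.2 then binAdd s (bribeCost g v.1) else s) []

def rawCast (past : List RawPast) : List RawVote :=
  past.map fun v => (v.1.1, v.1.2.2, v.2.1)

/-- The position in which the current voter has cast the ballot. -/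
def unbribedPos (g : Bool) (D : RawOBS → List Name) (r : RawOBS) : Pos :=
  ⟨r.1, D r, r.2.2.2.2.2.2, rawSpent g r.2.1, r.2.2.2.1,
    rawCast r.2.1 ++ [(r.2.2.1.1.1, r.2.2.1.1.2.2, r.2.2.1.2)], false, false, ([], []), [], []⟩

/-- The position in which the current voter has been bribed. -/
def bribedPos (g : Bool) (D : RawOBS → List Name) (r : RawOBS) : Pos :=
  ⟨r.1, D r, r.2.2.2.2.2.2, binAdd (rawSpent g r.2.1) (bribeCost g r.2.2.1.1), r.2.2.2.1,
    rawCast r.2.1, true, false, (r.2.2.1.1.1, r.2.2.1.1.2.2), [], r.1⟩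

open Classical in
/-- Some candidate in the second list wins (or, if `neg` is true, none of them does). -/
noncomputable def rawGoal (W : Language Γ') (h neg : Bool)
    (q : List Name × List Name × List RawVote) : Bool :=
  neg ^^ q.2.1.any fun c => decide (encRawQuery h q.1 q.2.2 c ∈ W)

-- The ballot of the current voter is already known, so leaving it gives a single position without a
-- move of nature. A bribe starts with the briber composing a vote.
open Classical in
noncomputable def solve (W : Language Γ') (g h neg : Bool) (D : RawOBS → List Name)
    (r : RawOBS) : Bool :=
  (binLe (unbribedPos g D r).spent r.2.2.2.2.2.2 &&
    decide ((unbribedPos g D r).Wins g (rawGoal W h neg))) ||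
  (binLe (bribedPos g D r).spent r.2.2.2.2.2.2 &&
    decide ((bribedPos g D r).Wins g (rawGoal W h neg)))

section Correct

variable {p w : Attribute} (rp : p.Repr) (rq : w.Repr) {C : Finset Name}

theorem binVal_bribeCost (v : Voter p w) :
    binVal (bribeCost rp.isGiven (rawVoter rp rq v)) = p.val v.price := (rp.val_eq _).symm

theorem binVal_rawSpent (I : OBS p w) :
    binVal (rawSpent rp.isGiven (I.past.map (rawPast rp rq))) = I.spent := by
  have key : ∀ (l : List (PastVoter p w I.C)) (s : List Bool),
      binVal ((l.map (rawPast rp rq)).foldl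
        (fun s v => bif v.2.2 then binAdd s (bribeCost rp.isGiven v.1) else s) s) =
        binVal s + (l.map fun v => if v.bribed then p.val v.price else 0).sum := by
    intro l
    induction l with
    | nil => simp
    | cons v l ih =>
      intro s
      rw [List.map_cons, List.foldl_cons, ih]
      cases h : v.bribed
      · simp [rawPast, h]
      · simp [rawPast, h, binVal_binAdd, binVal_bribeCost, add_assoc]
  exact (key I.past []).trans (by simp [binVal, OBS.spent])

theorem rawCast_map (I : OBS p w) :
    rawCast (I.past.map (rawPast rp rq)) = I.castVotes.map (rawVote rq) := by
  simp [rawCast, OBS.castVotes, rawPast, rawVoter, rawVote, Voter.cast]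

theorem orders_iff {L l : List Name} (hC : L.toFinset = C) :
    Orders L l ↔ l.Nodup ∧ l.toFinset = C := by
  subst hC
  simp [Orders, Finset.ext_iff]

theorem map_append_cast (U : List (WVote w C)) (v : Voter p w) (τ : Ranking C) :
    U.map (rawVote rq) ++ [((rawVoter rp rq v).1, (rawVoter rp rq v).2.2, τ.1)] =
      (U ++ [v.cast τ]).map (rawVote rq) := by
  simp [rawVote, rawVoter, Voter.cast]

/-- The success of a bribe does not depend on the revealed vote. The universal quantifier over that
vote can therefore be confined to the alternative without a bribe, which is the form of `Ensures`.
-/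
theorem ensures_iff {L : List Name} (hC : L.toFinset = C) (k : ℕ) {goal' : List RawVote → Bool}
    {goal : Multiset (Vote C) → Prop}
    (hg : ∀ U, goal' (U.map (rawVote rq)) = true ↔ goal (expand U)) (vs : List (Voter p w)) :
    ∀ s U, Ensures rp.isGiven goal' L (encodeNat k) (vs.map (rawVoter rp rq)) s
      (U.map (rawVote rq)) ↔ CanEnsure k goal vs (binVal s) U := by
  induction vs with
  | nil => exact fun s U => hg U
  | cons v vs ih =>
    intro s U
    have h : ∀ s (τ : Ranking C), Ensures rp.isGiven goal' L (encodeNat k)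
        (vs.map (rawVoter rp rq)) s
        (U.map (rawVote rq) ++ [((rawVoter rp rq v).1, (rawVoter rp rq v).2.2, τ.1)]) ↔
        CanEnsure k goal vs (binVal s) (U ++ [v.cast τ]) := fun s τ => by
      rw [map_append_cast, ih]
    -- Some order exists, so the budget condition, in which the revealed vote does not occur, can be
    -- pulled out of the quantifier.
    have : Nonempty (Ranking C) := ⟨⟨C.toList, C.nodup_toList, C.toList_toFinset⟩⟩
    simp only [CanEnsure, HasGoodChoice, List.map_cons, Ensures, binVal_encodeNat,
      forall_or_right, forall_and, forall_const, binVal_binAdd, binVal_bribeCost]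
    refine or_congr (and_congr_right fun _ => ⟨fun H τ => ?_, fun H l hl => ?_⟩)
      (and_congr_right fun _ => ⟨?_, ?_⟩)
    · exact (h s τ).1 (H τ.1 ((orders_iff hC).2 τ.2))
    · exact (h s ⟨l, (orders_iff hC).1 hl⟩).2 (H _)
    · rintro ⟨l, hl, H⟩
      refine ⟨⟨l, (orders_iff hC).1 hl⟩, ?_⟩
      have := (h _ ⟨l, (orders_iff hC).1 hl⟩).1 H
      rwa [binVal_binAdd, binVal_bribeCost] at this
    · rintro ⟨τ, H⟩
      refine ⟨τ.1, (orders_iff hC).2 τ.2, (h _ τ).2 ?_⟩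
      rwa [binVal_binAdd, binVal_bribeCost]

theorem rawGoal_iff (E : ElectionSystem) {L : List Name} (hL : L.Nodup) (hC : L.toFinset = C)
    (neg : Bool) (D : List Name) (U : List (WVote w C)) :
    rawGoal (winnerProblem E w) rq.isGiven neg (L, D, U.map (rawVote rq)) = true ↔
      bif neg then ∀ c ∈ D, c ∉ E.winners C (expand U) else ∃ c ∈ D, c ∈ E.winners C (expand U) := by
  simp only [rawGoal, encRawQuery_rawVote, mem_winnerProblem_iff rq E U _ hL hC]
  cases neg <;> simp

theorem solve_iff (E : ElectionSystem) (neg : Bool) (D : RawOBS → List Name) (I : OBS p w)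
    {L : List Name} (hL : L.Nodup) (hC : L.toFinset = I.C) {goal : Multiset (Vote I.C) → Prop}
    (hD : ∀ U, goal U ↔
      bif neg then ∀ c ∈ D (rawOBS rp rq I L), c ∉ E.winners I.C U
      else ∃ c ∈ D (rawOBS rp rq I L), c ∈ E.winners I.C U) :
    solve (winnerProblem E w) rp.isGiven rq.isGiven neg D (rawOBS rp rq I L) = true ↔
      I.Succeeds goal := by
  have h : ∀ s U, Ensures rp.isGiven
      (fun V => rawGoal (winnerProblem E w) rq.isGiven neg (L, D (rawOBS rp rq I L), V)) L
      (encodeNat I.k) (I.future.map (rawVoter rp rq)) s (U.map (rawVote rq)) ↔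
      CanEnsure I.k goal I.future (binVal s) U :=
    ensures_iff rp rq hC I.k (fun U => (rawGoal_iff rq E hL hC neg _ U).trans (hD _).symm) I.future
  have h' : ∀ s (τ : Ranking I.C), Ensures rp.isGiven
      (fun V => rawGoal (winnerProblem E w) rq.isGiven neg (L, D (rawOBS rp rq I L), V)) L
      (encodeNat I.k) (I.future.map (rawVoter rp rq)) s
      (I.castVotes.map (rawVote rq) ++
        [((rawVoter rp rq I.current).1, (rawVoter rp rq I.current).2.2, τ.1)]) ↔
      CanEnsure I.k goal I.future (binVal s) (I.castVotes ++ [I.current.cast τ]) := fun s τ => by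
    rw [map_append_cast, h]
  have hs := binVal_rawSpent rp rq I
  have hs' : binVal (binAdd (rawSpent rp.isGiven (I.past.map (rawPast rp rq)))
      (bribeCost rp.isGiven (rawVoter rp rq I.current))) =
      I.spent + p.val I.current.price := by rw [binVal_binAdd, hs, binVal_bribeCost]
  simp only [solve, Bool.or_eq_true, Bool.and_eq_true, binLe_eq, decide_eq_true_eq, OBS.Succeeds,
    HasGoodChoice]
  refine or_congr (and_congr ?_ ?_) (and_congr ?_ ?_)
  · simp only [unbribedPos, rawOBS, hs, binVal_encodeNat]
  · rw [← hs, ← h' _ I.ballot, ← rawCast_map rp rq]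
    simp [Pos.Wins, unbribedPos, rawOBS]
  · simp only [bribedPos, rawOBS, hs', binVal_encodeNat]
  · rw [← hs', Pos.Wins, if_pos (show (bribedPos _ _ _).active = true from rfl),
      if_neg (show ¬ (bribedPos _ _ _).nature = true from Bool.false_ne_true)]
    simp only [← h', ← rawCast_map rp rq]
    exact ⟨fun ⟨l, hl, H⟩ => ⟨⟨l, (orders_iff hC).1 hl⟩, H⟩,
      fun ⟨τ, H⟩ => ⟨τ.1, (orders_iff hC).2 τ.2, H⟩⟩

theorem constructiveGoal_iff (E : ElectionSystem) (I : OBS p w) (L : List Name)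
    (U : Multiset (Vote I.C)) : I.ConstructiveGoal E U ↔
      ∃ c ∈ likedFrom (rawOBS rp rq I L), c ∈ E.winners I.C U := by
  have h : ∀ c, c ∈ likedFrom (rawOBS rp rq I L) ↔ I.σ.1.idxOf c < I.σ.1.idxOf I.d ∨ c = I.d :=
    fun c => by
      rw [likedFrom, List.mem_append, List.mem_singleton]
      exact or_congr_left (mem_takeWhile_iff_idxOf_lt _ _ _)
  have hd : I.d ∈ I.σ.1 := by rw [← List.mem_toFinset, I.σ.2.2]; exact I.d_mem
  simp only [h, OBS.ConstructiveGoal, Ranking.WeaklyPrefers, Nat.le_iff_lt_or_eq]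
  refine exists_congr fun c => ?_
  rw [and_comm]
  refine and_congr_left fun hc => or_congr_right ⟨fun he => ?_, fun he => he ▸ rfl⟩
  exact ((List.idxOf_inj hd).1 he.symm).symm

/-- The goal runs over winners and the program over a part of the briber's order. They meet because
winners are candidates and so occur in that order. -/
theorem destructiveGoal_iff (E : ElectionSystem) (I : OBS p w) (L : List Name)
    (U : Multiset (Vote I.C)) : I.DestructiveGoal E U ↔
      ∀ c ∈ dislikedFrom (rawOBS rp rq I L), c ∉ E.winners I.C U := by
  refine forall_congr' fun c => ?_
  rw [imp_not_comm]
  refine ⟨fun h h₁ h₂ => h ?_ h₂, fun h h₁ h₂ => h ?_ h₂⟩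
  all_goals
    have hc : c ∈ I.σ.1 := by
      rw [← List.mem_toFinset, I.σ.2.2]
      exact E.winners_subset _ _ h₂
  · exact (mem_dropWhile_iff_idxOf_le I.d I.σ.2.1 hc).1 h₁
  · exact (mem_dropWhile_iff_idxOf_le I.d I.σ.2.1 hc).2 h₁

open Classical in
/-- Read a setting, check that it is one, and solve it. -/
noncomputable def decideOBS (W : Language Γ') (g h neg : Bool) (D : RawOBS → List Name)
    (s : List Γ') : Bool :=
  decide (encRawOBS g h (parseOBS g h s).1 = s) &&
    (validOBS g h (parseOBS g h s).1 && solve W g h neg D (parseOBS g h s).1)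

/-- The parser is total and may return anything on a malformed string. Comparing the input with the
code of the parsed tuple, and validating that tuple, leaves exactly the codes of settings. -/
theorem decideOBS_iff (E : ElectionSystem) (neg : Bool) (D : RawOBS → List Name)
    (goal : (I : OBS p w) → Multiset (Vote I.C) → Prop)
    (hD : ∀ (I : OBS p w) L U, goal I U ↔
      bif neg then ∀ c ∈ D (rawOBS rp rq I L), c ∉ E.winners I.C U
      else ∃ c ∈ D (rawOBS rp rq I L), c ∈ E.winners I.C U) (s : List Γ') :
    decideOBS (winnerProblem E w) rp.isGiven rq.isGiven neg D s = true ↔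
      ∃ (I : OBS p w) (L : List Name), L.Nodup ∧ L.toFinset = I.C ∧ I.Succeeds (goal I) ∧
        s = I.enc L := by
  simp only [decideOBS, Bool.and_eq_true, decide_eq_true_eq]
  constructor
  · rintro ⟨h₁, h₂, h₃⟩
    obtain ⟨I, L, hL, hC, hr⟩ := (validOBS_iff rp rq _).1 h₂
    rw [← hr] at h₁ h₃
    exact ⟨I, L, hL, hC, (solve_iff rp rq E neg D I hL hC (hD I L)).1 h₃,
      h₁.symm.trans (encRawOBS_rawOBS rp rq I L)⟩
  · rintro ⟨I, L, hL, hC, hI, rfl⟩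
    have h := reads_OBS rp rq (I, L) []
    rw [List.append_nil] at h
    rw [h]
    exact ⟨encRawOBS_rawOBS rp rq I L, (validOBS_iff rp rq _).2 ⟨I, L, hL, hC, rfl⟩,
      (solve_iff rp rq E neg D I hL hC (hD I L)).2 hI⟩

end Correct

section Space

variable {M : TM2ComputableAux Γ' Bool}

theorem ps_likedFrom : PS M likedFrom := by
  have := PS.takeWhile (M := M) (f := fun (r : RawOBS) (a : Name) =>
    !decide (a = r.2.2.2.2.2.1)) (l := fun r => r.2.2.2.2.1) ((decide_name.comp
      (show PS M fun q : RawOBS × Name => (q.2, q.1.2.2.2.2.2.1) by fun_prop)).not') (by fun_prop)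
  unfold likedFrom
  fun_prop

theorem ps_dislikedFrom : PS M dislikedFrom :=
  PS.dropWhile (M := M) (f := fun (r : RawOBS) (a : Name) =>
    !decide (a = r.2.2.2.2.2.1)) (l := fun r => r.2.2.2.2.1) ((decide_name.comp
      (show PS M fun q : RawOBS × Name => (q.2, q.1.2.2.2.2.2.1) by fun_prop)).not') (by fun_prop)

/-- An addition lengthens the total by the number of digits of the cost plus one, so the growth over
the fold is additive. -/
theorem ps_rawSpent (g : Bool) : PS M (rawSpent g) := by
  have h : PS M fun q : List RawPast × List Bool × RawPast =>
      bif q.2.2.2.2 then binAdd q.2.1 (bribeCost g q.2.2.1) else q.2.1 := by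
    unfold bribeCost
    fun_prop
  refine PS.foldl (f := fun (_ : List RawPast) s (v : RawPast) =>
    bif v.2.2 then binAdd s (bribeCost g v.1) else s) (s := fun _ => []) (l := fun l => l) h
    (by fun_prop) (by fun_prop) (c := fun q => 2 * sz q + 2)
    (((PolyBdd.const 2).mul .self).add (.const 2)) fun x s v => ?_
  cases v.2.2
  · exact Nat.le_add_right _ _
  · have h₁ : (bribeCost g v.1).length ≤ sz (x, v) := by
      have h₂ : sz (x, v) = 1 + sz x + (1 + (1 + sz v.1.1 + (1 + sz v.1.2.1 + sz v.1.2.2)) +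
        sz v.2) := rfl
      cases g
      · simp only [bribeCost, cond_false, List.length_singleton]; omega
      · have := sz_digits v.1.2.1
        simp only [bribeCost, cond_true]
        omega
    simp only [cond_true, sz_digits, length_binAdd]
    omega

theorem ps_unbribedPos (g : Bool) {D : RawOBS → List Name} (hD : PS M D) :
    PS M (unbribedPos g D) := by
  have h₁ := ps_rawSpent (M := M) g
  have h₂ : PS M rawCast :=
    PS.map (f := fun (_ : List RawPast) (v : RawPast) => (v.1.1, v.1.2.2, v.2.1)) (by fun_prop)
      PS.id'
  unfold unbribedPos
  fun_prop

theorem ps_bribedPos (g : Bool) {D : RawOBS → List Name} (hD : PS M D) :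
    PS M (bribedPos g D) := by
  have h₁ := ps_rawSpent (M := M) g
  have h₂ : PS M rawCast :=
    PS.map (f := fun (_ : List RawPast) (v : RawPast) => (v.1.1, v.1.2.2, v.2.1)) (by fun_prop)
      PS.id'
  unfold bribedPos bribeCost
  fun_prop

open Classical in
theorem ps_mem {W : Language Γ'} (T : DecidesInPolySpace W) :
    PS T.toTM2ComputableAux fun s : List Γ' => decide (s ∈ W) :=
  (maps_oracle T).congr (fun s => (enc_string s).symm) fun _ => rfl

theorem ps_solve {W : Language Γ'} (T : DecidesInPolySpace W) (g h neg : Bool)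
    {D : RawOBS → List Name} (hD : PS T.toTM2ComputableAux D) :
    PS T.toTM2ComputableAux (solve W g h neg D) := by
  classical
  have hgoal : PS T.toTM2ComputableAux (rawGoal W h neg) := by
    have := PS.any (M := T.toTM2ComputableAux)
      (f := fun (q : List Name × List Name × List RawVote) c =>
        decide (encRawQuery h q.1 q.2.2 c ∈ W)) (l := fun q => q.2.1)
      ((ps_mem T).comp ((ps_encRawQuery h).comp
        (show PS _ fun q : (List Name × List Name × List RawVote) × Name =>
          (q.1.1, q.1.2.2, q.2) by fun_prop))) (by fun_prop)
    unfold rawGoal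
    fun_prop
  have h₁ := ps_unbribedPos g hD
  have h₂ := ps_bribedPos g hD
  have hk : PS T.toTM2ComputableAux fun r : RawOBS => r.2.2.2.2.2.2 := by fun_prop
  exact ((ps_binLe (Pos.ps_spent.comp h₁) hk).and' ((Pos.ps_wins g hgoal).comp h₁)).or'
    ((ps_binLe (Pos.ps_spent.comp h₂) hk).and' ((Pos.ps_wins g hgoal).comp h₂))

theorem ps_decideOBS {W : Language Γ'} (T : DecidesInPolySpace W) (g h neg : Bool)
    {D : RawOBS → List Name} (hD : PS T.toTM2ComputableAux D) :
    PS T.toTM2ComputableAux (decideOBS W g h neg D) := by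
  classical
  have h₁ := PS.fst.comp (isParser_OBS (M := T.toTM2ComputableAux) g h).ps
  have h₂ : PS T.toTM2ComputableAux fun q : List Γ' × List Γ' => decide (q.1 = q.2) :=
    (PS.decide_list PS.decide_symbol .blank).congr' fun q => decide_eq_decide.2 Iff.rfl
  exact (h₂.comp (((ps_encRawOBS g h).comp h₁).pair PS.id')).and'
    (((ps_validOBS g h).comp h₁).and' ((ps_solve T g h neg hD).comp h₁))

theorem mem_PSPACE_of_ps {L : Language Γ'} {f : List Γ' → Bool} (hf : PS M f)
    (h : ∀ s, f s = true ↔ s ∈ L) : L ∈ PSPACE := by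
  classical
  refine mem_PSPACE_of_maps (M := M) (hf.congr enc_string fun s => ?_)
  have : f s = decide (s ∈ L) := by rw [Bool.eq_iff_iff, h, decide_eq_true_iff]
  rw [this]
  rfl

end Space

/-- The constructive goal asks whether some liked candidate wins, the destructive one whether no
disliked candidate does. Both are instances of `decideOBS`, and the choice of `rp` and `rq` covers
all eight problems. -/
theorem bribery_mem_PSPACE (E : ElectionSystem) {p w : Attribute} (rp : p.Repr) (rq : w.Repr)
    (h : winnerProblem E w ∈ PTIME ∨ winnerProblem E w ∈ PSPACE) :
    constructiveProblem E p w ∈ PSPACE ∧ destructiveProblem E p w ∈ PSPACE := by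
  obtain ⟨T⟩ : winnerProblem E w ∈ PSPACE := h.elim (fun h => PTIME_subset_PSPACE h) id
  exact ⟨mem_PSPACE_of_ps (ps_decideOBS T rp.isGiven rq.isGiven false ps_likedFrom)
      (decideOBS_iff rp rq E false likedFrom _ fun I L U => constructiveGoal_iff rp rq E I L U),
    mem_PSPACE_of_ps (ps_decideOBS T rp.isGiven rq.isGiven true ps_dislikedFrom)
      (decideOBS_iff rp rq E true dislikedFrom _ fun I L U => destructiveGoal_iff rp rq E I L U)⟩

end

end OnlineBribery

theorem theorem1 (E : OnlineBribery.ElectionSystem) :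
    ((OnlineBribery.unweightedWinnerProblem E ∈ OnlineBribery.PTIME ∨
        OnlineBribery.unweightedWinnerProblem E ∈ OnlineBribery.PSPACE) →
      OnlineBribery.onlineBribery E ∈ OnlineBribery.PSPACE ∧
      OnlineBribery.onlineDestructiveBribery E ∈ OnlineBribery.PSPACE ∧
      OnlineBribery.onlinePricedBribery E ∈ OnlineBribery.PSPACE ∧
      OnlineBribery.onlineDestructivePricedBribery E ∈ OnlineBribery.PSPACE) ∧
    ((OnlineBribery.weightedWinnerProblem E ∈ OnlineBribery.PTIME ∨
        OnlineBribery.weightedWinnerProblem E ∈ OnlineBribery.PSPACE) →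
      OnlineBribery.onlineWeightedBribery E ∈ OnlineBribery.PSPACE ∧
      OnlineBribery.onlineDestructiveWeightedBribery E ∈ OnlineBribery.PSPACE ∧
      OnlineBribery.onlinePricedWeightedBribery E ∈ OnlineBribery.PSPACE ∧
      OnlineBribery.onlineDestructivePricedWeightedBribery E ∈ OnlineBribery.PSPACE) :=
  ⟨fun h =>
    have h₁ := OnlineBribery.bribery_mem_PSPACE E .absent .absent h
    have h₂ := OnlineBribery.bribery_mem_PSPACE E .given .absent h
    ⟨h₁.1, h₁.2, h₂.1, h₂.2⟩,
  fun h =>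
    have h₁ := OnlineBribery.bribery_mem_PSPACE E .absent .given h
    have h₂ := OnlineBribery.bribery_mem_PSPACE E .given .given h
    ⟨h₁.1, h₁.2, h₂.1, h₂.2⟩⟩
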